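/- Let $d\in\mathbb N$. A Banach space $E$ of (classes of a.e. equal, complex-valued) functions on $\mathbb R^d$ is called a translation-invariant Banach function space (TIBF) of bounded type if $E\neq\{0\}$, $E\subseteq L^1_{\mathrm{loc}}(\mathbb R^d)$ continuously, $T_xE\subseteq E$ for all $x\in\mathbb R^d$ (where $T_xf(t)=f(t-x)$), there is $C_0>0$ with $\|T_xf\|_E\le C_0\|f\|_E$ for all $x\in\mathbb R^d$, $f\in E$, and $E*C_c(\mathbb R^d)\subseteq E$. It is solid if for all $f\in E$ and $g\in L^1_{\mathrm{loc}}(\mathbb R^d)$ with $|g|\le|f|$ a.e. one has $g\in E$ and $\|g\|_E\le\|f\|_E$. A weight function system is a sequence $\mathcal W=(w_n)_{n\in\mathbb N}$ of locally bounded measurable functions $w_n:\mathbb R^d\to[1,\infty)$ with $w_n\le w_{n+1}$. It satisfies (wM) if for every $n$ there are $m\ge n$ and $C>0$ with $w_n(x+y)\le Cw_m(x)$ for all $x\in\mathbb R^d$, $|y|\le1$. Given another weight function system $\mathcal V=(v_n)_{n\in\mathbb N}$, $\mathcal W$ is called $\mathcal V$-moderate if for every $n$ there are $m\ge n$ and $C>0$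 with $w_n(x+y)\le C\,w_m(x)\,v_m(y)$ for all $x,y\in\mathbb R^d$. Put $E_{\mathcal W}=\{f\in L^1_{\mathrm{loc}}(\mathbb R^d): fw_n\in E\text{ for all }n\}$ and let $\mathcal K^1_{\mathcal V}=\{\varphi\in C^\infty(\mathbb R^d):\varphi^{(\alpha)}v_n\in L^1(\mathbb R^d)\text{ for all }n\in\mathbb N,\ \alpha\in\mathbb N^d\}$ with the Fréchet topology given by the seminorms $\|\varphi^{(\alpha)}v_n\|_{L^1}$. Let $\mathcal D=C_c^\infty(\mathbb R^d)$ with dual $\mathcal D'$, write $\check\varphi(t)=\varphi(-t)$, $\check{\mathcal V}=(\check v_n)_{n\in\mathbb N}$ and $f*\varphi(x)=\langle f,T_x\check\varphi\rangle$, and define $$\mathcal O'_C(\mathcal D,E_{\mathcal W})=\{f\in\mathcal D': f*\varphi\in E_{\mathcal W}\text{ for all }\varphi\in\mathcal D\},$$ $$\mathcal O'_C(\mathcal K^1_{\mathcal V},E_{\mathcal W})=\{f\in(\mathcal K^1_{\check{\mathcal V}})': f*\varphi\in E_{\mathcal W}\text{ for all }\varphi\in\mathcal K^1_{\mathcal V}\}$$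 (the latter when $\mathcal V$ satisfies (wM), so that $T_x\check\varphi\in\mathcal K^1_{\check{\mathcal V}}$). Theorem. Let $E$ be a solid TIBF of bounded type on $\mathbb R^d$ and let $\mathcal V$ and $\mathcal W$ be weight function systems satisfying (wM). Then the restriction $f\mapsto f|_{\mathcal D}$ maps $\mathcal O'_C(\mathcal K^1_{\mathcal V},E_{\mathcal W})$ injectively into $\mathcal O'_C(\mathcal D,E_{\mathcal W})$, and, regarding the former as a subset of the latter through this map, $$\mathcal O'_C(\mathcal K^1_{\mathcal V},E_{\mathcal W})=\mathcal O'_C(\mathcal D,E_{\mathcal W})$$ if and only if $\mathcal W$ is $\mathcal V$-moderate. -/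

import Mathlib

open MeasureTheory
open scoped ContDiff Distributions

noncomputable section

/-- The Euclidean space `ℝ^d`. -/
abbrev Rd (d : ℕ) : Type := EuclideanSpace ℝ (Fin d)

/-! ### Translation-invariant Banach function spaces -/

/-- A Banach space `E` of classes of functions on `ℝ^d` is given by an (injective) linear map `ι`
into the space of a.e.-classes of measurable functions. `Represents ι e f` says that the element
`e` of `E` is the class of `f`; so `f` belongs to `E` iff `∃ e, Represents ι e f`. -/
def Represents {d : ℕ} {E : Type*} [NormedAddCommGroup E] [NormedSpace ℂ E]
    (ι : E →ₗ[ℂ] (Rd d →ₘ[(volume : Measure (Rd d))] ℂ)) (e : E) (f : Rd d → ℂ) : Prop :=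
  (ι e : Rd d → ℂ) =ᵐ[volume] f

/-- The Banach space `E` (with its embedding `ι` into classes of functions) is a
translation-invariant Banach function space of bounded type on `ℝ^d`. -/
structure IsTIBF {d : ℕ} {E : Type*} [NormedAddCommGroup E] [NormedSpace ℂ E]
    (ι : E →ₗ[ℂ] (Rd d →ₘ[(volume : Measure (Rd d))] ℂ)) : Prop where
  complete : CompleteSpace E
  nontrivial : Nontrivial E
  injective : Function.Injective ι
  locallyIntegrable : ∀ e : E, LocallyIntegrable (ι e : Rd d → ℂ) volume
  /-- The inclusion of `E` into the Fréchet space `L¹_loc` is continuous. -/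
  continuous_inclusion : ∀ K : Set (Rd d), IsCompact K →
    ∃ C : ℝ, ∀ e : E, ∫ x in K, ‖(ι e : Rd d → ℂ) x‖ ≤ C * ‖e‖
  /-- `T_x E ⊆ E`, where `T_x f (t) = f (t - x)`. -/
  translate_mem : ∀ (x : Rd d) (e : E),
    ∃ e' : E, Represents ι e' (fun t => (ι e : Rd d → ℂ) (t - x))
  /-- The translations are uniformly bounded on `E`. -/
  translate_bound : ∃ C₀ : ℝ, 0 < C₀ ∧ ∀ (x : Rd d) (e e' : E),
    Represents ι e' (fun t => (ι e : Rd d → ℂ) (t - x)) → ‖e'‖ ≤ C₀ * ‖e‖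
  /-- `E * C_c ⊆ E`. -/
  conv_mem : ∀ (e : E) (ψ : Rd d → ℂ), Continuous ψ → HasCompactSupport ψ →
    ∃ e' : E, Represents ι e' (fun x => ∫ t, (ι e : Rd d → ℂ) t * ψ (x - t))

/-- Solidity of the Banach function space `E`. -/
def IsSolid {d : ℕ} {E : Type*} [NormedAddCommGroup E] [NormedSpace ℂ E]
    (ι : E →ₗ[ℂ] (Rd d →ₘ[(volume : Measure (Rd d))] ℂ)) : Prop :=
  ∀ (e : E) (g : Rd d → ℂ), LocallyIntegrable g volume →
    (∀ᵐ x ∂(volume : Measure (Rd d)), ‖g x‖ ≤ ‖(ι e : Rd d → ℂ) x‖) →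
    ∃ e' : E, Represents ι e' g ∧ ‖e'‖ ≤ ‖e‖

/-! ### Weight function systems -/

/-- A weight function system on `ℝ^d`: an increasing sequence of measurable, locally bounded
functions with values in `[1, ∞)`. -/
structure WeightSystem (d : ℕ) where
  w : ℕ → Rd d → ℝ
  measurable : ∀ n, Measurable (w n)
  locallyBounded : ∀ n (K : Set (Rd d)), IsCompact K → ∃ C : ℝ, ∀ x ∈ K, w n x ≤ C
  one_le : ∀ n x, 1 ≤ w n x
  le_succ : ∀ n x, w n x ≤ w (n + 1) x

namespace WeightSystem

variable {d : ℕ}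

/-- The condition `(wM)`. -/
def WeaklyModerate (W : WeightSystem d) : Prop :=
  ∀ n, ∃ m, n ≤ m ∧ ∃ C : ℝ, 0 < C ∧
    ∀ x y : Rd d, y ∈ Metric.closedBall (0 : Rd d) 1 → W.w n (x + y) ≤ C * W.w m x

/-- `W` is `V`-moderate. -/
def IsModerate (W V : WeightSystem d) : Prop :=
  ∀ n, ∃ m, n ≤ m ∧ ∃ C : ℝ, 0 < C ∧
    ∀ x y : Rd d, W.w n (x + y) ≤ C * W.w m x * V.w m y

/-- The reflected weight function system `x ↦ w_n (-x)`. -/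
def check (W : WeightSystem d) : WeightSystem d where
  w n x := W.w n (-x)
  measurable n := (W.measurable n).comp measurable_neg
  locallyBounded n K hK := by
    obtain ⟨C, hC⟩ := W.locallyBounded n (Neg.neg '' K) (hK.image continuous_neg)
    exact ⟨C, fun x hx => hC _ ⟨x, hx, rfl⟩⟩
  one_le n x := W.one_le n (-x)
  le_succ n x := W.le_succ n (-x)

/-- Iterating `(wM)`: the unit ball may be replaced by any single translate. -/
theorem WeaklyModerate.translate {W : WeightSystem d} (hW : W.WeaklyModerate) (n : ℕ)
    (y : Rd d) : ∃ (m : ℕ) (C : ℝ), ∀ x : Rd d, W.w n (x + y) ≤ C * W.w m x := by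
  have key : ∀ (N : ℕ) (n : ℕ) (z : Rd d), ‖z‖ ≤ 1 →
      ∃ (m : ℕ) (C : ℝ), 0 < C ∧ ∀ x : Rd d, W.w n (x + (N : ℝ) • z) ≤ C * W.w m x := by
    intro N
    induction N with
    | zero => intro n z _; exact ⟨n, 1, one_pos, fun x => by simp⟩
    | succ N ih =>
      intro n z hz
      obtain ⟨m, _, C, hC, h⟩ := hW n
      obtain ⟨m', C', hC', h'⟩ := ih m z hz
      refine ⟨m', C * C', by positivity, fun x => ?_⟩
      have e : x + ((N + 1 : ℕ) : ℝ) • z = (x + (N : ℝ) • z) + z := by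
        push_cast; rw [add_smul, one_smul, add_assoc]
      rw [e, mul_assoc]
      exact (h _ z (by simpa using hz)).trans (mul_le_mul_of_nonneg_left (h' x) hC.le)
  obtain ⟨N, hN⟩ := exists_nat_gt ‖y‖
  have hN0 : (0 : ℝ) < N := lt_of_le_of_lt (norm_nonneg y) hN
  obtain ⟨m, C, _, h⟩ := key N n ((N : ℝ)⁻¹ • y) (by
    rw [norm_smul, norm_inv, Real.norm_natCast, inv_mul_le_iff₀ hN0]; linarith)
  refine ⟨m, C, fun x => ?_⟩
  have := h x
  rwa [smul_smul, mul_inv_cancel₀ hN0.ne', one_smul] at this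

end WeightSystem

/-! ### The space `E_W` -/

/-- The function `f` belongs to `E_W = {f ∈ L¹_loc | f w_n ∈ E for all n}`. -/
def MemWeighted {d : ℕ} {E : Type*} [NormedAddCommGroup E] [NormedSpace ℂ E]
    (ι : E →ₗ[ℂ] (Rd d →ₘ[(volume : Measure (Rd d))] ℂ)) (W : WeightSystem d)
    (f : Rd d → ℂ) : Prop :=
  LocallyIntegrable f volume ∧ ∀ n, ∃ e : E, Represents ι e (fun x => (W.w n x : ℂ) * f x)

/-! ### The Fréchet space `𝒦¹_V` -/

/-- The iterated partial derivative `∂_{s 0} ⋯ ∂_{s (k-1)} f`. For smooth `f`, the derivatives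
`f^(α)` over all multi-indices `α` with `|α| = k` are exactly these functions. -/
def partialDeriv {d k : ℕ} (s : Fin k → Fin d) (f : Rd d → ℂ) (x : Rd d) : ℂ :=
  iteratedFDeriv ℝ k f x (fun i => EuclideanSpace.single (s i) (1 : ℝ))

theorem continuous_partialDeriv {d k : ℕ} (s : Fin k → Fin d) {f : Rd d → ℂ}
    (hf : ContDiff ℝ ∞ f) : Continuous (partialDeriv s f) :=
  (ContinuousMultilinearMap.apply ℝ (fun _ : Fin k => Rd d) ℂ
    (fun i => EuclideanSpace.single (s i) (1 : ℝ))).continuous.comp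
      (hf.continuous_iteratedFDeriv (by exact_mod_cast le_top))

theorem partialDeriv_add {d k : ℕ} (s : Fin k → Fin d) {f g : Rd d → ℂ}
    (hf : ContDiff ℝ ∞ f) (hg : ContDiff ℝ ∞ g) (x : Rd d) :
    partialDeriv s (f + g) x = partialDeriv s f x + partialDeriv s g x := by
  unfold partialDeriv
  rw [iteratedFDeriv_add_apply (hf.contDiffAt.of_le (by exact_mod_cast le_top))
    (hg.contDiffAt.of_le (by exact_mod_cast le_top))]
  rfl

theorem partialDeriv_smul {d k : ℕ} (s : Fin k → Fin d) {f : Rd d → ℂ}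
    (hf : ContDiff ℝ ∞ f) (c : ℂ) (x : Rd d) :
    partialDeriv s (c • f) x = c * partialDeriv s f x := by
  unfold partialDeriv
  rw [iteratedFDeriv_const_smul_apply (hf.contDiffAt.of_le (by exact_mod_cast le_top))]
  rfl

/-- `∂^s [t ↦ f (x - t)] = ± (∂^s f) (x - ·)`. -/
theorem partialDeriv_const_sub {d k : ℕ} (s : Fin k → Fin d) {f : Rd d → ℂ}
    (hf : ContDiff ℝ ∞ f) (x t : Rd d) :
    partialDeriv s (fun t => f (x - t)) t = (-1 : ℂ) ^ k * partialDeriv s f (x - t) := by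
  have h1 : (fun t => f (x - t)) =
      (fun u => f (x + u)) ∘ (-(ContinuousLinearMap.id ℝ (Rd d))) := by
    funext t; simp [sub_eq_add_neg]
  have hg : ContDiff ℝ ∞ (fun u => f (x + u)) := hf.comp (contDiff_const.add contDiff_id)
  unfold partialDeriv
  rw [h1, ContinuousLinearMap.iteratedFDeriv_comp_right _ hg _ (by exact_mod_cast le_top),
    iteratedFDeriv_comp_add_left]
  have h2 := (iteratedFDeriv ℝ k f (x - t)).map_smul_univ (fun _ => (-1 : ℝ))
    (fun i => EuclideanSpace.single (s i) (1 : ℝ))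
  simp only [ContinuousMultilinearMap.compContinuousLinearMap_apply]
  simpa [sub_eq_add_neg] using h2

/-- The underlying vector space of `𝒦¹_V`: the smooth functions `f` such that `f^(α) v_n ∈ L¹`
for all `n` and `α`. -/
def K1Submodule {d : ℕ} (V : WeightSystem d) : Submodule ℂ (Rd d → ℂ) where
  carrier := {f | ContDiff ℝ ∞ f ∧ ∀ (n k : ℕ) (s : Fin k → Fin d),
    Integrable (fun x => (V.w n x : ℂ) * partialDeriv s f x) volume}
  zero_mem' := by
    refine ⟨contDiff_const, fun n k s => ?_⟩
    have : (fun x => (V.w n x : ℂ) * partialDeriv s (0 : Rd d → ℂ) x) = fun _ => 0 := by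
      funext x
      have := partialDeriv_smul s (f := (0 : Rd d → ℂ)) contDiff_const 0 x
      rw [zero_smul, zero_mul] at this
      rw [this, mul_zero]
    rw [this]
    exact integrable_zero _ _ _
  add_mem' := by
    rintro f g ⟨hf, hf'⟩ ⟨hg, hg'⟩
    refine ⟨hf.add hg, fun n k s => ((hf' n k s).add (hg' n k s)).congr ?_⟩
    exact Filter.Eventually.of_forall fun x => by
      simp only [Pi.add_apply, partialDeriv_add s hf hg, mul_add]
  smul_mem' := by
    rintro c f ⟨hf, hf'⟩
    refine ⟨contDiff_const.smul hf, fun n k s => ((hf' n k s).const_mul c).congr ?_⟩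
    exact Filter.Eventually.of_forall fun x => by
      simp only [partialDeriv_smul s hf]; ring

/-- The space `𝒦¹_V`; its topology is the Fréchet topology defined below (not the topology of
pointwise convergence). -/
def K1 {d : ℕ} (V : WeightSystem d) : Type := K1Submodule V

namespace K1

variable {d : ℕ} {V : WeightSystem d}

instance : AddCommGroup (K1 V) := inferInstanceAs (AddCommGroup (K1Submodule V))
instance : Module ℂ (K1 V) := inferInstanceAs (Module ℂ (K1Submodule V))
instance : CoeFun (K1 V) (fun _ => Rd d → ℂ) := ⟨Subtype.val⟩

/-- Build an element of `𝒦¹_V`. -/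
def mk (f : Rd d → ℂ) (hf : f ∈ K1Submodule V) : K1 V := ⟨f, hf⟩

theorem contDiff (f : K1 V) : ContDiff ℝ ∞ (f : Rd d → ℂ) := f.2.1

theorem integrable (f : K1 V) (n k : ℕ) (s : Fin k → Fin d) :
    Integrable (fun x => (V.w n x : ℂ) * partialDeriv s f x) volume := f.2.2 n k s

theorem coe_add (f g : K1 V) : ((f + g : K1 V) : Rd d → ℂ) = (f : Rd d → ℂ) + (g : Rd d → ℂ) := rfl

theorem coe_smul (c : ℂ) (f : K1 V) : ((c • f : K1 V) : Rd d → ℂ) = c • (f : Rd d → ℂ) := rfl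

variable (V) in
/-- The seminorms `f ↦ ‖f^(α) v_n‖_{L¹}` of `𝒦¹_V`. -/
def seminormFamily : SeminormFamily ℂ (K1 V) (ℕ × Σ k : ℕ, (Fin k → Fin d)) := fun i =>
  Seminorm.of (fun f => ∫ x, ‖(V.w i.1 x : ℂ) * partialDeriv i.2.2 f x‖)
    (fun f g => by
      have h := integral_mono_of_nonneg (μ := (volume : Measure (Rd d)))
        (f := fun x => ‖(V.w i.1 x : ℂ) * partialDeriv i.2.2 (f + g : K1 V) x‖)
        (g := fun x => ‖(V.w i.1 x : ℂ) * partialDeriv i.2.2 f x‖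
          + ‖(V.w i.1 x : ℂ) * partialDeriv i.2.2 g x‖)
        (Filter.Eventually.of_forall fun _ => norm_nonneg _)
        ((f.integrable _ _ _).norm.add (g.integrable _ _ _).norm)
        (Filter.Eventually.of_forall fun x => by
          simp only [coe_add, partialDeriv_add i.2.2 f.contDiff g.contDiff, mul_add]
          exact norm_add_le _ _)
      rwa [integral_add (f.integrable _ _ _).norm (g.integrable _ _ _).norm] at h)
    (fun c f => by
      rw [← integral_const_mul]
      congr 1
      funext x
      rw [coe_smul, partialDeriv_smul i.2.2 f.contDiff, mul_left_comm, norm_mul c])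

instance : Nonempty (ℕ × Σ k : ℕ, (Fin k → Fin d)) := ⟨(0, ⟨0, Fin.elim0⟩)⟩

/-- The Fréchet space topology of `𝒦¹_V`. -/
instance : TopologicalSpace (K1 V) := (seminormFamily V).moduleFilterBasis.topology

theorem withSeminorms : WithSeminorms (seminormFamily V) := ⟨rfl⟩

instance : IsTopologicalAddGroup (K1 V) := withSeminorms.topologicalAddGroup
instance : ContinuousSMul ℂ (K1 V) := withSeminorms.continuousSMul
instance : ContinuousSMul ℝ (K1 V) := IsScalarTower.continuousSMul ℂ
instance : LocallyConvexSpace ℝ (K1 V) := withSeminorms.toLocallyConvexSpace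

/-- For `φ ∈ 𝒦¹_V` the function `T_x φ̌ : t ↦ φ (x - t)`, which belongs to the space `𝒦¹` of
the reflected weights if `V` satisfies `(wM)`. -/
def transReflect (hV : V.WeaklyModerate) (x : Rd d) (φ : K1 V) : K1 V.check :=
  mk (fun t => φ (x - t)) (by
    refine ⟨φ.contDiff.comp (contDiff_const.sub contDiff_id), fun n k s => ?_⟩
    obtain ⟨m, C, hC⟩ := hV.translate n (-x)
    have h1 : Integrable (fun u => (V.w n (u + -x) : ℂ) * partialDeriv s φ u) volume := by
      refine ((φ.integrable m k s).const_mul (C : ℂ)).mono ?_ ?_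
      · exact ((Complex.measurable_ofReal.comp ((V.measurable n).comp
          (measurable_id.add_const (-x)))).mul
          (continuous_partialDeriv s φ.contDiff).measurable).aestronglyMeasurable
      · refine Filter.Eventually.of_forall fun u => ?_
        have h0 : 0 ≤ V.w n (u + -x) := zero_le_one.trans (V.one_le _ _)
        rw [← mul_assoc, norm_mul, norm_mul, ← Complex.ofReal_mul, Complex.norm_real,
          Complex.norm_real, Real.norm_of_nonneg h0, Real.norm_of_nonneg (h0.trans (hC u))]
        exact mul_le_mul_of_nonneg_right (hC u) (norm_nonneg _)
    refine ((h1.comp_sub_left x).const_mul ((-1 : ℂ) ^ k)).congr ?_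
    refine Filter.Eventually.of_forall fun t => ?_
    have e : x - t + -x = -t := by abel
    simp only [partialDeriv_const_sub s φ.contDiff, WeightSystem.check, e]
    ring)

/-- A compactly supported smooth function belongs to `𝒦¹_V`. -/
theorem mem_of_hasCompactSupport {f : Rd d → ℂ} (hf : ContDiff ℝ ∞ f)
    (hc : HasCompactSupport f) : f ∈ K1Submodule V := by
  refine ⟨hf, fun n k s => ?_⟩
  have hcont := continuous_partialDeriv s hf
  have hsupp : HasCompactSupport (partialDeriv s f) := by
    refine (hc.iteratedFDeriv (𝕜 := ℝ) k).comp_left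
      (g := fun L => L (fun i => EuclideanSpace.single (s i) (1 : ℝ))) rfl
  obtain ⟨C, hC⟩ := V.locallyBounded n _ hsupp
  refine ((hcont.integrable_of_hasCompactSupport hsupp).const_mul (C : ℂ)).mono ?_ ?_
  · exact ((Complex.measurable_ofReal.comp (V.measurable n)).mul
      hcont.measurable).aestronglyMeasurable
  · refine Filter.Eventually.of_forall fun x => ?_
    by_cases hx : x ∈ tsupport (partialDeriv s f)
    · have h0 : 0 ≤ V.w n x := zero_le_one.trans (V.one_le _ _)
      rw [norm_mul, norm_mul, Complex.norm_real, Complex.norm_real, Real.norm_of_nonneg h0,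
        Real.norm_of_nonneg (h0.trans (hC x hx))]
      exact mul_le_mul_of_nonneg_right (hC x hx) (norm_nonneg _)
    · rw [image_eq_zero_of_notMem_tsupport hx]; simp

end K1

/-! ### Distributions and convolutors -/

/-- The space `𝒟` of complex-valued test functions on `ℝ^d`, with its `(LF)`-topology. -/
abbrev TestFn (d : ℕ) : Type := 𝓓((⊤ : TopologicalSpace.Opens (Rd d)), ℂ)

/-- The space `𝒟'` of distributions on `ℝ^d`. -/
abbrev CDistribution (d : ℕ) : Type := TestFn d →L[ℂ] ℂ

/-- The dual of the Fréchet space `𝒦¹_V`. -/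
abbrev K1Dual {d : ℕ} (V : WeightSystem d) : Type := K1 V →L[ℂ] ℂ

/-- For `φ ∈ 𝒟` the test function `T_x φ̌ : t ↦ φ (x - t)`. -/
def TestFn.transReflect {d : ℕ} (x : Rd d) (φ : TestFn d) : TestFn d where
  toFun t := φ (x - t)
  contDiff' := φ.contDiff.comp (contDiff_const.sub contDiff_id)
  hasCompactSupport' := φ.hasCompactSupport.comp_homeomorph (Homeomorph.subLeft x)
  tsupport_subset' := fun _ _ => trivial

theorem norm_partialDeriv_le {d k : ℕ} (s : Fin k → Fin d) (f : Rd d → ℂ) (x : Rd d) :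
    ‖partialDeriv s f x‖ ≤ ‖iteratedFDeriv ℝ k f x‖ := by
  refine ((iteratedFDeriv ℝ k f x).le_opNorm _).trans ?_
  simp

/-- The continuous inclusion of `𝒟` into `𝒦¹_V`. -/
def TestFn.toK1 {d : ℕ} (V : WeightSystem d) : TestFn d →L[ℂ] K1 V :=
  TestFunction.mkCLM ℂ (fun φ => K1.mk φ (K1.mem_of_hasCompactSupport φ.contDiff φ.hasCompactSupport))
    (fun _ _ => rfl) (fun _ _ => rfl) (by
      intro K hK
      let L : 𝓓_{K}(Rd d, ℂ) →ₗ[ℂ] K1 V :=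
        { toFun := fun φ => K1.mk φ (K1.mem_of_hasCompactSupport φ.contDiff φ.compact_supp)
          map_add' := fun _ _ => rfl
          map_smul' := fun _ _ => rfl }
      change Continuous L
      refine WithSeminorms.continuous_of_continuous_comp K1.withSeminorms L ?_
      rintro ⟨n, k, s⟩
      obtain ⟨C, hC⟩ := V.locallyBounded n K K.isCompact
      have hC0 : 0 ≤ max C 0 := le_max_right _ _
      let A : NNReal := ⟨max C 0, hC0⟩ * ⟨(volume : Measure (Rd d)).real K, measureReal_nonneg⟩
      refine Seminorm.continuous_of_le (q := A • ContDiffMapSupportedIn.seminorm ℂ (Rd d) ℂ ⊤ K k)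
        (((ContDiffMapSupportedIn.withSeminorms ℂ (Rd d) ℂ ⊤ K).continuous_seminorm k).const_smul A) ?_
      intro φ
      change ∫ x, ‖(V.w n x : ℂ) * partialDeriv s φ x‖ ≤
        (max C 0 * (volume : Measure (Rd d)).real K) *
          ContDiffMapSupportedIn.seminorm ℂ (Rd d) ℂ ⊤ K k φ
      set N := ContDiffMapSupportedIn.seminorm ℂ (Rd d) ℂ ⊤ K k φ with hN
      have hN0 : 0 ≤ N := apply_nonneg _ _
      have hb : ∀ x, ‖(V.w n x : ℂ) * partialDeriv s φ x‖ ≤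
          (K : Set (Rd d)).indicator (fun _ => max C 0 * N) x := by
        intro x
        by_cases hx : x ∈ (K : Set (Rd d))
        · rw [Set.indicator_of_mem hx, norm_mul, Complex.norm_real,
            Real.norm_of_nonneg (zero_le_one.trans (V.one_le n x))]
          exact mul_le_mul ((hC x hx).trans (le_max_left _ _))
            ((norm_partialDeriv_le s φ x).trans
              (ContDiffMapSupportedIn.norm_iteratedFDeriv_apply_le_seminorm_top ℂ))
            (norm_nonneg _) hC0
        · rw [Set.indicator_of_notMem hx]
          have h0 : ‖partialDeriv s φ x‖ ≤ 0 := by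
            refine (norm_partialDeriv_le s φ x).trans ?_
            rw [φ.iteratedFDeriv_zero_on_compl hx]
            simp
          rw [norm_mul, le_antisymm h0 (norm_nonneg _), mul_zero]
      have hi : Integrable ((K : Set (Rd d)).indicator (fun _ => max C 0 * N)) volume :=
        (integrable_indicator_iff K.isCompact.measurableSet).2
          (integrableOn_const K.isCompact.measure_lt_top.ne)
      refine (integral_mono_of_nonneg (Filter.Eventually.of_forall fun _ => norm_nonneg _) hi
        (Filter.Eventually.of_forall hb)).trans (le_of_eq ?_)
      rw [integral_indicator K.isCompact.measurableSet, setIntegral_const, smul_eq_mul]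
      ring)

/-- The restriction to `𝒟` of a continuous linear functional on `𝒦¹_V`. -/
def restrictToTestFn {d : ℕ} (V : WeightSystem d) (F : K1Dual V) : CDistribution d :=
  F.comp (TestFn.toK1 V)

/-- The convolution `f * φ (x) = ⟨f, T_x φ̌⟩` of a distribution and a test function. -/
def convTestFn {d : ℕ} (f : CDistribution d) (φ : TestFn d) : Rd d → ℂ :=
  fun x => f (φ.transReflect x)

/-- The convolution `f * φ (x) = ⟨f, T_x φ̌⟩` of `f ∈ (𝒦¹_{V̌})'` and `φ ∈ 𝒦¹_V`. -/
def convK1 {d : ℕ} {V : WeightSystem d} (hV : V.WeaklyModerate) (f : K1Dual V.check)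
    (φ : K1 V) : Rd d → ℂ :=
  fun x => f (φ.transReflect hV x)

/-- The convolutor space `𝒪'_C(𝒟, E_W)`. -/
def OCTestFn {d : ℕ} {E : Type*} [NormedAddCommGroup E] [NormedSpace ℂ E]
    (ι : E →ₗ[ℂ] (Rd d →ₘ[(volume : Measure (Rd d))] ℂ)) (W : WeightSystem d) :
    Set (CDistribution d) :=
  {f | ∀ φ : TestFn d, MemWeighted ι W (convTestFn f φ)}

/-- The convolutor space `𝒪'_C(𝒦¹_V, E_W)`. -/
def OCK1 {d : ℕ} {E : Type*} [NormedAddCommGroup E] [NormedSpace ℂ E]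
    (ι : E →ₗ[ℂ] (Rd d →ₘ[(volume : Measure (Rd d))] ℂ)) {V : WeightSystem d}
    (hV : V.WeaklyModerate) (W : WeightSystem d) : Set (K1Dual V.check) :=
  {f | ∀ φ : K1 V, MemWeighted ι W (convK1 hV f φ)}

end

/-! Injectivity of the restriction is the density of `𝒟` in `𝒦¹`, obtained by cutting off. The
equality of the two convolutor spaces splits into two independent arguments.

Moderate weights give equality. Let `f` be a convolutor on `𝒟`. A closed graph argument, run on
`ℓ¹`-combinations of a bounded sequence of test functions, shows that for `ψ` supported in a fixed
ball the norm in `E` of `w_n (f * ψ)` is at most a sup norm of finitely many derivatives of `ψ`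
(`exists_norm_le_of_mem_OCTestFn`). A general `ψ` is cut into pieces along the lattice `ℤ^d`. Moving
the piece at `j` to the origin costs a constant, because translations are uniformly bounded on `E`,
and a factor `v(j)`, because `w_n(x) ≤ D w(x - j) v(j)`. The Sobolev inequality turns the sup norm
of the piece into an `L¹` norm of derivatives over a ball around `j`, and (wM) carries `v(j)` under
that integral. These balls overlap boundedly, so summation over `j` bounds `w_n (f * ψ)` by a
seminorm of `𝒦¹_V` (`exists_norm_le_integral_of_isModerate`). The same localization, with values at
points in place of norms in `E`, bounds `f` itself by a seminorm of the reflected space and hence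
extends it to a functional `F` (`exists_restrictToTestFn_eq`). Density, completeness of `E` and the
first estimate then put `F * φ` into `E_W` for every `φ` in `𝒦¹_V` (`mem_OCK1_of_isModerate`).

Equality forces moderateness. If the condition fails at `n`, there are points with `w_n(x_m + y_m)`
larger than `4^m (m + 1) w(x_m) v(y_m)`, the weights on the right having index tending to infinity
with `m`. Put `f = ∑ c_j δ_{x_j}` and `φ = ∑ b_j ψ(· - y_j)` with `ψ ≥ 0` a bump, `c_j = 2^{-j} /
w(x_j)` and `b_j = 2^{-j} / v(y_j)`. Then `f` is a convolutor on `𝒟` and `φ` lies in `𝒦¹_V`.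
Everything is nonnegative, so `f * φ` dominates each `c_m b_m ψ(· - x_m - y_m)`. Translating back to
the origin and using solidity bounds `(m + 1) ‖ψ‖` uniformly in `m`, which is absurd
(`isModerate_of_subset`). -/

/-! ### Derivatives of smooth functions on `ℝ^d` -/

/-- The sum of the norms of the derivatives of order at most `k`. -/
noncomputable def jetNorm {d : ℕ} {F : Type*} [NormedAddCommGroup F] [NormedSpace ℝ F] (k : ℕ)
    (φ : Rd d → F) (x : Rd d) : ℝ :=
  ∑ i ∈ Finset.range (k + 1), ‖iteratedFDeriv ℝ i φ x‖

section Jet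

variable {d : ℕ} {F : Type*} [NormedAddCommGroup F] [NormedSpace ℝ F]

theorem jetNorm_nonneg (k : ℕ) (φ : Rd d → F) (x : Rd d) : 0 ≤ jetNorm k φ x :=
  Finset.sum_nonneg fun _ _ => norm_nonneg _

theorem norm_iteratedFDeriv_le_jetNorm {i k : ℕ} (h : i ≤ k) (φ : Rd d → F) (x : Rd d) :
    ‖iteratedFDeriv ℝ i φ x‖ ≤ jetNorm k φ x :=
  Finset.single_le_sum (f := fun i => ‖iteratedFDeriv ℝ i φ x‖) (fun _ _ => norm_nonneg _)
    (Finset.mem_range.2 (Nat.lt_succ_of_le h))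

theorem norm_le_jetNorm (k : ℕ) (φ : Rd d → F) (x : Rd d) : ‖φ x‖ ≤ jetNorm k φ x := by
  simpa using norm_iteratedFDeriv_le_jetNorm (Nat.zero_le k) φ x

theorem jetNorm_mono {k l : ℕ} (h : k ≤ l) (φ : Rd d → F) (x : Rd d) :
    jetNorm k φ x ≤ jetNorm l φ x :=
  Finset.sum_le_sum_of_subset_of_nonneg (by simpa using h) fun _ _ _ => norm_nonneg _

theorem continuous_jetNorm (k : ℕ) {φ : Rd d → F} (hφ : ContDiff ℝ ∞ φ) :
    Continuous (jetNorm k φ) :=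
  continuous_finsetSum _ fun _ _ =>
    (hφ.continuous_iteratedFDeriv (by exact_mod_cast le_top)).norm

theorem jetNorm_eq_zero_of_notMem_tsupport (k : ℕ) {φ : Rd d → F} {x : Rd d}
    (hx : x ∉ tsupport φ) : jetNorm k φ x = 0 := by
  refine Finset.sum_eq_zero fun i _ => ?_
  have : x ∉ tsupport (iteratedFDeriv ℝ i φ) := fun h => hx (tsupport_iteratedFDeriv_subset i h)
  rw [image_eq_zero_of_notMem_tsupport this, norm_zero]

theorem hasCompactSupport_jetNorm (k : ℕ) {φ : Rd d → F} (hφ : HasCompactSupport φ) :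
    HasCompactSupport (jetNorm k φ) :=
  HasCompactSupport.intro hφ fun _ hx => jetNorm_eq_zero_of_notMem_tsupport k hx

theorem integrable_jetNorm (k : ℕ) {φ : Rd d → F} (hφ : ContDiff ℝ ∞ φ)
    (hc : HasCompactSupport φ) : Integrable (jetNorm k φ) volume :=
  (continuous_jetNorm k hφ).integrable_of_hasCompactSupport (hasCompactSupport_jetNorm k hc)

theorem exists_jetNorm_le (k : ℕ) {φ : Rd d → F} (hφ : ContDiff ℝ ∞ φ)
    (hc : HasCompactSupport φ) : ∃ M : ℝ, 0 ≤ M ∧ ∀ x, jetNorm k φ x ≤ M := by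
  obtain ⟨M, hM⟩ := (hasCompactSupport_jetNorm k hc).exists_bound_of_continuous
    (continuous_jetNorm k hφ)
  exact ⟨M, (norm_nonneg _).trans (hM 0), fun x => (le_abs_self _).trans (hM x)⟩

theorem jetNorm_comp_add_right (k : ℕ) (φ : Rd d → F) (a x : Rd d) :
    jetNorm k (fun t => φ (t + a)) x = jetNorm k φ (x + a) := by
  simp only [jetNorm, iteratedFDeriv_comp_add_right]

theorem jetNorm_comp_sub (k : ℕ) (φ : Rd d → F) (a x : Rd d) :
    jetNorm k (fun t => φ (t - a)) x = jetNorm k φ (x - a) := by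
  simp only [jetNorm, iteratedFDeriv_comp_sub]

theorem norm_iteratedFDeriv_const_sub (k : ℕ) (φ : Rd d → F) (x t : Rd d) :
    ‖iteratedFDeriv ℝ k (fun t => φ (x - t)) t‖ = ‖iteratedFDeriv ℝ k φ (x - t)‖ := by
  have h1 : (fun t => φ (x - t)) = (fun u => φ (x + u)) ∘ (LinearIsometryEquiv.neg ℝ (E := Rd d)) := by
    funext t; simp [sub_eq_add_neg]
  rw [h1, LinearIsometryEquiv.norm_iteratedFDeriv_comp_right, iteratedFDeriv_comp_add_left]
  simp [sub_eq_add_neg]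

theorem jetNorm_const_sub (k : ℕ) (φ : Rd d → F) (x t : Rd d) :
    jetNorm k (fun t => φ (x - t)) t = jetNorm k φ (x - t) := by
  simp only [jetNorm, norm_iteratedFDeriv_const_sub]

theorem jetNorm_const_smul (k : ℕ) {φ : Rd d → ℂ} (hφ : ContDiff ℝ ∞ φ) (c : ℂ) (x : Rd d) :
    jetNorm k (c • φ) x = ‖c‖ * jetNorm k φ x := by
  simp only [jetNorm, Finset.mul_sum]
  refine Finset.sum_congr rfl fun i _ => ?_
  rw [iteratedFDeriv_const_smul_apply (hφ.contDiffAt.of_le (by exact_mod_cast le_top)), norm_smul]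

theorem jetNorm_sub_le (k : ℕ) {φ ψ : Rd d → F} (hφ : ContDiff ℝ ∞ φ) (hψ : ContDiff ℝ ∞ ψ)
    (x : Rd d) : jetNorm k (φ - ψ) x ≤ jetNorm k φ x + jetNorm k ψ x := by
  simp only [jetNorm, ← Finset.sum_add_distrib]
  refine Finset.sum_le_sum fun i _ => ?_
  rw [iteratedFDeriv_sub_apply (hφ.contDiffAt.of_le (by exact_mod_cast le_top))
    (hψ.contDiffAt.of_le (by exact_mod_cast le_top))]
  exact norm_sub_le _ _

theorem norm_iteratedFDeriv_iteratedFDeriv (i k : ℕ) (φ : Rd d → F) (x : Rd d) :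
    ‖iteratedFDeriv ℝ i (iteratedFDeriv ℝ k φ) x‖ = ‖iteratedFDeriv ℝ (i + k) φ x‖ := by
  induction k generalizing i with
  | zero =>
    rw [iteratedFDeriv_zero_eq_comp, LinearIsometryEquiv.norm_iteratedFDeriv_comp_left, add_zero]
  | succ k ih =>
    rw [iteratedFDeriv_succ_eq_comp_left]
    have h := (continuousMultilinearCurryLeftEquiv ℝ
      (fun _ : Fin (k + 1) => Rd d) F).symm.norm_iteratedFDeriv_comp_left (𝕜 := ℝ)
        (fderiv ℝ (iteratedFDeriv ℝ k φ)) x i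
    refine Eq.trans h ?_
    have h2 := norm_iteratedFDeriv_fderiv (𝕜 := ℝ) (f := iteratedFDeriv ℝ k φ) (x := x) (n := i)
    refine Eq.trans h2 ?_
    rw [ih, add_assoc, add_comm 1 k]

/-- A product with a factor with bounded derivatives. -/
theorem jetNorm_mul_le (k : ℕ) {χ φ : Rd d → ℂ} (hχ : ContDiff ℝ ∞ χ) (hφ : ContDiff ℝ ∞ φ)
    {M : ℝ} {x : Rd d} (hM : jetNorm k χ x ≤ M) :
    jetNorm k (fun y => χ y * φ y) x ≤ (k + 1) * 2 ^ k * M * jetNorm k φ x := by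
  have hM0 : 0 ≤ M := (jetNorm_nonneg k χ x).trans hM
  have h : ∀ i ∈ Finset.range (k + 1), ‖iteratedFDeriv ℝ i (fun y => χ y * φ y) x‖ ≤
      2 ^ k * M * jetNorm k φ x := by
    intro i hi
    have hik : i ≤ k := Nat.lt_succ_iff.1 (Finset.mem_range.1 hi)
    refine (norm_iteratedFDeriv_mul_le (N := ∞) hχ hφ x (by exact_mod_cast le_top)).trans ?_
    calc ∑ j ∈ Finset.range (i + 1), (i.choose j : ℝ) * ‖iteratedFDeriv ℝ j χ x‖ *
          ‖iteratedFDeriv ℝ (i - j) φ x‖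
        ≤ ∑ j ∈ Finset.range (i + 1), (i.choose j : ℝ) * (M * jetNorm k φ x) := by
          refine Finset.sum_le_sum fun j hj => ?_
          have hj' : j ≤ i := Nat.lt_succ_iff.1 (Finset.mem_range.1 hj)
          rw [mul_assoc]
          gcongr
          · exact (norm_iteratedFDeriv_le_jetNorm (hj'.trans hik) χ x).trans hM
          · exact norm_iteratedFDeriv_le_jetNorm ((Nat.sub_le _ _).trans hik) φ x
      _ = 2 ^ i * (M * jetNorm k φ x) := by
          rw [← Finset.sum_mul]
          congr 1
          exact_mod_cast Nat.sum_range_choose i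
      _ ≤ 2 ^ k * M * jetNorm k φ x := by
          rw [← mul_assoc]
          have := jetNorm_nonneg k φ x
          gcongr
          norm_num
  refine (Finset.sum_le_sum h).trans (le_of_eq ?_)
  simp only [Finset.sum_const, Finset.card_range, nsmul_eq_mul]
  push_cast
  ring

/-- Second order Taylor estimate for all derivatives at once. -/
theorem norm_iteratedFDeriv_taylor_le (j : ℕ) : ∀ {F : Type} [NormedAddCommGroup F]
    [NormedSpace ℝ F] {ψ : Rd d → F} (_ : ContDiff ℝ ∞ ψ) {M : ℝ}
    (_ : ∀ x, ‖iteratedFDeriv ℝ (j + 2) ψ x‖ ≤ M) (v y : Rd d),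
    ‖iteratedFDeriv ℝ j (fun z => ψ (z + v) - ψ z - fderiv ℝ ψ z v) y‖ ≤ M * ‖v‖ ^ 2 := by
  induction j with
  | zero =>
    intro F _ _ ψ hψ M hM v y
    have hd : Differentiable ℝ ψ := hψ.differentiable (by simp)
    have hd' : Differentiable ℝ (fderiv ℝ ψ) :=
      (hψ.fderiv_right (m := ∞) (by simp)).differentiable (by simp)
    have hM' : ∀ x, ‖fderiv ℝ (fderiv ℝ ψ) x‖ ≤ M := by
      intro x
      have := hM x
      rwa [← norm_iteratedFDeriv_fderiv, ← norm_iteratedFDeriv_fderiv, norm_iteratedFDeriv_zero]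
        at this
    have hM0 : 0 ≤ M := (norm_nonneg (iteratedFDeriv ℝ (0 + 2) ψ 0)).trans (hM 0)
    rw [norm_iteratedFDeriv_zero]
    have hseg : Convex ℝ (Metric.closedBall y ‖v‖) := convex_closedBall _ _
    have h1 : ∀ z ∈ Metric.closedBall y ‖v‖, ‖fderiv ℝ ψ z - fderiv ℝ ψ y‖ ≤ M * ‖v‖ := by
      intro z hz
      refine (convex_univ.norm_image_sub_le_of_norm_fderiv_le (𝕜 := ℝ) (fun x _ => hd' x)
        (fun x _ => hM' x) (Set.mem_univ y) (Set.mem_univ z)).trans ?_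
      gcongr
      simpa [dist_eq_norm] using hz
    have h2 := hseg.norm_image_sub_le_of_norm_hasFDerivWithin_le' (f := ψ) (φ := fderiv ℝ ψ y)
      (fun z _ => (hd z).hasFDerivAt.hasFDerivWithinAt) h1
      (x := y) (y := y + v) (by simp) (by simp)
    rw [add_sub_cancel_left] at h2
    refine h2.trans (le_of_eq (by ring))
  | succ j ih =>
    intro F _ _ ψ hψ M hM v y
    have hψ' : ContDiff ℝ ∞ (fderiv ℝ ψ) := hψ.fderiv_right (by simp)
    have hd : Differentiable ℝ ψ := hψ.differentiable (by simp)
    have hd' : Differentiable ℝ (fderiv ℝ ψ) := hψ'.differentiable (by simp)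
    rw [← norm_iteratedFDeriv_fderiv]
    -- By symmetry of the second derivative, differentiating the Taylor remainder of `ψ` in `z`
    -- gives the Taylor remainder of `fderiv ℝ ψ`. The induction therefore lets the target space
    -- vary.
    have e : fderiv ℝ (fun z => ψ (z + v) - ψ z - fderiv ℝ ψ z v) =
        fun z => fderiv ℝ ψ (z + v) - fderiv ℝ ψ z - fderiv ℝ (fderiv ℝ ψ) z v := by
      funext z
      have a1 : HasFDerivAt (fun z => ψ (z + v)) (fderiv ℝ ψ (z + v)) z :=
        (hasFDerivAt_comp_add_right v).2 (hd (z + v)).hasFDerivAt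
      have a3 : HasFDerivAt (fun z => fderiv ℝ ψ z v)
          ((ContinuousLinearMap.apply ℝ F v).comp (fderiv ℝ (fderiv ℝ ψ) z)) z :=
        (ContinuousLinearMap.apply ℝ F v).hasFDerivAt.comp z (hd' z).hasFDerivAt
      refine (HasFDerivAt.fderiv (f := fun z => ψ (z + v) - ψ z - fderiv ℝ ψ z v)
        ((a1.sub (hd z).hasFDerivAt).sub a3)).trans ?_
      congr 1
      ext u
      have hs : IsSymmSndFDerivAt ℝ ψ z := (hψ.contDiffAt).isSymmSndFDerivAt (by
        rw [minSmoothness_of_isRCLikeNormedField]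
        exact WithTop.coe_le_coe.2 le_top)
      exact hs u v
    rw [e]
    refine ih hψ' (fun x => ?_) v y
    rw [norm_iteratedFDeriv_fderiv]
    exact hM x

/-- Expand every argument in the standard basis. This is the passage from the partial derivatives
that define `𝒦¹` to the operator norms of the full derivatives in `jetNorm`. -/
theorem ContinuousMultilinearMap.norm_le_sum_single {k : ℕ}
    (A : ContinuousMultilinearMap ℝ (fun _ : Fin k => Rd d) F) :
    ‖A‖ ≤ ∑ s : Fin k → Fin d, ‖A fun i => EuclideanSpace.single (s i) (1 : ℝ)‖ := by
  refine A.opNorm_le_bound (Finset.sum_nonneg fun _ _ => norm_nonneg _) fun m => ?_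
  have hm : ∀ i, m i = ∑ j, m i j • EuclideanSpace.single j (1 : ℝ) := by
    intro i
    ext l
    simp [Finset.sum_apply, Pi.single_apply]
  have : A m = ∑ s : Fin k → Fin d, A fun i => m i (s i) • EuclideanSpace.single (s i) (1 : ℝ) := by
    conv_lhs => rw [show m = fun i => ∑ j, m i j • EuclideanSpace.single j (1 : ℝ) from
      funext hm]
    exact A.toMultilinearMap.map_sum _
  rw [this, Finset.sum_mul]
  refine norm_sum_le_of_le _ fun s _ => ?_
  rw [A.map_smul_univ, norm_smul, mul_comm]
  gcongr
  rw [norm_prod]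
  exact Finset.prod_le_prod (fun _ _ => norm_nonneg _) fun i _ => PiLp.norm_apply_le (m i) (s i)

theorem norm_iteratedFDeriv_le_sum_partialDeriv (k : ℕ) (φ : Rd d → ℂ) (x : Rd d) :
    ‖iteratedFDeriv ℝ k φ x‖ ≤ ∑ s : Fin k → Fin d, ‖partialDeriv s φ x‖ :=
  ContinuousMultilinearMap.norm_le_sum_single _

theorem contDiff_partialDeriv {k : ℕ} (s : Fin k → Fin d) {φ : Rd d → ℂ}
    (hφ : ContDiff ℝ ∞ φ) : ContDiff ℝ ∞ (partialDeriv s φ) :=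
  (ContinuousMultilinearMap.apply ℝ (fun _ : Fin k => Rd d) ℂ
    (fun i => EuclideanSpace.single (s i) (1 : ℝ))).contDiff.comp
      (hφ.iteratedFDeriv_right (m := ∞) (by exact_mod_cast le_top))

theorem hasCompactSupport_partialDeriv {k : ℕ} (s : Fin k → Fin d) {φ : Rd d → ℂ}
    (hφ : HasCompactSupport φ) : HasCompactSupport (partialDeriv s φ) := by
  refine (hφ.iteratedFDeriv (𝕜 := ℝ) k).comp_left
      (g := fun L => L (fun i => EuclideanSpace.single (s i) (1 : ℝ))) rfl

theorem norm_iteratedFDeriv_partialDeriv_le (i : ℕ) {k : ℕ} (s : Fin k → Fin d) {φ : Rd d → ℂ}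
    (hφ : ContDiff ℝ ∞ φ) (x : Rd d) :
    ‖iteratedFDeriv ℝ i (partialDeriv s φ) x‖ ≤ ‖iteratedFDeriv ℝ (i + k) φ x‖ := by
  rw [← norm_iteratedFDeriv_iteratedFDeriv]
  have h := (ContinuousMultilinearMap.apply ℝ (fun _ : Fin k => Rd d) ℂ
    (fun i => EuclideanSpace.single (s i) (1 : ℝ))).norm_iteratedFDeriv_comp_left
      (f := iteratedFDeriv ℝ k φ) (x := x) (N := ∞) (n := i)
      (hφ.iteratedFDeriv_right (m := ∞) (by exact_mod_cast le_top)).contDiffAt (by exact_mod_cast le_top)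
  refine h.trans (mul_le_of_le_one_left (norm_nonneg _) ?_)
  refine ContinuousLinearMap.opNorm_le_bound _ zero_le_one fun A => ?_
  rw [one_mul]
  refine (A.le_opNorm _).trans ?_
  simp

theorem jetNorm_partialDeriv_le (l : ℕ) {k : ℕ} (s : Fin k → Fin d) {φ : Rd d → ℂ}
    (hφ : ContDiff ℝ ∞ φ) (x : Rd d) :
    jetNorm l (partialDeriv s φ) x ≤ jetNorm (l + k) φ x := by
  refine (Finset.sum_le_sum fun i _ => norm_iteratedFDeriv_partialDeriv_le i s hφ x).trans ?_
  have h := Finset.sum_range_add (fun i => ‖iteratedFDeriv ℝ i φ x‖) k (l + 1)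
  rw [jetNorm, show l + k + 1 = k + (l + 1) by omega, h]
  exact le_add_of_nonneg_of_le
    (Finset.sum_nonneg fun i _ => norm_nonneg (iteratedFDeriv ℝ i φ x))
    (le_of_eq (Finset.sum_congr rfl fun i _ => by rw [add_comm i k]))

end Jet

/-! ### The Sobolev inequality -/

section Sobolev

variable {d : ℕ}

open FourierTransform in
-- Integrability of `d + 1` derivatives makes the Fourier transform decay like `(1 + ‖w‖) ^ (-(d +
-- 1))`, which is integrable on `ℝ^d`; Fourier inversion then bounds the supremum of `g`.
theorem exists_sobolev (d : ℕ) : ∃ C : ℝ, 0 ≤ C ∧ ∀ g : Rd d → ℂ, ContDiff ℝ ∞ g →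
    HasCompactSupport g → ∀ x, ‖g x‖ ≤ C * ∫ y, jetNorm (d + 1) g y := by
  have hint : Integrable (fun w : Rd d => (1 + ‖w‖) ^ (-((d : ℝ) + 1))) volume :=
    integrable_one_add_norm (by simp)
  -- The factor `2 ^ d` comes from `(1 + t) ^ (d + 1) ≤ 2 ^ d (1 + t ^ (d + 1))`; the terms `1` and
  -- `2 ^ (d + 1)` are the constants of `hb` for `n = 0` and `n = d + 1`.
  set A : ℝ := 2 ^ d * (1 + 2 ^ (d + 1)) with hA
  refine ⟨A * ∫ w : Rd d, (1 + ‖w‖) ^ (-((d : ℝ) + 1)), by positivity, fun g hg hc x => ?_⟩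
  set S : ℝ := ∫ y, jetNorm (d + 1) g y with hS
  have hi : ∀ n : ℕ, Integrable (fun v => ‖iteratedFDeriv ℝ n g v‖) volume := fun n =>
    ((hg.continuous_iteratedFDeriv (by exact_mod_cast le_top)).integrable_of_hasCompactSupport
      (hc.iteratedFDeriv (𝕜 := ℝ) n)).norm
  have hSn : ∀ n ≤ d + 1, ∑ i ∈ Finset.range (n + 1), ∫ v, ‖iteratedFDeriv ℝ i g v‖ ≤ S := by
    intro n hn
    rw [← integral_finsetSum _ fun i _ => hi i]
    exact integral_mono (integrable_finsetSum _ fun i _ => hi i) (integrable_jetNorm _ hg hc)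
      fun y => jetNorm_mono hn g y
  have hb : ∀ n ≤ d + 1, ∀ w, ‖w‖ ^ n * ‖𝓕 g w‖ ≤ 2 ^ n * S := by
    intro n hn w
    have h := Real.pow_mul_norm_iteratedFDeriv_fourier_le (K := 0) (N := ⊤) (f := g) hg
      (fun k m hk _ => by
        have : k = 0 := by simpa using hk
        subst this
        simpa using hi m) (k := 0) (n := n) (by simp) le_top w
    rw [norm_iteratedFDeriv_zero] at h
    refine h.trans ?_
    simp only [pow_zero, one_mul, Finset.sum_product, zero_add, Finset.range_one,
      Finset.sum_singleton, Nat.cast_zero, mul_zero]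
    gcongr
    exact hSn n hn
  have hF : ∀ w, ‖𝓕 g w‖ ≤ A * S * (1 + ‖w‖) ^ (-((d : ℝ) + 1)) := by
    intro w
    have hpos : 0 < (1 + ‖w‖) ^ (d + 1) := by positivity
    have e : (1 + ‖w‖) ^ (-((d : ℝ) + 1)) = ((1 + ‖w‖) ^ (d + 1))⁻¹ := by
      rw [Real.rpow_neg (by positivity)]
      exact_mod_cast rfl
    rw [e, ← div_eq_mul_inv, le_div_iff₀ hpos]
    have h1 := add_pow_le (zero_le_one' ℝ) (norm_nonneg w) (d + 1)
    calc ‖𝓕 g w‖ * (1 + ‖w‖) ^ (d + 1)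
        ≤ ‖𝓕 g w‖ * (2 ^ d * (1 ^ (d + 1) + ‖w‖ ^ (d + 1))) := by
          gcongr
          simpa using h1
      _ = 2 ^ d * (‖w‖ ^ 0 * ‖𝓕 g w‖ + ‖w‖ ^ (d + 1) * ‖𝓕 g w‖) := by ring
      _ ≤ 2 ^ d * (2 ^ 0 * S + 2 ^ (d + 1) * S) := by
          exact mul_le_mul_of_nonneg_left
            (add_le_add (hb 0 (Nat.zero_le _) w) (hb (d + 1) le_rfl w)) (by positivity)
      _ = A * S := by rw [hA]; ring
  have hgi : Integrable g volume := hg.continuous.integrable_of_hasCompactSupport hc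
  have hFc : Continuous (𝓕 g) :=
    VectorFourier.fourierIntegral_continuous Real.continuous_fourierChar
      (by exact continuous_inner) hgi
  have hFi : Integrable (𝓕 g) volume :=
    (hint.const_mul (A * S)).mono' hFc.aestronglyMeasurable (Filter.Eventually.of_forall hF)
  have hinv : 𝓕⁻ (𝓕 g) = g := hg.continuous.fourierInv_fourier_eq hgi hFi
  calc ‖g x‖ = ‖𝓕⁻ (𝓕 g) x‖ := by rw [hinv]
    _ ≤ ∫ w, ‖𝓕 g w‖ := by
        rw [Real.fourierInv_eq]
        refine (norm_integral_le_integral_norm _).trans (le_of_eq ?_)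
        simp
    _ ≤ ∫ w, A * S * (1 + ‖w‖) ^ (-((d : ℝ) + 1)) :=
        integral_mono hFi.norm (hint.const_mul _) hF
    _ = A * (∫ w : Rd d, (1 + ‖w‖) ^ (-((d : ℝ) + 1))) * S := by
        rw [integral_const_mul]; ring

theorem exists_sobolev_jetNorm (d k : ℕ) : ∃ C : ℝ, 0 ≤ C ∧ ∀ g : Rd d → ℂ, ContDiff ℝ ∞ g →
    HasCompactSupport g → ∀ x, jetNorm k g x ≤ C * ∫ y, jetNorm (d + 1 + k) g y := by
  obtain ⟨C, hC, h⟩ := exists_sobolev d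
  refine ⟨∑ i ∈ Finset.range (k + 1), ∑ _s : Fin i → Fin d, C, by positivity,
    fun g hg hc x => ?_⟩
  rw [Finset.sum_mul]
  refine Finset.sum_le_sum fun i hi => ?_
  rw [Finset.sum_mul]
  refine (norm_iteratedFDeriv_le_sum_partialDeriv i g x).trans (Finset.sum_le_sum fun s _ => ?_)
  refine (h _ (contDiff_partialDeriv s hg) (hasCompactSupport_partialDeriv s hc) x).trans ?_
  refine mul_le_mul_of_nonneg_left ?_ hC
  refine integral_mono (integrable_jetNorm _ (contDiff_partialDeriv s hg)
    (hasCompactSupport_partialDeriv s hc)) (integrable_jetNorm _ hg hc) fun y => ?_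
  refine (jetNorm_partialDeriv_le _ s hg y).trans (jetNorm_mono ?_ g y)
  have := Finset.mem_range.1 hi
  omega

end Sobolev

/-! ### Test functions and distributions -/

section TestFn

variable {d : ℕ}

/-- A smooth function with compact support as a test function. -/
def TestFn.ofContDiff (φ : Rd d → ℂ) (hφ : ContDiff ℝ ∞ φ) (hc : HasCompactSupport φ) :
    TestFn d where
  toFun := φ
  contDiff' := hφ
  hasCompactSupport' := hc
  tsupport_subset' := fun _ _ => trivial

@[simp]
theorem TestFn.transReflect_apply (φ : TestFn d) (x t : Rd d) :
    φ.transReflect x t = φ (x - t) := rfl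

theorem TestFn.smooth (φ : TestFn d) : ContDiff ℝ ∞ φ := φ.contDiff

theorem TestFn.coe_sum {ι : Type*} (s : Finset ι) (φ : ι → TestFn d) (x : Rd d) :
    (∑ i ∈ s, φ i) x = ∑ i ∈ s, φ i x := by
  classical
  induction s using Finset.induction_on with
  | empty => rfl
  | insert a s ha ih => rw [Finset.sum_insert ha, Finset.sum_insert ha, ← ih]; rfl

theorem TestFn.exists_radius (φ : TestFn d) : ∃ R : ℝ, 0 ≤ R ∧ ∀ x, R < ‖x‖ → φ x = 0 := by
  obtain ⟨R, hR⟩ := φ.hasCompactSupport.isCompact.isBounded.subset_closedBall 0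
  refine ⟨max R 0, le_max_right _ _, fun x hx => image_eq_zero_of_notMem_tsupport fun h => ?_⟩
  have := hR h
  simp only [Metric.mem_closedBall, dist_zero_right] at this
  exact absurd hx (not_lt.2 (this.trans (le_max_left _ _)))

theorem tsupport_subset_closedBall {φ : Rd d → ℂ} {R : ℝ} (h : ∀ x, R < ‖x‖ → φ x = 0) :
    tsupport φ ⊆ Metric.closedBall 0 R := by
  refine closure_minimal (fun x hx => ?_) Metric.isClosed_closedBall
  by_contra hx'
  exact hx (h x (by simpa using hx'))

theorem hasCompactSupport_of_radius {φ : Rd d → ℂ} {R : ℝ} (h : ∀ x, R < ‖x‖ → φ x = 0) :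
    HasCompactSupport φ :=
  HasCompactSupport.of_support_subset_isCompact (isCompact_closedBall 0 R)
    ((subset_tsupport φ).trans (tsupport_subset_closedBall h))

/-- Continuity of a distribution on the test functions supported in a ball. -/
theorem CDistribution.exists_bound (f : CDistribution d) (R : ℝ) :
    ∃ (k : ℕ) (C : ℝ), 0 ≤ C ∧ ∀ ψ : TestFn d, (∀ x, R < ‖x‖ → ψ x = 0) →
      ∀ M : ℝ, (∀ x, jetNorm k ψ x ≤ M) → ‖f ψ‖ ≤ C * M := by
  let K : TopologicalSpace.Compacts (Rd d) := ⟨Metric.closedBall 0 R, isCompact_closedBall 0 R⟩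
  let g : 𝓓_{K}(Rd d, ℂ) →L[ℂ] ℂ := f.comp (TestFunction.ofSupportedInCLM ℂ (by simp))
  obtain ⟨s, C, -, hC⟩ := Seminorm.bound_of_continuous
    (ContDiffMapSupportedIn.withSeminorms ℂ (Rd d) ℂ ⊤ K)
    ((normSeminorm ℂ ℂ).comp g.toLinearMap) (continuous_norm.comp g.continuous)
  refine ⟨s.sup id, C, C.2, fun ψ hψ M hM => ?_⟩
  have hM0 : 0 ≤ M := (jetNorm_nonneg _ ψ 0).trans (hM 0)
  let ψ' : 𝓓_{K}(Rd d, ℂ) := ⟨ψ, ψ.contDiff, fun x hx => hψ x (by simpa [K] using hx)⟩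
  have e : f ψ = g ψ' := rfl
  rw [e]
  refine (hC ψ').trans ?_
  rw [smul_apply, NNReal.smul_def, smul_eq_mul]
  refine mul_le_mul_of_nonneg_left (Seminorm.finset_sup_apply_le hM0 fun i hi => ?_) C.2
  refine (ContDiffMapSupportedIn.seminorm_top_le_iff ℂ hM0 i ψ').2 fun x _ => ?_
  exact (norm_iteratedFDeriv_le_jetNorm (Finset.le_sup (f := id) hi) ψ x).trans (hM x)

/-- The directional derivative of a test function. -/
noncomputable def TestFn.dirDeriv (v : Rd d) (ψ : TestFn d) : TestFn d :=
  TestFn.ofContDiff (fun x => fderiv ℝ ψ x v)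
    ((ψ.smooth.fderiv_right (m := ∞) (by simp)).clm_apply contDiff_const)
    (((ψ.hasCompactSupport.fderiv (𝕜 := ℝ)).comp_left (g := fun L : Rd d →L[ℝ] ℂ => L v) rfl :))

theorem TestFn.dirDeriv_apply (v : Rd d) (ψ : TestFn d) (x : Rd d) :
    ψ.dirDeriv v x = fderiv ℝ ψ x v := rfl

theorem TestFn.dirDeriv_eq_zero {v : Rd d} {ψ : TestFn d} {R : ℝ}
    (h : ∀ x, R < ‖x‖ → ψ x = 0) (x : Rd d) (hx : R < ‖x‖) : ψ.dirDeriv v x = 0 := by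
  have : x ∉ tsupport ψ := fun h' => by
    have := tsupport_subset_closedBall h h'
    simp at this
    linarith
  rw [TestFn.dirDeriv_apply, fderiv_of_notMem_tsupport ℝ this]
  rfl

theorem TestFn.jetNorm_dirDeriv_le (l : ℕ) (i : Fin d) (ψ : TestFn d) (x : Rd d) :
    jetNorm l (ψ.dirDeriv (EuclideanSpace.single i 1)) x ≤ jetNorm (l + 1) ψ x := by
  rw [jetNorm, jetNorm, Finset.sum_range_succ' _ (l + 1)]
  refine le_add_of_le_of_nonneg (Finset.sum_le_sum fun j _ => ?_)
    (norm_nonneg (iteratedFDeriv ℝ 0 ψ x))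
  have h := norm_iteratedFDeriv_clm_apply_const (𝕜 := ℝ) (f := fderiv ℝ ψ)
    (c := EuclideanSpace.single i (1 : ℝ)) (x := x) (N := ∞) (n := j)
    (ψ.smooth.fderiv_right (m := ∞) (by simp)).contDiffAt (by exact_mod_cast le_top)
  rw [norm_iteratedFDeriv_fderiv] at h
  refine h.trans (le_of_eq ?_)
  simp

/-- Iterated partial derivatives of a test function. -/
noncomputable def TestFn.iterDeriv : (k : ℕ) → (Fin k → Fin d) → TestFn d → TestFn d
  | 0, _, ψ => ψ
  | k + 1, s, ψ => TestFn.iterDeriv k (Fin.tail s) (ψ.dirDeriv (EuclideanSpace.single (s 0) 1))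

theorem TestFn.iterDeriv_eq_zero {R : ℝ} (k : ℕ) : ∀ (s : Fin k → Fin d) (ψ : TestFn d),
    (∀ x, R < ‖x‖ → ψ x = 0) → ∀ x, R < ‖x‖ → TestFn.iterDeriv k s ψ x = 0 := by
  induction k with
  | zero => exact fun s ψ h => h
  | succ k ih => exact fun s ψ h => ih _ _ (TestFn.dirDeriv_eq_zero h)

theorem TestFn.jetNorm_iterDeriv_le (k : ℕ) : ∀ (l : ℕ) (s : Fin k → Fin d) (ψ : TestFn d)
    (x : Rd d), jetNorm l (TestFn.iterDeriv k s ψ) x ≤ jetNorm (l + k) ψ x := by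
  induction k with
  | zero => exact fun l s ψ x => le_rfl
  | succ k ih =>
    intro l s ψ x
    refine (ih l _ _ x).trans ((TestFn.jetNorm_dirDeriv_le _ _ _ x).trans (le_of_eq ?_))
    rw [add_assoc]

/-- The error of the linear approximation is `f` applied to `η v`, the reflected second order Taylor
remainder of `ψ`. For `‖v‖ ≤ 1` its support stays in the ball of radius `‖x‖ + R + 1`, and its
derivatives are `O(‖v‖ ^ 2)`, so continuity of `f` makes the error `O(‖v‖ ^ 2)`. -/
theorem hasFDerivAt_convTestFn (f : CDistribution d) (ψ : TestFn d) (x : Rd d) :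
    HasFDerivAt (convTestFn f ψ) (∑ i : Fin d, (EuclideanSpace.proj (𝕜 := ℝ) i).smulRight
      (convTestFn f (ψ.dirDeriv (EuclideanSpace.single i 1)) x)) x := by
  obtain ⟨R, hR0, hR⟩ := ψ.exists_radius
  obtain ⟨k, C, hC, hf⟩ := f.exists_bound (‖x‖ + R + 1)
  choose M hM0 hM using fun i => exists_jetNorm_le i ψ.smooth ψ.hasCompactSupport
  let η : Rd d → TestFn d := fun v => ψ.transReflect (x + v) - ψ.transReflect x -
    ∑ i : Fin d, ((v i : ℝ) : ℂ) • (ψ.dirDeriv (EuclideanSpace.single i 1)).transReflect x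
  have hη : ∀ v t, η v t = ψ (x - t + v) - ψ (x - t) - fderiv ℝ ψ (x - t) v := by
    intro v t
    have h1 : η v t = ψ (x + v - t) - ψ (x - t) - ∑ i : Fin d,
        ((v i : ℝ) : ℂ) * fderiv ℝ ψ (x - t) (EuclideanSpace.single i 1) := by
      change ψ (x + v - t) - ψ (x - t) - (∑ i : Fin d, ((v i : ℝ) : ℂ) •
        (ψ.dirDeriv (EuclideanSpace.single i 1)).transReflect x) t = _
      rw [TestFn.coe_sum]
      rfl
    have hv : v = ∑ i, v i • EuclideanSpace.single i (1 : ℝ) := by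
      ext l
      simp [Finset.sum_apply, Pi.single_apply]
    have h2 : fderiv ℝ ψ (x - t) v = ∑ i : Fin d,
        ((v i : ℝ) : ℂ) * fderiv ℝ ψ (x - t) (EuclideanSpace.single i 1) := by
      conv_lhs => rw [hv, map_sum]
      simp
    rw [h1, h2, show x + v - t = x - t + v by abel]
  have hfη : ∀ v, f (η v) = convTestFn f ψ (x + v) - convTestFn f ψ x -
      (∑ i : Fin d, (EuclideanSpace.proj (𝕜 := ℝ) i).smulRight
      (convTestFn f (ψ.dirDeriv (EuclideanSpace.single i 1)) x)) v := by
    intro v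
    simp only [η, map_sub, map_sum, map_smul, convTestFn, sum_apply,
      ContinuousLinearMap.smulRight_apply, smul_eq_mul,
      Complex.real_smul]
    rfl
  rw [hasFDerivAt_iff_isLittleO_nhds_zero]
  refine Asymptotics.IsBigO.trans_isLittleO ?_ (Asymptotics.isLittleO_norm_pow_id one_lt_two)
  refine Asymptotics.IsBigO.of_bound (C * ∑ i ∈ Finset.range (k + 1), M (i + 2)) ?_
  filter_upwards [Metric.closedBall_mem_nhds (0 : Rd d) one_pos] with v hv
  rw [mem_closedBall_zero_iff] at hv
  rw [← hfη, norm_pow, norm_norm, mul_assoc]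
  refine hf (η v) (fun t ht => ?_) _ fun t => ?_
  · have h1 : ‖t‖ ≤ ‖x - t‖ + ‖x‖ := by
      rw [norm_sub_rev]; simpa using norm_add_le (t - x) x
    have h2 : R < ‖x - t‖ := by linarith
    have h3 : R < ‖x - t + v‖ := by
      have : ‖x - t‖ ≤ ‖x - t + v‖ + ‖v‖ := by simpa using norm_sub_le (x - t + v) v
      linarith
    have h4 := TestFn.dirDeriv_eq_zero hR (v := v) _ h2
    rw [TestFn.dirDeriv_apply] at h4
    rw [hη, hR _ h2, hR _ h3, h4]
    simp
  · rw [Finset.sum_mul]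
    refine Finset.sum_le_sum fun i _ => ?_
    have e : ⇑(η v) = fun t => (fun z => ψ (z + v) - ψ z - fderiv ℝ ψ z v) (x - t) :=
      funext (hη v)
    rw [e, norm_iteratedFDeriv_const_sub i (fun z => ψ (z + v) - ψ z - fderiv ℝ ψ z v)]
    exact norm_iteratedFDeriv_taylor_le i ψ.smooth
      (fun y => (norm_iteratedFDeriv_le_jetNorm le_rfl ψ y).trans (hM _ y)) v _

theorem fderiv_convTestFn (f : CDistribution d) (ψ : TestFn d) :
    fderiv ℝ (convTestFn f ψ) = fun x => ∑ i : Fin d,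
      ContinuousLinearMap.smulRightL ℝ (Rd d) ℂ (EuclideanSpace.proj (𝕜 := ℝ) i)
        (convTestFn f (ψ.dirDeriv (EuclideanSpace.single i 1)) x) :=
  funext fun x => (hasFDerivAt_convTestFn f ψ x).fderiv

theorem contDiff_convTestFn (f : CDistribution d) (ψ : TestFn d) :
    ContDiff ℝ ∞ (convTestFn f ψ) := by
  have : ∀ (n : ℕ) (ψ : TestFn d), ContDiff ℝ n (convTestFn f ψ) := by
    intro n
    induction n with
    | zero =>
      intro ψ
      exact contDiff_zero.2 (continuous_iff_continuousAt.2 fun x =>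
        (hasFDerivAt_convTestFn f ψ x).continuousAt)
    | succ n ih =>
      intro ψ
      refine (contDiff_succ_iff_hasFDerivAt (n := n)).2
        ⟨_, ?_, hasFDerivAt_convTestFn f ψ⟩
      exact ContDiff.sum fun i _ => (ContinuousLinearMap.smulRightL ℝ (Rd d) ℂ
        (EuclideanSpace.proj (𝕜 := ℝ) i)).contDiff.comp (ih _)
  exact contDiff_infty.2 fun n => this n ψ

/-- Derivatives of `f * ψ` fall on `ψ`, so they are again convolutions of `f` with test functions
supported in the same ball. This makes the Sobolev inequality applicable to convolutors. -/
theorem norm_iteratedFDeriv_convTestFn_le (f : CDistribution d) (k : ℕ) :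
    ∀ (ψ : TestFn d) (x : Rd d), ‖iteratedFDeriv ℝ k (convTestFn f ψ) x‖ ≤
      ∑ s : Fin k → Fin d, ‖convTestFn f (TestFn.iterDeriv k s ψ) x‖ := by
  induction k with
  | zero =>
    intro ψ x
    simp [TestFn.iterDeriv]
  | succ k ih =>
    intro ψ x
    rw [← norm_iteratedFDeriv_fderiv, fderiv_convTestFn]
    have hs : ∀ i : Fin d, ContDiff ℝ ∞ (fun x =>
        ContinuousLinearMap.smulRightL ℝ (Rd d) ℂ (EuclideanSpace.proj (𝕜 := ℝ) i)
        (convTestFn f (ψ.dirDeriv (EuclideanSpace.single i 1)) x)) := fun i =>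
      (ContinuousLinearMap.smulRightL ℝ (Rd d) ℂ
        (EuclideanSpace.proj (𝕜 := ℝ) i)).contDiff.comp (contDiff_convTestFn f _)
    rw [iteratedFDeriv_sum fun i _ => (hs i).of_le (by exact_mod_cast le_top),
      Finset.sum_apply]
    rw [← (Fin.consEquiv (fun _ : Fin (k + 1) => Fin d)).sum_comp, Fintype.sum_prod_type]
    refine norm_sum_le_of_le _ fun i _ => ?_
    have h := (ContinuousLinearMap.smulRightL ℝ (Rd d) ℂ
        (EuclideanSpace.proj (𝕜 := ℝ) i)).norm_iteratedFDeriv_comp_left (x := x) (N := ∞) (n := k)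
        (f := convTestFn f (ψ.dirDeriv (EuclideanSpace.single i 1)))
        (contDiff_convTestFn f _).contDiffAt (by exact_mod_cast le_top)
    refine h.trans ((mul_le_of_le_one_left (norm_nonneg _) ?_).trans (ih _ x))
    refine ContinuousLinearMap.opNorm_le_bound _ zero_le_one fun z => ?_
    refine ContinuousLinearMap.opNorm_le_bound _ (by positivity) fun v => ?_
    rw [one_mul, mul_comm]
    change ‖v i • z‖ ≤ _
    rw [norm_smul]
    gcongr
    exact PiLp.norm_apply_le v i

theorem jetNorm_convTestFn_le (f : CDistribution d) (k : ℕ) (ψ : TestFn d) (x : Rd d) :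
    jetNorm k (convTestFn f ψ) x ≤ ∑ i ∈ Finset.range (k + 1), ∑ s : Fin i → Fin d,
      ‖convTestFn f (TestFn.iterDeriv i s ψ) x‖ :=
  Finset.sum_le_sum fun i _ => norm_iteratedFDeriv_convTestFn_le f i ψ x

end TestFn

/-! ### Representatives in translation-invariant Banach function spaces -/

section TIBF

open Filter Topology

variable {d : ℕ} {E : Type*} [NormedAddCommGroup E] [NormedSpace ℂ E]
  {ι : E →ₗ[ℂ] (Rd d →ₘ[(volume : Measure (Rd d))] ℂ)}

theorem Represents.congr {e : E} {g h : Rd d → ℂ} (hg : Represents ι e g) (hgh : ∀ x, g x = h x) :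
    Represents ι e h := by
  have : g = h := funext hgh
  rwa [← this]

theorem Represents.add {e e' : E} {g g' : Rd d → ℂ} (h : Represents ι e g)
    (h' : Represents ι e' g') : Represents ι (e + e') (fun x => g x + g' x) := by
  unfold Represents
  rw [map_add]
  filter_upwards [AEEqFun.coeFn_add (ι e) (ι e'), h, h'] with x h1 h2 h3
  rw [h1, Pi.add_apply, h2, h3]

theorem Represents.smul {e : E} {g : Rd d → ℂ} (c : ℂ) (h : Represents ι e g) :
    Represents ι (c • e) (fun x => c * g x) := by
  unfold Represents
  rw [map_smul]
  filter_upwards [AEEqFun.coeFn_smul c (ι e), h] with x h1 h2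
  rw [h1, Pi.smul_apply, h2, smul_eq_mul]

theorem Represents.sub {e e' : E} {g g' : Rd d → ℂ} (h : Represents ι e g)
    (h' : Represents ι e' g') : Represents ι (e - e') (fun x => g x - g' x) := by
  have := h.add (h'.smul (-1))
  rw [neg_one_smul, ← sub_eq_add_neg] at this
  exact this.congr fun x => by ring

theorem represents_zero : Represents ι 0 (fun _ => 0) := by
  unfold Represents
  rw [map_zero]
  exact AEEqFun.coeFn_zero

theorem represents_sum {α : Type*} (s : Finset α) {e : α → E} {g : α → Rd d → ℂ}
    (h : ∀ a ∈ s, Represents ι (e a) (g a)) :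
    Represents ι (∑ a ∈ s, e a) (fun x => ∑ a ∈ s, g a x) := by
  classical
  induction s using Finset.induction_on with
  | empty => simpa using represents_zero
  | insert a s ha ih =>
    have h1 := (h a (Finset.mem_insert_self a s)).add
      (ih fun b hb => h b (Finset.mem_insert_of_mem hb))
    simpa only [Finset.sum_insert ha] using h1

theorem Represents.locallyIntegrable (hE : IsTIBF ι) {e : E} {g : Rd d → ℂ}
    (h : Represents ι e g) : LocallyIntegrable g volume := fun x => by
  obtain ⟨U, hU, hi⟩ := hE.locallyIntegrable e x
  exact ⟨U, hU, hi.congr (ae_restrict_of_ae h)⟩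

theorem Represents.unique (hE : IsTIBF ι) {e e' : E} {g : Rd d → ℂ} (h : Represents ι e g)
    (h' : Represents ι e' g) : e = e' :=
  hE.injective (AEEqFun.ext (h.trans h'.symm))

theorem Represents.dominated (hsolid : IsSolid ι) {e : E} {g h : Rd d → ℂ}
    (hg : Represents ι e g) (hh : LocallyIntegrable h volume) (hle : ∀ x, ‖h x‖ ≤ ‖g x‖) :
    ∃ e' : E, Represents ι e' h ∧ ‖e'‖ ≤ ‖e‖ :=
  hsolid e h hh (hg.mono fun x hx => by rw [hx]; exact hle x)

theorem IsTIBF.exists_translate (hE : IsTIBF ι) : ∃ C₀ : ℝ, 0 < C₀ ∧ ∀ (x : Rd d) (e : E)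
    (g : Rd d → ℂ), Represents ι e g →
      ∃ e' : E, Represents ι e' (fun t => g (t - x)) ∧ ‖e'‖ ≤ C₀ * ‖e‖ := by
  obtain ⟨C₀, hC₀, h⟩ := hE.translate_bound
  refine ⟨C₀, hC₀, fun x e g hg => ?_⟩
  obtain ⟨e', he'⟩ := hE.translate_mem x e
  refine ⟨e', he'.trans ?_, h x e e' he'⟩
  exact (measurePreserving_sub_right (volume : Measure (Rd d)) x).quasiMeasurePreserving.ae_eq_comp
    hg

theorem IsTIBF.exists_setIntegral_le (hE : IsTIBF ι) {K : Set (Rd d)} (hK : IsCompact K) :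
    ∃ C : ℝ, 0 ≤ C ∧ ∀ (e : E) (g : Rd d → ℂ), Represents ι e g → ∫ x in K, ‖g x‖ ≤ C * ‖e‖ := by
  obtain ⟨C, h⟩ := hE.continuous_inclusion K hK
  refine ⟨max C 0, le_max_right _ _, fun e g hg => ?_⟩
  have h1 : ∫ x in K, ‖g x‖ = ∫ x in K, ‖(ι e : Rd d → ℂ) x‖ :=
    integral_congr_ae ((ae_restrict_of_ae hg).mono fun x hx => by simp only [hx])
  rw [h1]
  exact (h e).trans (by gcongr; exact le_max_left _ _)

/-- Translating the ball to the origin by uniformly bounded operators makes the constant of the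
inclusion into `L¹_loc` independent of the centre `x`. -/
theorem IsTIBF.exists_setIntegral_closedBall_le (hE : IsTIBF ι) (R : ℝ) :
    ∃ C : ℝ, 0 ≤ C ∧ ∀ (x : Rd d) (e : E) (g : Rd d → ℂ), Represents ι e g →
      ∫ y in Metric.closedBall x R, ‖g y‖ ≤ C * ‖e‖ := by
  obtain ⟨C, hC, h⟩ := hE.exists_setIntegral_le (isCompact_closedBall (0 : Rd d) R)
  obtain ⟨C₀, hC₀, hT⟩ := hE.exists_translate
  refine ⟨C * C₀, by positivity, fun x e g hg => ?_⟩
  obtain ⟨e', he', hle⟩ := hT (-x) e g hg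
  have h1 := h e' _ he'
  have hmp := measurePreserving_add_right (volume : Measure (Rd d)) x
  have h2 := hmp.setIntegral_preimage_emb (measurableEmbedding_addRight x) (fun y => ‖g y‖)
    (Metric.closedBall x R)
  have h3 : (fun y => y + x) ⁻¹' Metric.closedBall x R = Metric.closedBall 0 R := by
    ext y; simp [dist_eq_norm]
  rw [h3] at h2
  rw [← h2]
  simp only [sub_neg_eq_add] at h1
  refine h1.trans ?_
  rw [mul_assoc]
  gcongr

/-- Convergence in the space together with pointwise convergence of representatives. -/
theorem IsTIBF.represents_of_tendsto (hE : IsTIBF ι) {e : ℕ → E} {g : ℕ → Rd d → ℂ} {e' : E}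
    {g' : Rd d → ℂ} (h : ∀ n, Represents ι (e n) (g n)) (he : Tendsto e atTop (𝓝 e'))
    (hg : ∀ x, Tendsto (fun n => g n x) atTop (𝓝 (g' x))) : Represents ι e' g' := by
  have hm : ∀ n, AEStronglyMeasurable (g n) volume := fun n =>
    ((h n).locallyIntegrable hE).aestronglyMeasurable
  have hm' : AEStronglyMeasurable g' volume :=
    aestronglyMeasurable_of_tendsto_ae atTop hm (Eventually.of_forall hg)
  set u : Rd d → ℂ := (ι e' : Rd d → ℂ) with hu
  have hur : Represents ι e' u := EventuallyEq.rfl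
  have hum : AEStronglyMeasurable u volume := (ι e').aestronglyMeasurable
  have key : ∀ N : ℕ, ∀ᵐ x ∂(volume.restrict (Metric.closedBall (0 : Rd d) N)), u x = g' x := by
    intro N
    set μ := (volume : Measure (Rd d)).restrict (Metric.closedBall (0 : Rd d) N)
    obtain ⟨C, hC, hCb⟩ := hE.exists_setIntegral_le (isCompact_closedBall (0 : Rd d) N)
    -- Fatou's lemma along the pointwise convergence `g n → g'`. The right side vanishes because `E`
    -- embeds continuously into `L¹_loc`, so no subsequence has to be extracted.
    have h1 : ∫⁻ x, ‖u x - g' x‖ₑ ∂μ ≤ liminf (fun n => ∫⁻ x, ‖u x - g n x‖ₑ ∂μ) atTop := by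
      refine le_trans (le_of_eq ?_)
        (lintegral_liminf_le' (fun n => ((hum.sub (hm n)).restrict.enorm)))
      refine lintegral_congr fun x => ?_
      exact ((tendsto_const_nhds.sub (hg x)).enorm.liminf_eq).symm
    have h2 : Tendsto (fun n => ∫⁻ x, ‖u x - g n x‖ₑ ∂μ) atTop (𝓝 0) := by
      have h3 : ∀ n, ∫⁻ x, ‖u x - g n x‖ₑ ∂μ ≤ ENNReal.ofReal (C * ‖e' - e n‖) := by
        intro n
        have hr := hur.sub (h n)
        have hi : Integrable (fun x => u x - g n x) μ :=
          (hr.locallyIntegrable hE).integrableOn_isCompact (isCompact_closedBall _ _)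
        rw [← ofReal_integral_norm_eq_lintegral_enorm hi]
        exact ENNReal.ofReal_le_ofReal (hCb _ _ hr)
      refine tendsto_of_tendsto_of_tendsto_of_le_of_le tendsto_const_nhds ?_
        (fun _ => bot_le) h3
      have h4 : Tendsto (fun n => C * ‖e' - e n‖) atTop (𝓝 (C * ‖e' - e'‖)) :=
        (tendsto_const_nhds.sub he).norm.const_mul C
      rw [sub_self, norm_zero, mul_zero] at h4
      simpa using ENNReal.tendsto_ofReal h4
    rw [h2.liminf_eq, nonpos_iff_eq_zero] at h1
    have h5 := (lintegral_eq_zero_iff' (hum.sub hm').restrict.enorm).1 h1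
    filter_upwards [h5] with x hx
    simpa [sub_eq_zero] using hx
  have := (ae_restrict_iUnion_iff (μ := (volume : Measure (Rd d)))
    (fun N : ℕ => Metric.closedBall (0 : Rd d) N) (fun x => u x = g' x)).2 key
  rwa [Metric.iUnion_closedBall_nat, Measure.restrict_univ] at this

theorem IsTIBF.represents_tsum (hE : IsTIBF ι) {e : ℕ → E} {g : ℕ → Rd d → ℂ} {g' : Rd d → ℂ}
    (h : ∀ n, Represents ι (e n) (g n)) (he : Summable fun n => ‖e n‖)
    (hg : ∀ x, HasSum (fun n => g n x) (g' x)) : ∃ e' : E, Represents ι e' g' := by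
  have := hE.complete
  exact ⟨∑' n, e n, hE.represents_of_tendsto (fun N => represents_sum (Finset.range N)
    fun n _ => h n) he.of_norm.hasSum.tendsto_sum_nat fun x => (hg x).tendsto_sum_nat⟩

/-- A nonzero element dominates a multiple of the indicator of a bounded set of positive measure.
Convolving that indicator with a wide plateau function gives a positive constant on the ball, and
solidity cuts this down to the indicator of the ball. -/
theorem IsTIBF.exists_represents_indicator (hE : IsTIBF ι) (hsolid : IsSolid ι) (R : ℝ) :
    ∃ e : E, Represents ι e ((Metric.closedBall (0 : Rd d) R).indicator fun _ => 1) := by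
  have := hE.nontrivial
  obtain ⟨e₀, he₀⟩ := exists_ne (0 : E)
  set u : Rd d → ℂ := (ι e₀ : Rd d → ℂ) with hu
  have hur : Represents ι e₀ u := EventuallyEq.rfl
  have hum : StronglyMeasurable u := (ι e₀).stronglyMeasurable
  let A : ℕ → Set (Rd d) := fun n => {x | ((n : ℝ) + 1)⁻¹ ≤ ‖u x‖} ∩ Metric.closedBall 0 n
  have hAm : ∀ n, MeasurableSet (A n) := fun n =>
    (measurableSet_le measurable_const hum.norm.measurable).inter measurableSet_closedBall
  obtain ⟨n, hn⟩ : ∃ n, volume (A n) ≠ 0 := by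
    by_contra! hcon
    refine he₀ (Represents.unique hE (e := e₀) (g := u) hur (represents_zero.trans ?_))
    have h0 : ∀ᵐ x ∂(volume : Measure (Rd d)), ∀ n, x ∉ A n :=
      ae_all_iff.2 fun n => measure_eq_zero_iff_ae_notMem.1 (hcon n)
    filter_upwards [h0] with x hx
    by_contra hne
    have hpos : 0 < ‖u x‖ := norm_pos_iff.2 fun h => hne h.symm
    obtain ⟨N, hN⟩ := exists_nat_gt (max ‖u x‖⁻¹ ‖x‖)
    refine hx N ⟨?_, ?_⟩
    · change ((N : ℝ) + 1)⁻¹ ≤ ‖u x‖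
      rw [inv_le_comm₀ (by positivity) hpos]
      linarith [le_max_left ‖u x‖⁻¹ ‖x‖]
    · simpa using ((le_max_right _ _).trans hN.le)
  set c : ℝ := ((n : ℝ) + 1)⁻¹ with hc
  have hc0 : 0 < c := by positivity
  have hAfin : volume (A n) ≠ ⊤ :=
    ((measure_mono Set.inter_subset_right).trans_lt
      (isCompact_closedBall (0 : Rd d) (n : ℝ)).measure_lt_top).ne
  have hAr : 0 < (volume : Measure (Rd d)).real (A n) := ENNReal.toReal_pos hn hAfin
  have hint : Integrable ((A n).indicator fun _ => (c : ℂ)) volume :=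
    (integrable_indicator_iff (hAm n)).2 (integrableOn_const hAfin)
  obtain ⟨e₁, he₁, -⟩ := hur.dominated hsolid (h := (A n).indicator fun _ => (c : ℂ))
    hint.locallyIntegrable (fun x => by
      by_cases hx : x ∈ A n
      · rw [Set.indicator_of_mem hx, Complex.norm_real, Real.norm_of_nonneg hc0.le]
        exact hx.1
      · rw [Set.indicator_of_notMem hx]; simp)
  -- The plateau must contain every `x - t` with `‖x‖ ≤ R` and `‖t‖ ≤ n`.
  let b : ContDiffBump (0 : Rd d) := ⟨n + max R 0 + 1, n + max R 0 + 2, by positivity, by linarith⟩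
  obtain ⟨e₂, he₂⟩ := hE.conv_mem e₁ (fun x => (b x : ℂ))
    (Complex.continuous_ofReal.comp b.continuous)
    (b.hasCompactSupport.comp_left (g := fun r : ℝ => (r : ℂ)) rfl)
  have he₂' : Represents ι e₂ fun x => ∫ t, (A n).indicator (fun _ => (c : ℂ)) t * (b (x - t) : ℂ) := by
    refine he₂.trans (Eventually.of_forall fun x => ?_)
    refine integral_congr_ae (he₁.mono fun t ht => ?_)
    simp only [ht]
  set a : ℝ := c * (volume : Measure (Rd d)).real (A n) with ha
  have ha0 : 0 < a := by positivity
  have hval : ∀ x ∈ Metric.closedBall (0 : Rd d) R,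
      ∫ t, (A n).indicator (fun _ => (c : ℂ)) t * (b (x - t) : ℂ) = a := by
    intro x hx
    have : (fun t => (A n).indicator (fun _ => (c : ℂ)) t * (b (x - t) : ℂ)) =
        (A n).indicator fun _ => (c : ℂ) := by
      funext t
      by_cases ht : t ∈ A n
      · have h1 : b (x - t) = 1 := by
          refine b.one_of_mem_closedBall ?_
          have h2 : ‖t‖ ≤ n := by simpa using ht.2
          have h3 : ‖x‖ ≤ R := by simpa using hx
          rw [mem_closedBall_zero_iff]
          change ‖x - t‖ ≤ n + max R 0 + 1
          linarith [norm_sub_le x t, le_max_left R 0]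
        rw [h1]; simp
      · simp [Set.indicator_of_notMem ht]
    rw [this, integral_indicator (hAm n), setIntegral_const, ha]
    simp [mul_comm]
  have he₃ := he₂'.smul ((a : ℂ)⁻¹)
  obtain ⟨e₄, he₄, -⟩ := he₃.dominated hsolid
    (h := (Metric.closedBall (0 : Rd d) R).indicator fun _ => 1)
    ((integrable_indicator_iff measurableSet_closedBall).2
      (integrableOn_const (isCompact_closedBall _ _).measure_lt_top.ne)).locallyIntegrable
    (fun x => by
      by_cases hx : x ∈ Metric.closedBall (0 : Rd d) R
      · rw [Set.indicator_of_mem hx, hval x hx,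
          inv_mul_cancel₀ (Complex.ofReal_ne_zero.2 ha0.ne')]
      · rw [Set.indicator_of_notMem hx, norm_zero]
        exact norm_nonneg _)
  exact ⟨e₄, he₄⟩

end TIBF

/-! ### Automatic continuity of convolutors -/

section ClosedGraph

open Filter Topology

variable {d : ℕ}

/-- A uniformly supported sequence of test functions, bounded in every `jetNorm`. -/
structure IsBoundedSeq (φ : ℕ → TestFn d) (R : ℝ) (B : ℕ → ℝ) : Prop where
  supp : ∀ k x, R < ‖x‖ → φ k x = 0
  bound : ∀ i k x, jetNorm i (φ k) x ≤ B i

/-- Coefficients of the series `∑ a_k φ_k`. Through `ℓ¹` the closed graph theorem is needed only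
between Banach spaces, and the unit vectors, of norm one, correspond to the `φ_k`. -/
abbrev EllOne : Type := lp (fun _ : ℕ => ℂ) 1

theorem EllOne.summable (a : EllOne) : Summable fun k => ‖a k‖ := by
  simpa using (lp.memℓp a).summable (by simp)

theorem EllOne.tsum_norm (a : EllOne) : ∑' k, ‖a k‖ = ‖a‖ := by
  rw [lp.norm_eq_tsum_rpow (by simp)]
  simp

namespace IsBoundedSeq

variable {φ : ℕ → TestFn d} {R : ℝ} {B : ℕ → ℝ}

theorem norm_iteratedFDeriv_term_le (h : IsBoundedSeq φ R B) (a : EllOne) (i k : ℕ) (x : Rd d) :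
    ‖iteratedFDeriv ℝ i (fun x => a k * φ k x) x‖ ≤ ‖a k‖ * B i := by
  have e : (fun x => a k * φ k x) = a k • ⇑(φ k) := rfl
  rw [e, iteratedFDeriv_const_smul_apply ((φ k).smooth.contDiffAt.of_le (by exact_mod_cast le_top)),
    norm_smul]
  gcongr
  exact (norm_iteratedFDeriv_le_jetNorm le_rfl _ _).trans (h.bound i k x)

theorem contDiff_term (a : EllOne) (k : ℕ) : ContDiff ℝ ∞ (fun x => a k * φ k x) :=
  contDiff_const.mul (φ k).smooth

theorem contDiff_series (h : IsBoundedSeq φ R B) (a : EllOne) :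
    ContDiff ℝ ∞ (fun x => ∑' k, a k * φ k x) :=
  contDiff_tsum (N := ⊤) (v := fun i k => ‖a k‖ * B i) (fun k => contDiff_term a k)
    (fun _ _ => a.summable.mul_right _) fun i k x _ => h.norm_iteratedFDeriv_term_le a i k x

theorem series_eq_zero (h : IsBoundedSeq φ R B) (a : EllOne) (x : Rd d) (hx : R < ‖x‖) :
    ∑' k, a k * φ k x = 0 := by
  simp [h.supp _ x hx]

/-- The test function `∑ a_k φ_k`. -/
noncomputable def series (h : IsBoundedSeq φ R B) (a : EllOne) : TestFn d :=
  TestFn.ofContDiff (fun x => ∑' k, a k * φ k x) (h.contDiff_series a)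
    (hasCompactSupport_of_radius (h.series_eq_zero a))

theorem series_apply (h : IsBoundedSeq φ R B) (a : EllOne) (x : Rd d) :
    h.series a x = ∑' k, a k * φ k x := rfl

theorem summable_series (h : IsBoundedSeq φ R B) (a : EllOne) (x : Rd d) :
    Summable fun k => a k * φ k x := by
  refine Summable.of_norm_bounded (a.summable.mul_right (B 0)) fun k => ?_
  rw [norm_mul]
  gcongr
  exact (norm_le_jetNorm 0 _ _).trans (h.bound 0 k x)

theorem series_add (h : IsBoundedSeq φ R B) (a b : EllOne) :
    h.series (a + b) = h.series a + h.series b := by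
  ext x
  change ∑' k, (a + b) k * φ k x = ∑' k, a k * φ k x + ∑' k, b k * φ k x
  rw [← (h.summable_series a x).tsum_add (h.summable_series b x)]
  refine tsum_congr fun k => ?_
  rw [← add_mul]
  rfl

theorem series_smul (h : IsBoundedSeq φ R B) (c : ℂ) (a : EllOne) :
    h.series (c • a) = c • h.series a := by
  ext x
  change ∑' k, (c • a) k * φ k x = c * ∑' k, a k * φ k x
  rw [← tsum_mul_left]
  refine tsum_congr fun k => ?_
  rw [← mul_assoc]
  rfl

theorem series_single (h : IsBoundedSeq φ R B) (k : ℕ) :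
    h.series (lp.single 1 k (1 : ℂ)) = φ k := by
  ext x
  rw [series_apply, tsum_eq_single k]
  · simp
  · intro j hj
    simp [hj]

theorem jetNorm_series_le (h : IsBoundedSeq φ R B) (a : EllOne) (i : ℕ) (x : Rd d) :
    jetNorm i (h.series a) x ≤ (∑ j ∈ Finset.range (i + 1), B j) * ‖a‖ := by
  rw [Finset.sum_mul]
  refine Finset.sum_le_sum fun j _ => ?_
  have e : iteratedFDeriv ℝ j (h.series a) x =
      ∑' k, iteratedFDeriv ℝ j (fun x => a k * φ k x) x :=
    iteratedFDeriv_tsum_apply (N := ⊤) (v := fun i k => ‖a k‖ * B i) (fun k => contDiff_term a k)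
      (fun i _ => a.summable.mul_right _) (fun i k x _ => h.norm_iteratedFDeriv_term_le a i k x)
      le_top x
  rw [e, ← a.tsum_norm, ← tsum_mul_left]
  refine tsum_of_norm_bounded (a.summable.mul_left (B j)).hasSum fun k => ?_
  rw [mul_comm]
  exact h.norm_iteratedFDeriv_term_le a j k x

theorem tendsto_convTestFn_series (h : IsBoundedSeq φ R B) (f : CDistribution d) (x : Rd d)
    {u : ℕ → EllOne} {a : EllOne} (hu : Tendsto u atTop (𝓝 a)) :
    Tendsto (fun n => convTestFn f (h.series (u n)) x) atTop (𝓝 (convTestFn f (h.series a) x)) := by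
  obtain ⟨k, C, hC, hf⟩ := f.exists_bound (‖x‖ + R)
  rw [tendsto_iff_norm_sub_tendsto_zero]
  have hb : ∀ n, ‖convTestFn f (h.series (u n)) x - convTestFn f (h.series a) x‖ ≤
      C * ((∑ j ∈ Finset.range (k + 1), B j) * ‖u n - a‖) := by
    intro n
    have e : convTestFn f (h.series (u n)) x - convTestFn f (h.series a) x =
        f ((h.series (u n - a)).transReflect x) := by
      have h1 : h.series (u n) = h.series (u n - a) + h.series a := by
        rw [← h.series_add, sub_add_cancel]
      have h2 : (h.series (u n)).transReflect x =
          (h.series (u n - a)).transReflect x + (h.series a).transReflect x := by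
        conv_lhs => rw [h1]
        rfl
      rw [convTestFn, convTestFn, h2, map_add, add_sub_cancel_right]
    rw [e]
    refine hf _ (fun t ht => ?_) _ fun t => ?_
    · have h1 : ‖t‖ ≤ ‖x - t‖ + ‖x‖ := by
        rw [norm_sub_rev]; simpa using norm_add_le (t - x) x
      exact h.series_eq_zero _ _ (by linarith)
    · change jetNorm k (fun t => h.series (u n - a) (x - t)) t ≤ _
      rw [jetNorm_const_sub]
      exact h.jetNorm_series_le _ _ _
  have h0 : Tendsto (fun n => C * ((∑ j ∈ Finset.range (k + 1), B j) * ‖u n - a‖)) atTop (𝓝 0) := by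
    have := ((tendsto_iff_norm_sub_tendsto_zero.1 hu).const_mul
      (∑ j ∈ Finset.range (k + 1), B j)).const_mul C
    simpa using this
  exact squeeze_zero (fun _ => norm_nonneg _) hb h0

end IsBoundedSeq

variable {E : Type*} [NormedAddCommGroup E] [NormedSpace ℂ E]
  {ι : E →ₗ[ℂ] (Rd d →ₘ[(volume : Measure (Rd d))] ℂ)}

theorem convTestFn_add (f : CDistribution d) (φ ψ : TestFn d) (x : Rd d) :
    convTestFn f (φ + ψ) x = convTestFn f φ x + convTestFn f ψ x :=
  map_add f (φ.transReflect x) (ψ.transReflect x)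

theorem convTestFn_smul (f : CDistribution d) (c : ℂ) (φ : TestFn d) (x : Rd d) :
    convTestFn f (c • φ) x = c * convTestFn f φ x :=
  map_smul f c (φ.transReflect x)

/-- A convolutor is bounded on bounded sequences of test functions. -/
theorem IsBoundedSeq.exists_norm_le {φ : ℕ → TestFn d} {R : ℝ} {B : ℕ → ℝ}
    (h : IsBoundedSeq φ R B) (hE : IsTIBF ι) {W : WeightSystem d} {f : CDistribution d}
    (hf : f ∈ OCTestFn ι W) (n : ℕ) : ∃ C : ℝ, ∀ k (e : E),
      Represents ι e (fun x => (W.w n x : ℂ) * convTestFn f (φ k) x) → ‖e‖ ≤ C := by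
  have := hE.complete
  choose T hT using fun a : EllOne => (hf (h.series a)).2 n
  let L : EllOne →ₗ[ℂ] E :=
    { toFun := T
      map_add' := fun a b => by
        refine Represents.unique hE (hT (a + b)) (((hT a).add (hT b)).congr fun x => ?_)
        rw [h.series_add, convTestFn_add]
        ring
      map_smul' := fun c a => by
        refine Represents.unique hE (hT (c • a)) (((hT a).smul c).congr fun x => ?_)
        rw [h.series_smul, convTestFn_smul]
        ring }
  -- The graph is closed: convergence of the coefficients makes the convolutions converge pointwise,
  -- and a limit in `E` must agree with the pointwise limit.
  have hL : ∀ (u : ℕ → EllOne) (a : EllOne) (e : E), Tendsto u atTop (𝓝 a) →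
      Tendsto (L ∘ u) atTop (𝓝 e) → e = L a := by
    intro u a e hu he
    refine Represents.unique hE ?_ (hT a)
    exact hE.represents_of_tendsto (fun m => hT (u m)) he fun x =>
      (h.tendsto_convTestFn_series f x hu).const_mul _
  let A : EllOne →L[ℂ] E := ContinuousLinearMap.ofSeqClosedGraph fun u a e => hL u a e
  refine ⟨‖A‖, fun k e he => ?_⟩
  have h1 : e = A (lp.single 1 k (1 : ℂ)) := by
    refine Represents.unique hE he ((hT (lp.single 1 k (1 : ℂ))).congr fun x => ?_)
    rw [h.series_single]
  rw [h1]
  refine (A.le_opNorm _).trans (le_of_eq ?_)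
  rw [lp.norm_single (by simp)]
  simp

/-- A convolutor is continuous on the test functions supported in a ball. -/
theorem exists_norm_le_of_mem_OCTestFn (hE : IsTIBF ι) {W : WeightSystem d} {f : CDistribution d}
    (hf : f ∈ OCTestFn ι W) (R : ℝ) (n : ℕ) : ∃ (k : ℕ) (C : ℝ), 0 ≤ C ∧ ∀ ψ : TestFn d,
      (∀ x, R < ‖x‖ → ψ x = 0) → ∀ M : ℝ, (∀ x, jetNorm k ψ x ≤ M) → ∀ e : E,
        Represents ι e (fun x => (W.w n x : ℂ) * convTestFn f ψ x) → ‖e‖ ≤ C * M := by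
  by_contra! hcon
  -- The same `k` serves as the order of derivatives and as the constant in the failing estimate.
  choose ψ hsupp M hM e he hlt using fun k : ℕ => hcon k k (Nat.cast_nonneg k)
  have hM0 : ∀ k, 0 ≤ M k := fun k => (jetNorm_nonneg _ _ _).trans (hM k 0)
  have he0 : ∀ k, 0 < ‖e k‖ := fun k =>
    (mul_nonneg (Nat.cast_nonneg k) (hM0 k)).trans_lt (hlt k)
  -- After this scaling the norms in `E` are exactly `k`, while the derivatives of order at most `k`
  -- of the `k`-th function stay bounded by one.
  let c : ℕ → ℂ := fun k => ((k / ‖e k‖ : ℝ) : ℂ)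
  have hc : ∀ k, ‖c k‖ = k / ‖e k‖ := fun k => by
    rw [Complex.norm_real, Real.norm_of_nonneg (div_nonneg (Nat.cast_nonneg k) (norm_nonneg _))]
  let φ : ℕ → TestFn d := fun k => c k • ψ k
  have hjet : ∀ i k x, jetNorm i (φ k) x = ‖c k‖ * jetNorm i (ψ k) x := fun i k x =>
    jetNorm_const_smul i (ψ k).smooth (c k) x
  have hjet1 : ∀ k x, jetNorm k (φ k) x ≤ 1 := by
    intro k x
    rw [hjet, hc, div_mul_eq_mul_div, div_le_one (he0 k)]
    exact (mul_le_mul_of_nonneg_left (hM k x) (Nat.cast_nonneg k)).trans (hlt k).le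
  choose m hm0 hm using fun i k => exists_jetNorm_le i (φ k).smooth (φ k).hasCompactSupport
  -- In order `i` the members with `k ≥ i` are bounded by one; the finitely many earlier ones
  -- contribute their own bounds.
  have hb : IsBoundedSeq φ R (fun i => 1 + ∑ k ∈ Finset.range i, m i k) := by
    refine ⟨fun k x hx => ?_, fun i k x => ?_⟩
    · change c k * ψ k x = 0
      rw [hsupp k x hx, mul_zero]
    · have hs : 0 ≤ ∑ k ∈ Finset.range i, m i k := Finset.sum_nonneg fun k _ => hm0 i k
      by_cases hik : i ≤ k
      · exact ((jetNorm_mono hik _ x).trans (hjet1 k x)).trans (le_add_of_nonneg_right hs)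
      · refine (hm i k x).trans (le_add_of_nonneg_of_le zero_le_one ?_)
        exact Finset.single_le_sum (f := fun k => m i k) (fun k _ => hm0 i k)
          (Finset.mem_range.2 (not_le.1 hik))
  obtain ⟨C, hC⟩ := hb.exists_norm_le hE hf n
  obtain ⟨k, hk⟩ := exists_nat_gt C
  have h1 := hC k (c k • e k) (((he k).smul (c k)).congr fun x => by
    rw [convTestFn_smul]; ring)
  rw [norm_smul, hc, div_mul_cancel₀ _ (he0 k).ne'] at h1
  linarith

end ClosedGraph

/-! ### Weights -/

section Weights

variable {d : ℕ}

theorem WeightSystem.mono (W : WeightSystem d) {n m : ℕ} (h : n ≤ m) (x : Rd d) :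
    W.w n x ≤ W.w m x :=
  monotone_nat_of_le_succ (f := fun n => W.w n x) (fun n => W.le_succ n x) h

theorem WeightSystem.pos (W : WeightSystem d) (n : ℕ) (x : Rd d) : 0 < W.w n x :=
  zero_lt_one.trans_le (W.one_le n x)

theorem WeightSystem.norm_coe (W : WeightSystem d) (n : ℕ) (x : Rd d) :
    ‖(W.w n x : ℂ)‖ = W.w n x := by
  rw [Complex.norm_real, Real.norm_of_nonneg (W.pos n x).le]

/-- Iterating `(wM)`: the unit ball may be replaced by any ball. -/
theorem WeightSystem.WeaklyModerate.closedBall {W : WeightSystem d} (hW : W.WeaklyModerate)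
    (R : ℝ) (n : ℕ) : ∃ (m : ℕ) (C : ℝ), 0 < C ∧
      ∀ x y : Rd d, ‖y‖ ≤ R → W.w n (x + y) ≤ C * W.w m x := by
  have key : ∀ (N : ℕ) (n : ℕ), ∃ (m : ℕ) (C : ℝ), 0 < C ∧ ∀ x z : Rd d, ‖z‖ ≤ 1 →
      W.w n (x + (N : ℝ) • z) ≤ C * W.w m x := by
    intro N
    induction N with
    | zero => exact fun n => ⟨n, 1, one_pos, fun x z _ => by simp⟩
    | succ N ih =>
      intro n
      obtain ⟨m, _, C, hC, h⟩ := hW n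
      obtain ⟨m', C', hC', h'⟩ := ih m
      refine ⟨m', C * C', by positivity, fun x z hz => ?_⟩
      have e : x + ((N + 1 : ℕ) : ℝ) • z = (x + (N : ℝ) • z) + z := by
        push_cast; rw [add_smul, one_smul, add_assoc]
      rw [e, mul_assoc]
      exact (h _ z (by simpa using hz)).trans (mul_le_mul_of_nonneg_left (h' x z hz) hC.le)
  obtain ⟨N, hN⟩ := exists_nat_gt (max R 0)
  have hN0 : (0 : ℝ) < N := (le_max_right _ _).trans_lt hN
  obtain ⟨m, C, hC, h⟩ := key N n
  refine ⟨m, C, hC, fun x y hy => ?_⟩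
  have := h x ((N : ℝ)⁻¹ • y) (by
    rw [norm_smul, norm_inv, Real.norm_natCast, inv_mul_le_iff₀ hN0]
    linarith [le_max_left R 0])
  rwa [smul_smul, mul_inv_cancel₀ hN0.ne', one_smul] at this

theorem WeightSystem.WeaklyModerate.check {V : WeightSystem d} (hV : V.WeaklyModerate) :
    V.check.WeaklyModerate := by
  intro n
  obtain ⟨m, hm, C, hC, h⟩ := hV n
  refine ⟨m, hm, C, hC, fun x y hy => ?_⟩
  have := h (-x) (-y) (by simpa using hy)
  change V.w n (-(x + y)) ≤ C * V.w m (-x)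
  rwa [neg_add]

theorem WeightSystem.aestronglyMeasurable_coe (W : WeightSystem d) (n : ℕ) :
    AEStronglyMeasurable (fun x => (W.w n x : ℂ)) (volume : Measure (Rd d)) :=
  (Complex.measurable_ofReal.comp (W.measurable n)).aestronglyMeasurable

theorem WeightSystem.integrableOn_mul (W : WeightSystem d) (n : ℕ) {g : Rd d → ℂ}
    (hg : LocallyIntegrable g volume) {K : Set (Rd d)} (hK : IsCompact K) :
    IntegrableOn (fun x => (W.w n x : ℂ) * g x) K volume := by
  obtain ⟨C, hC⟩ := W.locallyBounded n K hK
  refine Integrable.mono' (((hg.integrableOn_isCompact hK).norm).const_mul C)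
    ((W.aestronglyMeasurable_coe n).restrict.mul hg.aestronglyMeasurable.restrict) ?_
  filter_upwards [ae_restrict_mem hK.measurableSet] with x hx
  rw [norm_mul, W.norm_coe]
  gcongr
  exact hC x hx

theorem WeightSystem.locallyIntegrable_mul (W : WeightSystem d) (n : ℕ) {g : Rd d → ℂ}
    (hg : LocallyIntegrable g volume) : LocallyIntegrable (fun x => (W.w n x : ℂ) * g x) volume :=
  (locallyIntegrable_iff).2 fun _ hK => W.integrableOn_mul n hg hK

end Weights

/-! ### Pointwise bounds for convolutors -/

section Pointwise

variable {d : ℕ} {E : Type*} [NormedAddCommGroup E] [NormedSpace ℂ E]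
  {ι : E →ₗ[ℂ] (Rd d →ₘ[(volume : Measure (Rd d))] ℂ)}

/-- Apply the global inequality to `G` times a bump equal to one at `x`. Translates of one bump are
used, so the constant does not depend on `x`. -/
theorem exists_sobolev_closedBall (d : ℕ) : ∃ C : ℝ, 0 ≤ C ∧ ∀ G : Rd d → ℂ, ContDiff ℝ ∞ G →
    ∀ x, ‖G x‖ ≤ C * ∫ y in Metric.closedBall x 1, jetNorm (d + 1) G y := by
  obtain ⟨C, hC, hS⟩ := exists_sobolev d
  let b : ContDiffBump (0 : Rd d) := ⟨1 / 2, 1, by norm_num, by norm_num⟩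
  let χ : Rd d → ℂ := fun x => (b x : ℂ)
  have hχ : ContDiff ℝ ∞ χ := Complex.ofRealCLM.contDiff.comp b.contDiff
  have hχc : HasCompactSupport χ :=
    b.hasCompactSupport.comp_left (g := fun r : ℝ => (r : ℂ)) rfl
  obtain ⟨A, hA0, hA⟩ := exists_jetNorm_le (d + 1) hχ hχc
  set c : ℝ := (((d + 1 : ℕ) : ℝ) + 1) * 2 ^ (d + 1) * A with hc
  have hc0 : 0 ≤ c := by positivity
  refine ⟨C * c, by positivity, fun G hG x => ?_⟩
  let χx : Rd d → ℂ := fun y => χ (y - x)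
  have hχx : ContDiff ℝ ∞ χx := hχ.comp (contDiff_id.sub contDiff_const)
  have hzero : ∀ y ∉ Metric.closedBall x 1, χx y = 0 := by
    intro y hy
    have : b (y - x) = 0 := b.zero_of_le_dist (by
      rw [dist_zero_right, ← dist_eq_norm]
      exact (not_le.1 hy).le)
    simp [χx, χ, this]
  have hsub : tsupport (fun y => χx y * G y) ⊆ Metric.closedBall x 1 := by
    refine closure_minimal (fun y hy => ?_) Metric.isClosed_closedBall
    by_contra hy'
    exact hy (by simp [hzero y hy'])
  have hcs : HasCompactSupport (fun y => χx y * G y) :=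
    (isCompact_closedBall x 1).of_isClosed_subset (isClosed_tsupport _) hsub
  have hval : χx x * G x = G x := by
    have : b 0 = 1 := b.one_of_mem_closedBall (by simp [b])
    simp [χx, χ, this]
  have h1 := hS (fun y => χx y * G y) (hχx.mul hG) hcs x
  simp only [hval] at h1
  refine h1.trans ?_
  rw [mul_assoc]
  refine mul_le_mul_of_nonneg_left ?_ hC
  rw [← integral_const_mul, ← integral_indicator measurableSet_closedBall]
  refine integral_mono (integrable_jetNorm _ (hχx.mul hG) hcs) ?_ fun y => ?_
  · exact (integrable_indicator_iff measurableSet_closedBall).2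
      ((continuous_const.mul (continuous_jetNorm _ hG)).continuousOn.integrableOn_compact
        (isCompact_closedBall x 1))
  · by_cases hy : y ∈ Metric.closedBall x 1
    · rw [Set.indicator_of_mem hy]
      refine jetNorm_mul_le (d + 1) hχx hG ?_
      rw [jetNorm_comp_sub]
      exact hA _
    · rw [Set.indicator_of_notMem hy,
        jetNorm_eq_zero_of_notMem_tsupport _ (fun h => hy (hsub h))]

/-- Local Sobolev bounds the value at `x` by integrals over the unit ball at `x` of `f` convolved
with derivatives of `ψ`. There (wM) replaces `w_n(x)` by `w_m(y)`, and the local integrals are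
controlled by norms in `E` uniformly in `x`. -/
theorem exists_pointwise_le_of_mem_OCTestFn (hE : IsTIBF ι) {W : WeightSystem d}
    (hW : W.WeaklyModerate) {f : CDistribution d} (hf : f ∈ OCTestFn ι W) (R : ℝ) (n : ℕ) :
    ∃ (k : ℕ) (C : ℝ), 0 ≤ C ∧ ∀ ψ : TestFn d, (∀ x, R < ‖x‖ → ψ x = 0) →
      ∀ M : ℝ, (∀ x, jetNorm k ψ x ≤ M) → ∀ x, W.w n x * ‖convTestFn f ψ x‖ ≤ C * M := by
  obtain ⟨m, D, hD, hDw⟩ := hW.closedBall 1 n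
  obtain ⟨k, C₁, hC₁, hk⟩ := exists_norm_le_of_mem_OCTestFn hE hf R m
  obtain ⟨C₂, hC₂, hint⟩ := hE.exists_setIntegral_closedBall_le 1
  obtain ⟨C₃, hC₃, hS⟩ := exists_sobolev_closedBall d
  -- The Sobolev inequality costs `d + 1` derivatives beyond the order `k` of the closed graph
  -- estimate.
  refine ⟨k + (d + 1), C₃ * ∑ i ∈ Finset.range (d + 1 + 1), ∑ _s : Fin i → Fin d, D * (C₂ * C₁),
    by positivity, fun ψ hψ M hM x => ?_⟩
  have hcont : ∀ φ : TestFn d, Continuous (convTestFn f φ) := fun φ =>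
    (contDiff_convTestFn f φ).continuous
  have hter : ∀ i ∈ Finset.range (d + 1 + 1), ∀ s : Fin i → Fin d,
      W.w n x * ∫ y in Metric.closedBall x 1, ‖convTestFn f (TestFn.iterDeriv i s ψ) y‖ ≤
        D * (C₂ * C₁) * M := by
    intro i hi s
    set T := TestFn.iterDeriv i s ψ
    obtain ⟨e, he⟩ := (hf T).2 m
    have h1 : ‖e‖ ≤ C₁ * M := hk T (TestFn.iterDeriv_eq_zero i s ψ hψ) M (fun y =>
      ((TestFn.jetNorm_iterDeriv_le i k s ψ y).trans (jetNorm_mono (by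
        have := Finset.mem_range.1 hi; omega) _ _)).trans (hM y)) e he
    have h2 := hint x e _ he
    rw [← integral_const_mul]
    calc ∫ y in Metric.closedBall x 1, W.w n x * ‖convTestFn f T y‖
        ≤ ∫ y in Metric.closedBall x 1, D * ‖(W.w m y : ℂ) * convTestFn f T y‖ := by
          refine setIntegral_mono_on ?_ ?_ measurableSet_closedBall fun y hy => ?_
          · exact (continuous_const.mul (hcont T).norm).continuousOn.integrableOn_compact
              (isCompact_closedBall x 1)
          · exact ((W.integrableOn_mul m (hcont T).locallyIntegrable
              (isCompact_closedBall x 1)).norm).const_mul D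
          · rw [norm_mul, W.norm_coe, ← mul_assoc]
            gcongr
            have := hDw y (x - y) (by rw [norm_sub_rev]; simpa [dist_eq_norm] using hy)
            rwa [add_sub_cancel] at this
      _ ≤ D * (C₂ * ‖e‖) := by
          rw [integral_const_mul]
          gcongr
      _ ≤ D * (C₂ * (C₁ * M)) := by gcongr
      _ = D * (C₂ * C₁) * M := by ring
  have hsum : ∫ y in Metric.closedBall x 1, jetNorm (d + 1) (convTestFn f ψ) y ≤
      ∑ i ∈ Finset.range (d + 1 + 1), ∑ s : Fin i → Fin d,
        ∫ y in Metric.closedBall x 1, ‖convTestFn f (TestFn.iterDeriv i s ψ) y‖ := by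
    have hi : ∀ φ : TestFn d,
        IntegrableOn (fun y => ‖convTestFn f φ y‖) (Metric.closedBall x 1) volume := fun φ =>
      (hcont φ).norm.continuousOn.integrableOn_compact (isCompact_closedBall x 1)
    have hj : ∀ i, IntegrableOn (fun y => ∑ s : Fin i → Fin d,
        ‖convTestFn f (TestFn.iterDeriv i s ψ) y‖) (Metric.closedBall x 1) volume := fun i =>
      integrable_finsetSum _ fun s _ => hi _
    have e : ∀ i, ∑ s : Fin i → Fin d, ∫ y in Metric.closedBall x 1,
        ‖convTestFn f (TestFn.iterDeriv i s ψ) y‖ = ∫ y in Metric.closedBall x 1,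
          ∑ s : Fin i → Fin d, ‖convTestFn f (TestFn.iterDeriv i s ψ) y‖ := fun i =>
      (integral_finsetSum _ fun s _ => hi _).symm
    simp only [e]
    rw [← integral_finsetSum _ fun i _ => hj i]
    exact integral_mono ((continuous_jetNorm _
      (contDiff_convTestFn f ψ)).continuousOn.integrableOn_compact (isCompact_closedBall x 1))
      (integrable_finsetSum _ fun i _ => hj i) fun y => jetNorm_convTestFn_le f (d + 1) ψ y
  calc W.w n x * ‖convTestFn f ψ x‖
      ≤ W.w n x * (C₃ * ∑ i ∈ Finset.range (d + 1 + 1), ∑ s : Fin i → Fin d,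
        ∫ y in Metric.closedBall x 1, ‖convTestFn f (TestFn.iterDeriv i s ψ) y‖) := by
        refine mul_le_mul_of_nonneg_left ?_ (W.pos n x).le
        exact (hS _ (contDiff_convTestFn f ψ) x).trans (mul_le_mul_of_nonneg_left hsum hC₃)
    _ = C₃ * ∑ i ∈ Finset.range (d + 1 + 1), ∑ s : Fin i → Fin d,
        W.w n x * ∫ y in Metric.closedBall x 1, ‖convTestFn f (TestFn.iterDeriv i s ψ) y‖ := by
        simp only [← Finset.mul_sum]
        ring
    _ ≤ C₃ * ∑ i ∈ Finset.range (d + 1 + 1), ∑ _s : Fin i → Fin d, D * (C₂ * C₁) * M := by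
        exact mul_le_mul_of_nonneg_left (Finset.sum_le_sum fun i hi =>
          Finset.sum_le_sum fun s _ => hter i hi s) hC₃
    _ = _ := by
        simp only [← Finset.sum_mul]
        ring

end Pointwise

/-! ### A smooth partition of unity along the integer lattice -/

section Lattice

variable {d : ℕ}

/-- The points of the lattice `ℤ^d` in `ℝ^d`. -/
def latticePoint (j : Fin d → ℤ) : Rd d := WithLp.toLp 2 fun i => (j i : ℝ)

@[simp]
theorem latticePoint_apply (j : Fin d → ℤ) (i : Fin d) : latticePoint j i = j i := rfl

theorem norm_le_of_abs_le_one {z : Rd d} (h : ∀ i, |z i| ≤ 1) : ‖z‖ ≤ d := by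
  have hv : z = ∑ i, z i • EuclideanSpace.single i (1 : ℝ) := by
    ext l
    simp [Finset.sum_apply, Pi.single_apply]
  rw [hv]
  refine (norm_sum_le _ _).trans ?_
  refine (Finset.sum_le_sum (g := fun _ => (1 : ℝ)) fun i _ => ?_).trans (by simp)
  rw [norm_smul]
  simpa using h i

/-- The box of lattice points containing all those at distance at most `R` from `y`. -/
noncomputable def latticeBox (y : Rd d) (R : ℝ) : Finset (Fin d → ℤ) :=
  Fintype.piFinset fun i => Finset.Icc ⌈y i - R⌉ ⌊y i + R⌋

theorem mem_latticeBox {y : Rd d} {R : ℝ} {j : Fin d → ℤ} (h : ‖y - latticePoint j‖ ≤ R) :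
    j ∈ latticeBox y R := by
  refine Fintype.mem_piFinset.2 fun i => ?_
  have h1 : |y i - j i| ≤ R := by
    simpa using (PiLp.norm_apply_le (y - latticePoint j) i).trans h
  rw [abs_le] at h1
  exact Finset.mem_Icc.2 ⟨Int.ceil_le.2 (by linarith), Int.le_floor.2 (by linarith)⟩

theorem card_latticeBox_le (y : Rd d) (R : ℝ) : (latticeBox y R).card ≤ ⌈2 * R + 1⌉₊ ^ d := by
  rw [latticeBox, Fintype.card_piFinset]
  refine (Finset.prod_le_pow_card _ _ ⌈2 * R + 1⌉₊ fun i _ => ?_).trans (by simp)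
  rw [Int.card_Icc]
  have h1 : ((⌊y i + R⌋ + 1 - ⌈y i - R⌉ : ℤ) : ℝ) ≤ 2 * R + 1 := by
    push_cast
    linarith [Int.floor_le (y i + R), Int.le_ceil (y i - R)]
  rw [Int.toNat_le]
  have h2 := h1.trans (Nat.le_ceil _)
  exact_mod_cast h2

/-- The balls of a fixed radius around the lattice points have bounded overlap. -/
theorem sum_setIntegral_closedBall_le (R : ℝ) (J : Finset (Fin d → ℤ)) {h : Rd d → ℝ}
    (h0 : ∀ x, 0 ≤ h x) (hi : Integrable h volume) :
    ∑ j ∈ J, ∫ y in Metric.closedBall (latticePoint j) R, h y ≤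
      (⌈2 * R + 1⌉₊ ^ d : ℕ) * ∫ y, h y := by
  classical
  have e : ∀ j, ∫ y in Metric.closedBall (latticePoint j) R, h y =
      ∫ y, (Metric.closedBall (latticePoint j) R).indicator h y := fun j =>
    (integral_indicator measurableSet_closedBall).symm
  simp only [e]
  rw [← integral_finsetSum _ fun j _ => hi.indicator measurableSet_closedBall,
    ← integral_const_mul]
  refine integral_mono (integrable_finsetSum _ fun j _ => hi.indicator measurableSet_closedBall)
    (hi.const_mul _) fun y => ?_
  have h1 : ∑ j ∈ J, (Metric.closedBall (latticePoint j) R).indicator h y ≤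
      ∑ _j ∈ latticeBox y R, h y := by
    have h2 : ∑ j ∈ J, (Metric.closedBall (latticePoint j) R).indicator h y =
        ∑ j ∈ J.filter (fun j => y ∈ Metric.closedBall (latticePoint j) R), h y := by
      rw [Finset.sum_filter]
      rfl
    rw [h2]
    refine Finset.sum_le_sum_of_subset_of_nonneg (fun j hj => ?_) fun _ _ _ => h0 y
    have := (Finset.mem_filter.1 hj).2
    exact mem_latticeBox (by simpa [dist_eq_norm] using this)
  refine h1.trans ?_
  rw [Finset.sum_const, nsmul_eq_mul]
  refine mul_le_mul_of_nonneg_right ?_ (h0 y)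
  exact_mod_cast card_latticeBox_le y R

open Convolution in
-- `χ` is the indicator of the half-open unit cube convolved with a mollifier `ρ`. The lattice
-- translates of the cube tile space, so the translates of `χ` sum to `∫ ρ = 1`.
theorem exists_lattice_partition (d : ℕ) : ∃ (χ : Rd d → ℂ) (R : ℝ), ContDiff ℝ ∞ χ ∧
    (∀ x, R < ‖x‖ → χ x = 0) ∧ ∀ (J : Finset (Fin d → ℤ)) (x : Rd d),
      (∀ j, ‖x - latticePoint j‖ ≤ R → j ∈ J) → ∑ j ∈ J, χ (x - latticePoint j) = 1 := by
  let Q : Set (Rd d) := {z | ∀ i, 0 ≤ z i ∧ z i < 1}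
  have hQm : MeasurableSet Q := by
    have : Q = ⋂ i, {z : Rd d | 0 ≤ z i} ∩ {z : Rd d | z i < 1} := by
      ext z; simp [Q]
    rw [this]
    have hc : ∀ i, Measurable fun z : Rd d => z i := fun i =>
      (EuclideanSpace.proj (𝕜 := ℝ) i).continuous.measurable
    exact MeasurableSet.iInter fun i => (measurableSet_le measurable_const (hc i)).inter
      (measurableSet_lt (hc i) measurable_const)
  have hQb : ∀ z ∈ Q, ‖z‖ ≤ d := fun z hz => norm_le_of_abs_le_one fun i => by
    rw [abs_le]
    exact ⟨by linarith [(hz i).1], (hz i).2.le⟩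
  let u : Rd d → ℝ := Q.indicator fun _ => 1
  have hQfin : volume Q ≠ ⊤ := ((measure_mono fun z hz => by
    simpa using hQb z hz).trans_lt (isCompact_closedBall (0 : Rd d) (d : ℝ)).measure_lt_top).ne
  have hui : Integrable u volume := (integrable_indicator_iff hQm).2 (integrableOn_const hQfin)
  let b : ContDiffBump (0 : Rd d) := ⟨1 / 2, 1, by norm_num, by norm_num⟩
  let ρ : Rd d → ℝ := b.normed volume
  have hρ : ContDiff ℝ ∞ ρ := b.contDiff_normed
  have hρc : HasCompactSupport ρ := b.hasCompactSupport_normed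
  have hρi : Integrable ρ volume := hρ.continuous.integrable_of_hasCompactSupport hρc
  have hρ0 : ∀ x, 1 < ‖x‖ → ρ x = 0 := by
    intro x hx
    refine image_eq_zero_of_notMem_tsupport fun h => ?_
    rw [b.tsupport_normed_eq] at h
    have : ‖x‖ ≤ 1 := by simpa [b] using h
    linarith
  let χ : Rd d → ℝ := fun x => ∫ t, u t * ρ (x - t)
  have hχ : ContDiff ℝ ∞ χ :=
    hρc.contDiff_convolution_right (ContinuousLinearMap.lsmul ℝ ℝ) hui.locallyIntegrable hρ
  -- The cube lies in the ball of radius `d`, and the mollifier adds one.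
  refine ⟨fun x => (χ x : ℂ), d + 1, Complex.ofRealCLM.contDiff.comp hχ, fun x hx => ?_,
    fun J x hJ => ?_⟩
  · have : (fun t => u t * ρ (x - t)) = fun _ => 0 := by
      funext t
      by_cases ht : t ∈ Q
      · have h1 : ‖x‖ ≤ ‖x - t‖ + ‖t‖ := by simpa using norm_add_le (x - t) t
        rw [hρ0 (x - t) (by linarith [hQb t ht]), mul_zero]
      · simp [u, Set.indicator_of_notMem ht]
    simp [χ, this]
  · have hprod : ∀ a : Rd d, Integrable (fun t => u (t - a) * ρ (x - t)) volume := by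
      intro a
      refine (hρi.comp_sub_left x).norm.mono' ((hui.comp_sub_right a).aestronglyMeasurable.mul
        (hρi.comp_sub_left x).aestronglyMeasurable) (Filter.Eventually.of_forall fun t => ?_)
      rw [norm_mul]
      refine mul_le_of_le_one_left (norm_nonneg _) ?_
      by_cases ht : t - a ∈ Q
      · simp [u, Set.indicator_of_mem ht]
      · simp [u, Set.indicator_of_notMem ht]
    have h1 : ∀ j, χ (x - latticePoint j) = ∫ t, u (t - latticePoint j) * ρ (x - t) := by
      intro j
      change ∫ t, u t * ρ (x - latticePoint j - t) = _
      rw [← integral_sub_right_eq_self (fun t => u t * ρ (x - latticePoint j - t))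
        (latticePoint j)]
      refine integral_congr_ae (Filter.Eventually.of_forall fun t => ?_)
      simp only
      congr 2
      abel
    have h2 : ∀ t, (∑ j ∈ J, u (t - latticePoint j) * ρ (x - t)) = ρ (x - t) := by
      intro t
      by_cases ht : 1 < ‖x - t‖
      · simp [hρ0 _ ht]
      · rw [← Finset.sum_mul]
        have h3 : ∑ j ∈ J, u (t - latticePoint j) = 1 := by
          have hfl : t - latticePoint (fun i => ⌊t i⌋) ∈ Q := fun i => by
            simp only [PiLp.sub_apply, latticePoint_apply]
            exact ⟨by linarith [Int.floor_le (t i)], by linarith [Int.lt_floor_add_one (t i)]⟩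
          rw [Finset.sum_eq_single (fun i => ⌊t i⌋)]
          · simp [u, Set.indicator_of_mem hfl]
          · intro j _ hj
            refine Set.indicator_of_notMem (fun h => hj ?_) _
            funext i
            have := h i
            simp only [PiLp.sub_apply, latticePoint_apply] at this
            exact (Int.floor_eq_iff.2 ⟨by linarith, by linarith⟩).symm
          · intro hnot
            refine absurd (hJ _ ?_) hnot
            have h4 := norm_add_le (x - t) (t - latticePoint fun i => ⌊t i⌋)
            rw [sub_add_sub_cancel] at h4
            linarith [hQb _ hfl]
        rw [h3, one_mul]
    have h5 : ∑ j ∈ J, χ (x - latticePoint j) = 1 := by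
      simp only [h1]
      rw [← integral_finsetSum _ fun j _ => hprod _]
      simp only [h2]
      rw [integral_sub_left_eq_self ρ volume x]
      exact b.integral_normed
    change ∑ j ∈ J, (χ (x - latticePoint j) : ℂ) = 1
    exact_mod_cast h5

end Lattice

/-! ### The Fréchet space `𝒦¹_V` -/

namespace K1

open Filter Topology

variable {d : ℕ} {V : WeightSystem d}

theorem integrable_mul_jetNorm (φ : K1 V) (m k : ℕ) :
    Integrable (fun x => V.w m x * jetNorm k φ x) volume := by
  have hi : Integrable (fun x => ∑ i ∈ Finset.range (k + 1), ∑ s : Fin i → Fin d,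
      ‖(V.w m x : ℂ) * partialDeriv s φ x‖) volume :=
    integrable_finsetSum _ fun i _ => integrable_finsetSum _ fun s _ => (φ.integrable m i s).norm
  refine hi.mono' ((V.measurable m).aestronglyMeasurable.mul
    (continuous_jetNorm k φ.contDiff).aestronglyMeasurable) (Eventually.of_forall fun x => ?_)
  rw [Real.norm_of_nonneg (mul_nonneg (V.pos m x).le (jetNorm_nonneg _ _ _)), jetNorm,
    Finset.mul_sum]
  refine Finset.sum_le_sum fun i _ => ?_
  refine (mul_le_mul_of_nonneg_left (norm_iteratedFDeriv_le_sum_partialDeriv i φ x)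
    (V.pos m x).le).trans (le_of_eq ?_)
  rw [Finset.mul_sum]
  exact Finset.sum_congr rfl fun s _ => by rw [norm_mul, V.norm_coe]

/-- Together with `seminormFamily_le`, this shows that the weighted integrals of `jetNorm` define
the topology of `𝒦¹_V`; all later estimates are stated with them. -/
theorem integral_mul_jetNorm_le (φ : K1 V) (m k : ℕ) :
    ∫ x, V.w m x * jetNorm k φ x ≤ ∑ i ∈ Finset.range (k + 1), ∑ s : Fin i → Fin d,
      seminormFamily V (m, ⟨i, s⟩) φ := by
  have e : ∀ i, ∑ s : Fin i → Fin d, seminormFamily V (m, ⟨i, s⟩) φ =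
      ∫ x, ∑ s : Fin i → Fin d, ‖(V.w m x : ℂ) * partialDeriv s φ x‖ := fun i =>
    (integral_finsetSum _ fun s _ => (φ.integrable m i s).norm).symm
  have hi : ∀ i, Integrable (fun x => ∑ s : Fin i → Fin d,
      ‖(V.w m x : ℂ) * partialDeriv s φ x‖) volume := fun i =>
    integrable_finsetSum _ fun s _ => (φ.integrable m i s).norm
  simp only [e]
  rw [← integral_finsetSum _ fun i _ => hi i]
  refine integral_mono (φ.integrable_mul_jetNorm m k) (integrable_finsetSum _ fun i _ => hi i)
    fun x => ?_
  rw [jetNorm, Finset.mul_sum]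
  refine Finset.sum_le_sum fun i _ => ?_
  refine (mul_le_mul_of_nonneg_left (norm_iteratedFDeriv_le_sum_partialDeriv i φ x)
    (V.pos m x).le).trans (le_of_eq ?_)
  rw [Finset.mul_sum]
  exact Finset.sum_congr rfl fun s _ => by rw [norm_mul, V.norm_coe]

theorem seminormFamily_le (φ : K1 V) (m k : ℕ) (s : Fin k → Fin d) :
    seminormFamily V (m, ⟨k, s⟩) φ ≤ ∫ x, V.w m x * jetNorm k φ x := by
  refine integral_mono (φ.integrable m k s).norm (φ.integrable_mul_jetNorm m k) fun x => ?_
  simp only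
  rw [norm_mul, V.norm_coe]
  refine mul_le_mul_of_nonneg_left ?_ (V.pos m x).le
  exact (norm_partialDeriv_le s _ x).trans (norm_iteratedFDeriv_le_jetNorm le_rfl _ x)

theorem tendsto_of_seminorm {u : ℕ → K1 V} {φ : K1 V}
    (h : ∀ i, Tendsto (fun N => seminormFamily V i (u N - φ)) atTop (𝓝 0)) :
    Tendsto u atTop (𝓝 φ) := by
  refine (withSeminorms.tendsto_nhds u φ).2 fun i ε hε => ?_
  exact (h i).eventually (gt_mem_nhds hε)

theorem seminorm_tendsto {u : ℕ → K1 V} {φ : K1 V} (h : Tendsto u atTop (𝓝 φ)) (i) :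
    Tendsto (fun N => seminormFamily V i (u N - φ)) atTop (𝓝 0) := by
  have h1 : Continuous (seminormFamily V i) := withSeminorms.continuous_seminorm i
  have h2 : Tendsto (fun N => u N - φ) atTop (𝓝 (φ - φ)) := h.sub tendsto_const_nhds
  rw [sub_self] at h2
  have h3 := (h1.tendsto 0).comp h2
  rw [map_zero] at h3
  exact h3

theorem exists_seminorm_transReflect_le (hV : V.WeaklyModerate) (x : Rd d) (n k : ℕ)
    (s : Fin k → Fin d) : ∃ (m : ℕ) (C : ℝ), ∀ φ : K1 V,
      seminormFamily V.check (n, ⟨k, s⟩) (φ.transReflect hV x) ≤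
        C * seminormFamily V (m, ⟨k, s⟩) φ := by
  obtain ⟨m, C, hC⟩ := hV.translate n (-x)
  refine ⟨m, C, fun φ => ?_⟩
  change ∫ t, ‖(V.w n (-t) : ℂ) * partialDeriv s (fun t => φ (x - t)) t‖ ≤
    C * ∫ t, ‖(V.w m t : ℂ) * partialDeriv s φ t‖
  have e : ∀ t, ‖(V.w n (-t) : ℂ) * partialDeriv s (fun t => φ (x - t)) t‖ =
      (fun t => ‖(V.w n (t + -x) : ℂ) * partialDeriv s φ t‖) (x - t) := by
    intro t
    simp only [partialDeriv_const_sub s φ.contDiff, norm_mul, norm_pow, norm_neg, norm_one,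
      one_pow, one_mul]
    rw [show x - t + -x = -t by abel]
  simp only [e]
  rw [integral_sub_left_eq_self (fun t => ‖(V.w n (t + -x) : ℂ) * partialDeriv s φ t‖) volume x,
    ← integral_const_mul]
  refine integral_mono_of_nonneg (Eventually.of_forall fun _ => norm_nonneg _)
    ((φ.integrable m k s).norm.const_mul C) (Eventually.of_forall fun t => ?_)
  simp only [norm_mul, V.norm_coe]
  rw [← mul_assoc]
  gcongr
  exact hC t

theorem tendsto_transReflect (hV : V.WeaklyModerate) (x : Rd d) {u : ℕ → K1 V} {φ : K1 V}
    (h : Tendsto u atTop (𝓝 φ)) :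
    Tendsto (fun N => (u N).transReflect hV x) atTop (𝓝 (φ.transReflect hV x)) := by
  refine tendsto_of_seminorm ?_
  rintro ⟨n, k, s⟩
  obtain ⟨m, C, hC⟩ := exists_seminorm_transReflect_le hV x n k s
  have h1 := (seminorm_tendsto h (m, ⟨k, s⟩)).const_mul C
  rw [mul_zero] at h1
  exact squeeze_zero (fun _ => apply_nonneg _ _) (fun N => hC (u N - φ)) h1

/-- Smooth cutoffs with uniformly bounded derivatives. -/
theorem _root_.exists_cutoff (d : ℕ) : ∃ c : ℕ → Rd d → ℝ, (∀ N, ContDiff ℝ ∞ (c N)) ∧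
    (∀ N, HasCompactSupport (c N)) ∧ (∀ N x, 0 ≤ c N x) ∧
    (∀ (N : ℕ) x, ‖x‖ ≤ N + 1 → c N x = 1) ∧
    ∀ k, ∃ A : ℝ, ∀ N x, jetNorm k (fun y => (c N y : ℂ)) x ≤ A := by
  let b : ContDiffBump (0 : Rd d) := ⟨1, 2, by norm_num, by norm_num⟩
  let ε : ℕ → ℝ := fun N => ((N : ℝ) + 1)⁻¹
  have hε : ∀ N, 0 < ε N := fun N => by positivity
  have hε1 : ∀ N, ε N ≤ 1 := fun N => inv_le_one_of_one_le₀ (by simp)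
  have hb : ContDiff ℝ ∞ (fun y => (b y : ℂ)) := Complex.ofRealCLM.contDiff.comp b.contDiff
  refine ⟨fun N x => b (ε N • x), fun N => b.contDiff.comp (contDiff_const_smul _),
    fun N => ?_, fun N x => b.nonneg, fun N x hx => ?_, fun k => ?_⟩
  · exact b.hasCompactSupport.comp_smul (hε N).ne'
  · refine b.one_of_mem_closedBall ?_
    rw [mem_closedBall_zero_iff, norm_smul, Real.norm_of_nonneg (hε N).le]
    change ((N : ℝ) + 1)⁻¹ * ‖x‖ ≤ 1
    rw [inv_mul_le_iff₀ (by positivity)]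
    linarith
  · obtain ⟨A, hA0, hA⟩ := exists_jetNorm_le k hb
      (b.hasCompactSupport.comp_left (g := fun r : ℝ => (r : ℂ)) rfl)
    refine ⟨A, fun N x => le_trans (Finset.sum_le_sum fun i _ => ?_) (hA (ε N • x))⟩
    have h1 := congrFun (iteratedFDeriv_comp_const_smul (𝕜 := ℝ) (i := i) (ε N)
      (hb.of_le (by exact_mod_cast le_top))) x
    rw [show (fun y => ((b (ε N • y) : ℝ) : ℂ)) = fun y => (fun y => (b y : ℂ)) (ε N • y) from rfl]
    rw [h1, norm_smul, norm_pow, Real.norm_of_nonneg (hε N).le]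
    exact mul_le_of_le_one_left (norm_nonneg _) (pow_le_one₀ (hε N).le (hε1 N))

/-- The test functions are dense in `𝒦¹_V`. -/
theorem exists_tendsto_toK1 (φ : K1 V) : ∃ (c : ℕ → Rd d → ℝ) (u : ℕ → TestFn d),
    (∀ N x, 0 ≤ c N x) ∧ (∀ (N : ℕ) x, ‖x‖ ≤ N + 1 → c N x = 1) ∧ (∀ N x, u N x = c N x * φ x) ∧
    (∀ m k, Tendsto (fun N => ∫ x, V.w m x * jetNorm k (⇑(u N) - (φ : Rd d → ℂ)) x) atTop (𝓝 0)) ∧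
    Tendsto (fun N => TestFn.toK1 V (u N)) atTop (𝓝 φ) := by
  obtain ⟨c, hc, hcs, hc0, hc1, hcb⟩ := exists_cutoff d
  have hcC : ∀ N, ContDiff ℝ ∞ (fun y => (c N y : ℂ)) := fun N =>
    Complex.ofRealCLM.contDiff.comp (hc N)
  have hcsC : ∀ N, HasCompactSupport (fun y => (c N y : ℂ)) := fun N =>
    (hcs N).comp_left (g := fun r : ℝ => (r : ℂ)) rfl
  let u : ℕ → TestFn d := fun N => TestFn.ofContDiff (fun x => (c N x : ℂ) * φ x)
    ((hcC N).mul φ.contDiff) ((hcsC N).mul_right)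
  have hint : ∀ m k, Tendsto (fun N => ∫ x, V.w m x * jetNorm k (⇑(u N) - (φ : Rd d → ℂ)) x)
      atTop (𝓝 0) := by
    intro m k
    obtain ⟨A, hA⟩ := hcb k
    have hle : ∀ N x, jetNorm k (⇑(u N) - (φ : Rd d → ℂ)) x ≤
        ((k + 1) * 2 ^ k * A + 1) * jetNorm k φ x := by
      intro N x
      refine (jetNorm_sub_le k (u N).smooth φ.contDiff x).trans ?_
      rw [add_mul, one_mul]
      gcongr
      exact jetNorm_mul_le k (hcC N) φ.contDiff (hA N x)
    -- For large `N` the cutoff equals one on a whole neighbourhood of `x`, so all derivatives of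
    -- the difference vanish there; dominated convergence then applies.
    have hzero : ∀ x, ∀ᶠ N in atTop, V.w m x * jetNorm k (⇑(u N) - (φ : Rd d → ℂ)) x = 0 := by
      intro x
      obtain ⟨N₀, hN₀⟩ := exists_nat_gt ‖x‖
      filter_upwards [eventually_ge_atTop N₀] with N hN
      have hN' : (N₀ : ℝ) ≤ N := by exact_mod_cast hN
      rw [jetNorm_eq_zero_of_notMem_tsupport, mul_zero]
      rw [notMem_tsupport_iff_eventuallyEq]
      have hU : Metric.ball (0 : Rd d) (N + 1) ∈ 𝓝 x :=
        Metric.isOpen_ball.mem_nhds (by simp; linarith)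
      filter_upwards [hU] with y hy
      have : c N y = 1 := hc1 N y (by simpa using (mem_ball_zero_iff.1 hy).le)
      change (c N y : ℂ) * φ y - φ y = 0
      rw [this]
      simp
    have h0 : ∫ x : Rd d, (0 : ℝ) = 0 := integral_zero _ _
    rw [← h0]
    refine tendsto_integral_of_dominated_convergence
      (fun x => V.w m x * (((k + 1) * 2 ^ k * A + 1) * jetNorm k φ x)) (fun N => ?_) ?_
      (fun N => Eventually.of_forall fun x => ?_) (Eventually.of_forall fun x => ?_)
    · exact (V.measurable m).aestronglyMeasurable.mul
        (continuous_jetNorm k ((u N).smooth.sub φ.contDiff)).aestronglyMeasurable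
    · refine ((φ.integrable_mul_jetNorm m k).const_mul ((k + 1) * 2 ^ k * A + 1)).congr
        (Eventually.of_forall fun x => ?_)
      simp only
      ring
    · rw [Real.norm_of_nonneg (mul_nonneg (V.pos m x).le (jetNorm_nonneg _ _ _))]
      exact mul_le_mul_of_nonneg_left (hle N x) (V.pos m x).le
    · exact (tendsto_congr' (hzero x)).2 tendsto_const_nhds
  -- The cutoffs are kept in the conclusion because the positivity argument of `le_norm_convK1`
  -- needs their sign and their plateaus.
  refine ⟨c, u, hc0, hc1, fun N x => rfl, hint, tendsto_of_seminorm ?_⟩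
  rintro ⟨m, k, s⟩
  exact squeeze_zero (fun _ => apply_nonneg _ _)
    (fun N => seminormFamily_le (TestFn.toK1 V (u N) - φ) m k s) (hint m k)

end K1

/-! ### Density of `𝒟` and the restriction map. -/

section Restriction

open Filter Topology

variable {d : ℕ} {V : WeightSystem d}

/-- A continuous functional is determined on the dense subspace of test functions. -/
theorem restrictToTestFn_injective : Function.Injective (restrictToTestFn V) := by
  intro F G h
  ext φ
  obtain ⟨-, u, -, -, -, -, hu⟩ := φ.exists_tendsto_toK1
  have h1 := (F.continuous.tendsto φ).comp hu
  have h2 := (G.continuous.tendsto φ).comp hu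
  refine tendsto_nhds_unique h1 (h2.congr fun N => ?_)
  exact (DFunLike.congr_fun h (u N)).symm

theorem convK1_toK1 (hV : V.WeaklyModerate) (F : K1Dual V.check) (ψ : TestFn d) :
    convK1 hV F (TestFn.toK1 V ψ) = convTestFn (restrictToTestFn V.check F) ψ := rfl

theorem tendsto_convTestFn_convK1 (hV : V.WeaklyModerate) (F : K1Dual V.check) {φ : K1 V}
    {u : ℕ → TestFn d} (hu : Tendsto (fun N => TestFn.toK1 V (u N)) atTop (𝓝 φ)) (x : Rd d) :
    Tendsto (fun N => convTestFn (restrictToTestFn V.check F) (u N) x) atTop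
      (𝓝 (convK1 hV F φ x)) :=
  (F.continuous.tendsto _).comp (K1.tendsto_transReflect hV x hu)

end Restriction

/-! ### Localization along the lattice -/

/-- A smooth function supported in a ball whose lattice translates sum up to one. -/
structure IsLatticePartition {d : ℕ} (χ : Rd d → ℂ) (R : ℝ) : Prop where
  contDiff : ContDiff ℝ ∞ χ
  eq_zero : ∀ x, R < ‖x‖ → χ x = 0
  sum_eq_one : ∀ (J : Finset (Fin d → ℤ)) (x : Rd d),
    (∀ j, ‖x - latticePoint j‖ ≤ R → j ∈ J) → ∑ j ∈ J, χ (x - latticePoint j) = 1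

namespace IsLatticePartition

open Filter Topology

variable {d : ℕ} {χ : Rd d → ℂ} {R : ℝ}

theorem hasCompactSupport (h : IsLatticePartition χ R) : HasCompactSupport χ :=
  hasCompactSupport_of_radius h.eq_zero

theorem contDiff_translate (h : IsLatticePartition χ R) (a : Rd d) :
    ContDiff ℝ ∞ (fun x => χ (x - a)) :=
  h.contDiff.comp (contDiff_id.sub contDiff_const)

theorem piece_eq_zero (h : IsLatticePartition χ R) (j : Fin d → ℤ) (θ : Rd d → ℂ) (x : Rd d)
    (hx : x ∉ Metric.closedBall (latticePoint j) R) : χ (x - latticePoint j) * θ x = 0 := by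
  rw [h.eq_zero _ (by simpa [dist_eq_norm] using hx), zero_mul]

theorem tsupport_piece_subset (h : IsLatticePartition χ R) (j : Fin d → ℤ) (θ : Rd d → ℂ) :
    tsupport (fun x => χ (x - latticePoint j) * θ x) ⊆ Metric.closedBall (latticePoint j) R := by
  refine closure_minimal (fun x hx => ?_) Metric.isClosed_closedBall
  by_contra hx'
  exact hx (h.piece_eq_zero j θ x hx')

/-- The localization of a smooth function near a lattice point. -/
def piece (h : IsLatticePartition χ R) (j : Fin d → ℤ) (θ : Rd d → ℂ) (hθ : ContDiff ℝ ∞ θ) :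
    TestFn d :=
  TestFn.ofContDiff (fun x => χ (x - latticePoint j) * θ x)
    ((h.contDiff_translate _).mul hθ)
    ((isCompact_closedBall _ _).of_isClosed_subset (isClosed_tsupport _)
      (h.tsupport_piece_subset j θ))

theorem piece_apply (h : IsLatticePartition χ R) (j : Fin d → ℤ) (θ : Rd d → ℂ)
    (hθ : ContDiff ℝ ∞ θ) (x : Rd d) : h.piece j θ hθ x = χ (x - latticePoint j) * θ x := rfl

/-- Here the sup norms of the closed graph estimate become the `L¹` norms of `𝒦¹`, at the price of
`d + 1` derivatives. The constant is uniform in `j` because all pieces use translates of the same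
`χ`. -/
theorem exists_jetNorm_piece_le (h : IsLatticePartition χ R) (k : ℕ) : ∃ C : ℝ, 0 ≤ C ∧
    ∀ (j : Fin d → ℤ) (θ : Rd d → ℂ) (hθ : ContDiff ℝ ∞ θ) (x : Rd d),
      jetNorm k (h.piece j θ hθ) x ≤
        C * ∫ y in Metric.closedBall (latticePoint j) R, jetNorm (d + 1 + k) θ y := by
  obtain ⟨C, hC, hS⟩ := exists_sobolev_jetNorm d k
  obtain ⟨A, hA0, hA⟩ := exists_jetNorm_le (d + 1 + k) h.contDiff h.hasCompactSupport
  set c : ℝ := (((d + 1 + k : ℕ) : ℝ) + 1) * 2 ^ (d + 1 + k) * A with hc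
  refine ⟨C * c, by positivity, fun j θ hθ x => ?_⟩
  refine (hS _ (h.piece j θ hθ).smooth (h.piece j θ hθ).hasCompactSupport x).trans ?_
  rw [mul_assoc]
  refine mul_le_mul_of_nonneg_left ?_ hC
  rw [← integral_const_mul, ← integral_indicator measurableSet_closedBall]
  refine integral_mono (integrable_jetNorm _ (h.piece j θ hθ).smooth
    (h.piece j θ hθ).hasCompactSupport) ?_ fun y => ?_
  · exact (integrable_indicator_iff measurableSet_closedBall).2
      ((continuous_const.mul (continuous_jetNorm _ hθ)).continuousOn.integrableOn_compact
        (isCompact_closedBall _ _))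
  · by_cases hy : y ∈ Metric.closedBall (latticePoint j) R
    · rw [Set.indicator_of_mem hy]
      refine jetNorm_mul_le (d + 1 + k) (h.contDiff_translate _) hθ ?_
      rw [jetNorm_comp_sub]
      exact hA _
    · rw [Set.indicator_of_notMem hy]
      exact (jetNorm_eq_zero_of_notMem_tsupport _
        (fun h' => hy (h.tsupport_piece_subset j θ h'))).le

theorem piece_eq_zero_of_notMem_latticeBox (h : IsLatticePartition χ R) {ψ : TestFn d} {R' : ℝ}
    (hψ : ∀ x, R' < ‖x‖ → ψ x = 0) {j : Fin d → ℤ} (hj : j ∉ latticeBox 0 (R' + R)) :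
    h.piece j ψ ψ.smooth = 0 := by
  ext x
  rw [piece_apply]
  change _ = (0 : ℂ)
  by_cases hx : R' < ‖x‖
  · rw [hψ x hx, mul_zero]
  · refine h.piece_eq_zero j ψ x fun hx' => hj (mem_latticeBox ?_)
    rw [zero_sub, norm_neg]
    have h1 : ‖x - latticePoint j‖ ≤ R := by simpa [dist_eq_norm] using hx'
    have h2 : ‖latticePoint j‖ ≤ ‖x‖ + ‖x - latticePoint j‖ := by
      simpa using norm_sub_le x (x - latticePoint j)
    linarith

theorem sum_piece (h : IsLatticePartition χ R) {ψ : TestFn d} {R' : ℝ}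
    (hψ : ∀ x, R' < ‖x‖ → ψ x = 0) :
    ∑ j ∈ latticeBox 0 (R' + R), h.piece j ψ ψ.smooth = ψ := by
  ext x
  rw [TestFn.coe_sum]
  simp only [piece_apply]
  by_cases hx : R' < ‖x‖
  · simp [hψ x hx]
  · rw [← Finset.sum_mul, h.sum_eq_one, one_mul]
    intro j hj
    refine mem_latticeBox ?_
    rw [zero_sub, norm_neg]
    have h2 : ‖latticePoint j‖ ≤ ‖x‖ + ‖x - latticePoint j‖ := by
      simpa using norm_sub_le x (x - latticePoint j)
    linarith

end IsLatticePartition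

/-! ### Moderate weights: extension of convolutors from `𝒟` to `𝒦¹`. -/

section Extension

open Filter Topology

variable {d : ℕ} {E : Type*} [NormedAddCommGroup E] [NormedSpace ℂ E]
  {ι : E →ₗ[ℂ] (Rd d →ₘ[(volume : Measure (Rd d))] ℂ)}

theorem convTestFn_sum (f : CDistribution d) {α : Type*} (s : Finset α) (φ : α → TestFn d)
    (x : Rd d) : convTestFn f (∑ a ∈ s, φ a) x = ∑ a ∈ s, convTestFn f (φ a) x := by
  classical
  induction s using Finset.induction_on with
  | empty => exact map_zero f
  | insert a s ha ih => rw [Finset.sum_insert ha, Finset.sum_insert ha, convTestFn_add, ih]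

theorem WeightSystem.integrableOn_mul_jetNorm (V : WeightSystem d) (m k : ℕ) {θ : Rd d → ℂ}
    (hθ : ContDiff ℝ ∞ θ) {K : Set (Rd d)} (hK : IsCompact K) :
    IntegrableOn (fun y => V.w m y * jetNorm k θ y) K volume := by
  have h1 : LocallyIntegrable (fun y => (jetNorm k θ y : ℂ)) volume :=
    (Complex.continuous_ofReal.comp (continuous_jetNorm k hθ)).locallyIntegrable
  refine (V.integrableOn_mul m h1 hK).norm.congr (Eventually.of_forall fun y => ?_)
  simp only
  rw [norm_mul, V.norm_coe, Complex.norm_real, Real.norm_of_nonneg (jetNorm_nonneg _ _ _)]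

/-- Moving a weight inside a local integral. -/
theorem WeightSystem.WeaklyModerate.exists_mul_setIntegral_le {V : WeightSystem d}
    (hV : V.WeaklyModerate) (R : ℝ) (n : ℕ) : ∃ (m : ℕ) (B : ℝ), 0 < B ∧
      ∀ (k : ℕ) (θ : Rd d → ℂ), ContDiff ℝ ∞ θ → ∀ a : Rd d,
        V.w n a * ∫ y in Metric.closedBall a R, jetNorm k θ y ≤
          B * ∫ y in Metric.closedBall a R, V.w m y * jetNorm k θ y := by
  obtain ⟨m, B, hB, h⟩ := hV.closedBall R n
  refine ⟨m, B, hB, fun k θ hθ a => ?_⟩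
  rw [← integral_const_mul, ← integral_const_mul]
  refine setIntegral_mono_on ((continuous_const.mul
    (continuous_jetNorm k hθ)).continuousOn.integrableOn_compact (isCompact_closedBall a R))
    ((V.integrableOn_mul_jetNorm m k hθ (isCompact_closedBall a R)).const_mul B)
    measurableSet_closedBall fun y hy => ?_
  rw [← mul_assoc]
  refine mul_le_mul_of_nonneg_right ?_ (jetNorm_nonneg _ _ _)
  have := h y (a - y) (by rw [norm_sub_rev]; simpa [dist_eq_norm] using hy)
  rwa [add_sub_cancel] at this

/-- The weighted norm of `f * ψ` is controlled by a seminorm of `𝒦¹_V`. -/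
theorem exists_norm_le_integral_of_isModerate (hE : IsTIBF ι) (hsolid : IsSolid ι)
    {V W : WeightSystem d} (hV : V.WeaklyModerate) (hmod : W.IsModerate V) {f : CDistribution d}
    (hf : f ∈ OCTestFn ι W) (n : ℕ) : ∃ (m k : ℕ) (C : ℝ), 0 ≤ C ∧ ∀ (ψ : TestFn d) (e : E),
      Represents ι e (fun x => (W.w n x : ℂ) * convTestFn f ψ x) →
        ‖e‖ ≤ C * ∫ y, V.w m y * jetNorm k ψ y := by
  obtain ⟨χ, R, hχ₁, hχ₂, hχ₃⟩ := exists_lattice_partition d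
  have hχ : IsLatticePartition χ R := ⟨hχ₁, hχ₂, hχ₃⟩
  obtain ⟨n', -, D, hD, hDw⟩ := hmod n
  obtain ⟨k₀, C₁, hC₁, hk₀⟩ := exists_norm_le_of_mem_OCTestFn hE hf R n'
  obtain ⟨C₀, hC₀, hT⟩ := hE.exists_translate
  obtain ⟨m, B, hB, hVm⟩ := hV.exists_mul_setIntegral_le R n'
  obtain ⟨C₂, hC₂, hjet⟩ := hχ.exists_jetNorm_piece_le k₀
  set A : ℝ := D * C₀ * C₁ * C₂ with hA
  have hA0 : 0 ≤ A := by positivity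
  refine ⟨m, d + 1 + k₀, A * B * (⌈2 * R + 1⌉₊ ^ d : ℕ), by positivity, fun ψ e he => ?_⟩
  obtain ⟨R', -, hψ⟩ := ψ.exists_radius
  -- With `Q` the piece recentred at the origin, `f * P` is the translate of `f * Q` by the lattice
  -- point. Moderateness bounds `w_n(x)` by `w_{n'}` at the translated point times `v_{n'}` at the
  -- lattice point, and solidity converts this into a bound in `E`.
  have hpiece : ∀ j, ∃ e' : E,
      Represents ι e' (fun x => (W.w n x : ℂ) * convTestFn f (hχ.piece j ψ ψ.smooth) x) ∧
      ‖e'‖ ≤ A * B * ∫ y in Metric.closedBall (latticePoint j) R,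
        V.w m y * jetNorm (d + 1 + k₀) ψ y := by
    intro j
    set P := hχ.piece j ψ ψ.smooth with hP
    have hsupp : ∀ x, R < ‖x‖ → P (x + latticePoint j) = 0 := fun x hx => by
      rw [hP, hχ.piece_apply, add_sub_cancel_right, hχ.eq_zero x hx, zero_mul]
    let Q : TestFn d := TestFn.ofContDiff (fun x => P (x + latticePoint j))
      (P.smooth.comp (contDiff_id.add contDiff_const)) (hasCompactSupport_of_radius hsupp)
    obtain ⟨e₁, he₁⟩ := (hf Q).2 n'
    set I : ℝ := ∫ y in Metric.closedBall (latticePoint j) R, jetNorm (d + 1 + k₀) ψ y with hI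
    have h1 : ‖e₁‖ ≤ C₁ * (C₂ * I) := by
      refine hk₀ Q hsupp _ (fun x => ?_) e₁ he₁
      change jetNorm k₀ (fun x => P (x + latticePoint j)) x ≤ _
      rw [jetNorm_comp_add_right]
      exact hjet j ψ ψ.smooth _
    obtain ⟨e₂, he₂, h2⟩ := hT (latticePoint j) e₁ _ he₁
    have hconv : ∀ x, convTestFn f Q (x - latticePoint j) = convTestFn f P x := by
      intro x
      have : Q.transReflect (x - latticePoint j) = P.transReflect x := by
        ext t
        change P (x - latticePoint j - t + latticePoint j) = P (x - t)
        congr 1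
        abel
      rw [convTestFn, this, convTestFn]
    have he₃ := he₂.smul (((D * V.w n' (latticePoint j) : ℝ)) : ℂ)
    obtain ⟨e₄, he₄, h4⟩ := he₃.dominated hsolid
      (h := fun x => (W.w n x : ℂ) * convTestFn f P x)
      (W.locallyIntegrable_mul n (contDiff_convTestFn f P).continuous.locallyIntegrable)
      (fun x => by
        simp only [hconv, norm_mul, W.norm_coe]
        rw [← mul_assoc]
        refine mul_le_mul_of_nonneg_right ?_ (norm_nonneg _)
        rw [Complex.norm_real, Real.norm_of_nonneg (mul_nonneg hD.le (V.pos _ _).le)]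
        have := hDw (x - latticePoint j) (latticePoint j)
        rw [sub_add_cancel] at this
        linarith)
    refine ⟨e₄, he₄, h4.trans ?_⟩
    rw [norm_smul, Complex.norm_real, Real.norm_of_nonneg (mul_nonneg hD.le (V.pos _ _).le)]
    have hv := (V.pos n' (latticePoint j)).le
    calc D * V.w n' (latticePoint j) * ‖e₂‖
        ≤ D * V.w n' (latticePoint j) * (C₀ * (C₁ * (C₂ * I))) := by
          gcongr
          exact h2.trans (by gcongr)
      _ = A * (V.w n' (latticePoint j) * I) := by rw [hA]; ring
      _ ≤ A * (B * _) :=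
          mul_le_mul_of_nonneg_left (hVm (d + 1 + k₀) ψ ψ.smooth (latticePoint j)) hA0
      _ = _ := by ring
  choose e' he' hle using hpiece
  set J := latticeBox (0 : Rd d) (R' + R)
  have hsum : e = ∑ j ∈ J, e' j := by
    refine Represents.unique hE he ((represents_sum J fun j _ => he' j).congr fun x => ?_)
    rw [← Finset.mul_sum, ← convTestFn_sum, hχ.sum_piece hψ]
  have hint : Integrable (fun y => V.w m y * jetNorm (d + 1 + k₀) ψ y) volume :=
    (TestFn.toK1 V ψ).integrable_mul_jetNorm m _
  rw [hsum]
  calc ‖∑ j ∈ J, e' j‖ ≤ ∑ j ∈ J, A * B * ∫ y in Metric.closedBall (latticePoint j) R,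
        V.w m y * jetNorm (d + 1 + k₀) ψ y := norm_sum_le_of_le _ fun j _ => hle j
    _ ≤ A * B * ((⌈2 * R + 1⌉₊ ^ d : ℕ) * ∫ y, V.w m y * jetNorm (d + 1 + k₀) ψ y) := by
        rw [← Finset.mul_sum]
        refine mul_le_mul_of_nonneg_left ?_ (by positivity)
        exact sum_setIntegral_closedBall_le R J
          (fun y => mul_nonneg (V.pos m y).le (jetNorm_nonneg _ _ _)) hint
    _ = _ := by ring

/-- A local estimate for the distribution itself. -/
theorem exists_norm_piece_le (hE : IsTIBF ι) {V W : WeightSystem d} (hV : V.WeaklyModerate)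
    (hW : W.WeaklyModerate) (hmod : W.IsModerate V) {f : CDistribution d}
    (hf : f ∈ OCTestFn ι W) {χ : Rd d → ℂ} {R : ℝ} (hχ : IsLatticePartition χ R) :
    ∃ (m k : ℕ) (C : ℝ), 0 ≤ C ∧ ∀ (j : Fin d → ℤ) (θ : Rd d → ℂ) (hθ : ContDiff ℝ ∞ θ),
      ‖f (hχ.piece j θ hθ)‖ ≤ C * ∫ y in Metric.closedBall (latticePoint j) R,
        V.check.w m y * jetNorm k θ y := by
  obtain ⟨n', -, D, hD, hDw⟩ := hmod 0
  obtain ⟨k₀, C₁, hC₁, hk₀⟩ := exists_pointwise_le_of_mem_OCTestFn hE hW hf R n'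
  obtain ⟨m, B, hB, hVm⟩ := hV.check.exists_mul_setIntegral_le R n'
  obtain ⟨C₂, hC₂, hjet⟩ := hχ.exists_jetNorm_piece_le k₀
  refine ⟨m, d + 1 + k₀, D * C₁ * C₂ * B, by positivity, fun j θ hθ => ?_⟩
  set P := hχ.piece j θ hθ with hP
  set a := latticePoint j
  set I : ℝ := ∫ y in Metric.closedBall a R, jetNorm (d + 1 + k₀) θ y with hI
  have h1 : W.w n' a * ‖f P‖ ≤ C₁ * (C₂ * I) := by
    -- The pairing with `P` is the value at `a` of the convolution with its reflection about `a`;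
    -- that reflection is supported in the fixed ball of radius `R`.
    have hconv : convTestFn f (P.transReflect a) a = f P := by
      have : (P.transReflect a).transReflect a = P := by
        ext t
        change P (a - (a - t)) = P t
        rw [sub_sub_cancel]
      rw [convTestFn, this]
    have h2 := hk₀ (P.transReflect a) (fun s hs => by
      rw [TestFn.transReflect_apply, hP, hχ.piece_apply, hχ.eq_zero, zero_mul]
      rwa [sub_sub_cancel_left, norm_neg]) (C₂ * I) (fun s => by
      change jetNorm k₀ (fun t => P (a - t)) s ≤ _
      rw [jetNorm_const_sub]
      exact hjet j θ hθ _) a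
    rwa [hconv] at h2
  -- Moderateness of `w_0` at the pair `a`, `-a`. The reflected weight absorbs the factor
  -- `w_{n'}(a)` of the pointwise estimate.
  have h3 : 1 ≤ D * W.w n' a * V.check.w n' a := by
    have := hDw a (-a)
    rw [add_neg_cancel] at this
    exact (W.one_le 0 0).trans this
  have hv := (V.check.pos n' a).le
  calc ‖f P‖ ≤ D * W.w n' a * V.check.w n' a * ‖f P‖ :=
        le_mul_of_one_le_left (norm_nonneg _) h3
    _ = D * V.check.w n' a * (W.w n' a * ‖f P‖) := by ring
    _ ≤ D * V.check.w n' a * (C₁ * (C₂ * I)) := by gcongr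
    _ = D * C₁ * C₂ * (V.check.w n' a * I) := by ring
    _ ≤ D * C₁ * C₂ * (B * _) :=
        mul_le_mul_of_nonneg_left (hVm (d + 1 + k₀) θ hθ a) (by positivity)
    _ = _ := by ring

/-- For moderate weights, convolutors extend to continuous functionals on `𝒦¹`. -/
theorem exists_restrictToTestFn_eq (hE : IsTIBF ι) {V W : WeightSystem d}
    (hV : V.WeaklyModerate) (hW : W.WeaklyModerate) (hmod : W.IsModerate V) {f : CDistribution d}
    (hf : f ∈ OCTestFn ι W) : ∃ F : K1Dual V.check, restrictToTestFn V.check F = f := by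
  obtain ⟨χ, R, hχ₁, hχ₂, hχ₃⟩ := exists_lattice_partition d
  have hχ : IsLatticePartition χ R := ⟨hχ₁, hχ₂, hχ₃⟩
  obtain ⟨m, k, C, hC, hle⟩ := exists_norm_piece_le hE hV hW hmod hf hχ
  set N : ℝ := ((⌈2 * R + 1⌉₊ ^ d : ℕ) : ℝ) with hN
  let P : (Fin d → ℤ) → K1 V.check → TestFn d := fun j θ => hχ.piece j θ θ.contDiff
  -- Bounded overlap of the balls turns the local estimates into a seminorm of `θ`. Hence the series
  -- of the values of `f` on the pieces converges absolutely, and its sum serves as the extension.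
  have hfin : ∀ (θ : K1 V.check) (J : Finset (Fin d → ℤ)), ∑ j ∈ J, ‖f (P j θ)‖ ≤
      C * (N * ∫ y, V.check.w m y * jetNorm k θ y) := by
    intro θ J
    refine (Finset.sum_le_sum fun j _ => hle j θ θ.contDiff).trans ?_
    rw [← Finset.mul_sum]
    refine mul_le_mul_of_nonneg_left ?_ hC
    exact sum_setIntegral_closedBall_le R J
      (fun y => mul_nonneg (V.check.pos m y).le (jetNorm_nonneg _ _ _))
      (θ.integrable_mul_jetNorm m k)
  have hsum : ∀ θ, Summable fun j => ‖f (P j θ)‖ := fun θ =>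
    summable_of_sum_le (fun _ => norm_nonneg _) (hfin θ)
  let L : K1 V.check →ₗ[ℂ] ℂ :=
    { toFun := fun θ => ∑' j, f (P j θ)
      map_add' := fun θ η => by
        rw [← (hsum θ).of_norm.tsum_add (hsum η).of_norm]
        refine tsum_congr fun j => ?_
        rw [← map_add]
        congr 1
        ext x
        exact mul_add _ _ _
      map_smul' := fun c θ => by
        rw [RingHom.id_apply, smul_eq_mul, ← tsum_mul_left]
        refine tsum_congr fun j => ?_
        rw [← smul_eq_mul, ← map_smul]
        congr 1
        ext x
        exact mul_left_comm _ _ _ }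
  have hL : ∀ θ, ‖L θ‖ ≤ C * (N * ∑ i ∈ Finset.range (k + 1), ∑ s : Fin i → Fin d,
      K1.seminormFamily V.check (m, ⟨i, s⟩) θ) := by
    intro θ
    refine (norm_tsum_le_tsum_norm (hsum θ)).trans ?_
    refine ((hsum θ).tsum_le_of_sum_le (hfin θ)).trans ?_
    have := θ.integral_mul_jetNorm_le m k
    gcongr
  have hcont : Continuous L := by
    refine continuous_of_continuousAt_zero L ?_
    rw [ContinuousAt, map_zero]
    refine squeeze_zero_norm hL ?_
    have h1 : Continuous fun θ : K1 V.check => C * (N * ∑ i ∈ Finset.range (k + 1),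
        ∑ s : Fin i → Fin d, K1.seminormFamily V.check (m, ⟨i, s⟩) θ) :=
      continuous_const.mul (continuous_const.mul (continuous_finsetSum _ fun i _ =>
        continuous_finsetSum _ fun s _ => K1.withSeminorms.continuous_seminorm (m, ⟨i, s⟩)))
    have h2 := h1.tendsto 0
    simpa using h2
  refine ⟨⟨L, hcont⟩, ?_⟩
  ext ψ
  change ∑' j, f (hχ.piece j ψ ψ.smooth) = f ψ
  obtain ⟨R', -, hψ⟩ := ψ.exists_radius
  -- On a test function only finitely many pieces are nonzero and they add up to it, so the series
  -- returns `f ψ`.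
  rw [tsum_eq_sum (s := latticeBox 0 (R' + R)) fun j hj => by
    rw [hχ.piece_eq_zero_of_notMem_latticeBox hψ hj, map_zero], ← map_sum, hχ.sum_piece hψ]

/-- For moderate weights, the extended functional is again a convolutor. -/
theorem mem_OCK1_of_isModerate (hE : IsTIBF ι) (hsolid : IsSolid ι) {V W : WeightSystem d}
    (hV : V.WeaklyModerate) (hmod : W.IsModerate V) {F : K1Dual V.check}
    (hF : restrictToTestFn V.check F ∈ OCTestFn ι W) : F ∈ OCK1 ι hV W := by
  have := hE.complete
  intro φ
  obtain ⟨-, u, -, -, -, hu, huφ⟩ := φ.exists_tendsto_toK1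
  have hlim := fun x => tendsto_convTestFn_convK1 hV F huφ x
  have key : ∀ n, ∃ e : E, Represents ι e (fun x => (W.w n x : ℂ) * convK1 hV F φ x) := by
    intro n
    obtain ⟨m, k, C, hC, hle⟩ :=
      exists_norm_le_integral_of_isModerate hE hsolid hV hmod hF n
    choose e he using fun N => (hF (u N)).2 n
    set r : ℕ → ℝ := fun N =>
      ∫ x, V.w m x * jetNorm k (⇑(u N) - (φ : Rd d → ℂ)) x with hr
    have hint : ∀ N, Integrable (fun x => V.w m x * jetNorm k (⇑(u N) - (φ : Rd d → ℂ)) x)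
        volume := fun N => (TestFn.toK1 V (u N) - φ).integrable_mul_jetNorm m k
    -- The estimate on `𝒟` is applied to differences of approximants of `φ`: the sequence is Cauchy
    -- in `E`, and its limit is identified through the pointwise limit.
    have hdist : ∀ N M, ‖e N - e M‖ ≤ C * (r N + r M) := by
      intro N M
      have h1 : Represents ι (e N - e M)
          (fun x => (W.w n x : ℂ) * convTestFn (restrictToTestFn V.check F) (u N - u M) x) := by
        refine ((he N).sub (he M)).congr fun x => ?_
        have : convTestFn (restrictToTestFn V.check F) (u N - u M) x =
            convTestFn (restrictToTestFn V.check F) (u N) x -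
              convTestFn (restrictToTestFn V.check F) (u M) x :=
          map_sub (restrictToTestFn V.check F) ((u N).transReflect x) ((u M).transReflect x)
        rw [this]
        ring
      refine (hle _ _ h1).trans (mul_le_mul_of_nonneg_left ?_ hC)
      rw [hr, ← integral_add (hint N) (hint M)]
      refine integral_mono ((TestFn.toK1 V (u N - u M)).integrable_mul_jetNorm m k)
        ((hint N).add (hint M)) fun x => ?_
      simp only
      rw [← mul_add]
      refine mul_le_mul_of_nonneg_left ?_ (V.pos m x).le
      have e1 : ⇑(u N - u M) = (⇑(u N) - (φ : Rd d → ℂ)) - (⇑(u M) - (φ : Rd d → ℂ)) := by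
        rw [sub_sub_sub_cancel_right]
        rfl
      rw [e1]
      exact jetNorm_sub_le k ((u N).smooth.sub φ.contDiff) ((u M).smooth.sub φ.contDiff) x
    have hcauchy : CauchySeq e := by
      rw [Metric.cauchySeq_iff]
      intro ε hε
      have h1 : Tendsto (fun N => C * r N) atTop (𝓝 0) := by
        simpa using (hu m k).const_mul C
      obtain ⟨N₀, hN₀⟩ := eventually_atTop.1 (h1.eventually (gt_mem_nhds (half_pos hε)))
      refine ⟨N₀, fun N hN M hM => ?_⟩
      rw [dist_eq_norm]
      refine (hdist N M).trans_lt ?_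
      rw [mul_add]
      linarith [hN₀ N hN, hN₀ M hM]
    obtain ⟨e', he'⟩ := cauchySeq_tendsto_of_complete hcauchy
    exact ⟨e', hE.represents_of_tendsto he he' fun x => (hlim x).const_mul _⟩
  refine ⟨?_, key⟩
  -- Local integrability of `F * φ` follows from that of its product with `w_0`, since `w_0 ≥ 1`.
  obtain ⟨e, he⟩ := key 0
  refine (he.locallyIntegrable hE).mono ?_ (Eventually.of_forall fun x => ?_)
  · exact aestronglyMeasurable_of_tendsto_ae atTop
      (fun N => (contDiff_convTestFn _ (u N)).continuous.aestronglyMeasurable)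
      (Eventually.of_forall hlim)
  · rw [norm_mul, W.norm_coe]
    exact le_mul_of_one_le_left (norm_nonneg _) (W.one_le 0 x)

end Extension

/-! ### Series of point masses and of translated bumps -/

section Series

open Filter Topology

variable {d : ℕ}

/-- The distribution `∑ c_j δ_{x_j}`. -/
noncomputable def diracSeries (c : ℕ → ℝ) (hc : Summable c) (hc0 : ∀ j, 0 ≤ c j) (x : ℕ → Rd d) :
    CDistribution d :=
  have hs : ∀ g : BoundedContinuousFunction (Rd d) ℂ, Summable fun j => (c j : ℂ) * g (x j) :=
    fun g => Summable.of_norm_bounded (hc.mul_right ‖g‖) fun j => by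
      rw [norm_mul, Complex.norm_real, Real.norm_of_nonneg (hc0 j)]
      exact mul_le_mul_of_nonneg_left (g.norm_coe_le_norm _) (hc0 j)
  let L : BoundedContinuousFunction (Rd d) ℂ →ₗ[ℂ] ℂ :=
    { toFun := fun g => ∑' j, (c j : ℂ) * g (x j)
      map_add' := fun g h => by
        rw [← (hs g).tsum_add (hs h)]
        exact tsum_congr fun j => mul_add _ _ _
      map_smul' := fun a g => by
        rw [RingHom.id_apply, smul_eq_mul, ← tsum_mul_left]
        exact tsum_congr fun j => mul_left_comm _ _ _ }
  (L.mkContinuous (∑' j, c j) fun g => by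
    rw [← tsum_mul_right]
    refine tsum_of_norm_bounded (hc.mul_right ‖g‖).hasSum fun j => ?_
    rw [norm_mul, Complex.norm_real, Real.norm_of_nonneg (hc0 j)]
    exact mul_le_mul_of_nonneg_left (g.norm_coe_le_norm _) (hc0 j)).comp
  (TestFunction.toBoundedContinuousFunctionCLM ℂ)

theorem TestFn.exists_norm_le (φ : TestFn d) : ∃ M : ℝ, 0 ≤ M ∧ ∀ x, ‖φ x‖ ≤ M := by
  obtain ⟨M, hM0, hM⟩ := exists_jetNorm_le 0 φ.smooth φ.hasCompactSupport
  exact ⟨M, hM0, fun x => (norm_le_jetNorm 0 φ x).trans (hM x)⟩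

variable {E : Type*} [NormedAddCommGroup E] [NormedSpace ℂ E]
  {ι : E →ₗ[ℂ] (Rd d →ₘ[(volume : Measure (Rd d))] ℂ)}

/-- Each term of `f * φ` is a translate of `φ`, dominated by a translated indicator of a ball on
which (wM) gives `w_n ≤ C w_m(x_j)`. The norms of the terms are thus at most a constant times `c_j
w_m(x_j)`, and the series converges absolutely in `E`. -/
theorem diracSeries_mem_OCTestFn (hE : IsTIBF ι) (hsolid : IsSolid ι) {W : WeightSystem d}
    (hW : W.WeaklyModerate) {c : ℕ → ℝ} (hc : Summable c) (hc0 : ∀ j, 0 ≤ c j) {x : ℕ → Rd d}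
    (hcw : ∀ k, Summable fun j => c j * W.w k (x j)) :
    diracSeries c hc hc0 x ∈ OCTestFn ι W := by
  intro φ
  refine ⟨(contDiff_convTestFn _ φ).continuous.locallyIntegrable, fun n => ?_⟩
  obtain ⟨M, hM0, hM⟩ := φ.exists_norm_le
  obtain ⟨R, -, hR⟩ := φ.exists_radius
  obtain ⟨m, C, hC, hCw⟩ := hW.closedBall R n
  obtain ⟨C₀, hC₀, hT⟩ := hE.exists_translate
  obtain ⟨e₁, he₁⟩ := hE.exists_represents_indicator hsolid R
  have hterm : ∀ j, ∃ e : E, Represents ι e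
      (fun y => (W.w n y : ℂ) * ((c j : ℂ) * φ (y - x j))) ∧
      ‖e‖ ≤ c j * W.w m (x j) * (C * M * (C₀ * ‖e₁‖)) := by
    intro j
    obtain ⟨e₂, he₂, h2⟩ := hT (x j) e₁ _ he₁
    have hpos : 0 ≤ c j * (C * W.w m (x j)) * M :=
      mul_nonneg (mul_nonneg (hc0 j) (mul_nonneg hC.le (W.pos _ _).le)) hM0
    have he₃ := he₂.smul ((c j * (C * W.w m (x j)) * M : ℝ) : ℂ)
    obtain ⟨e₄, he₄, h4⟩ := he₃.dominated hsolid
      (h := fun y => (W.w n y : ℂ) * ((c j : ℂ) * φ (y - x j)))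
      (W.locallyIntegrable_mul n (continuous_const.mul (φ.continuous.comp
        (continuous_id.sub continuous_const))).locallyIntegrable)
      (fun y => by
        rw [norm_mul _ (Set.indicator _ _ _), Complex.norm_real, Real.norm_of_nonneg hpos,
          norm_mul, norm_mul, W.norm_coe, Complex.norm_real, Real.norm_of_nonneg (hc0 j)]
        by_cases hy : y - x j ∈ Metric.closedBall (0 : Rd d) R
        · rw [Set.indicator_of_mem hy, norm_one, mul_one, mul_left_comm, ← mul_assoc]
          have h5 := hCw (x j) (y - x j) (by simpa using hy)
          rw [add_sub_cancel] at h5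
          exact mul_le_mul (mul_le_mul_of_nonneg_left h5 (hc0 j)) (hM _) (norm_nonneg _)
            (mul_nonneg (hc0 j) (mul_nonneg hC.le (W.pos _ _).le))
        · rw [hR (y - x j) (by simpa using hy), norm_zero, mul_zero, mul_zero]
          positivity)
    refine ⟨e₄, he₄, h4.trans ?_⟩
    rw [norm_smul, Complex.norm_real, Real.norm_of_nonneg hpos]
    calc _ ≤ c j * (C * W.w m (x j)) * M * (C₀ * ‖e₁‖) := mul_le_mul_of_nonneg_left h2 hpos
      _ = _ := by ring
  choose e he hle using hterm
  refine hE.represents_tsum he (Summable.of_nonneg_of_le (fun _ => norm_nonneg _) hle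
    ((hcw m).mul_right _)) fun y => ?_
  refine HasSum.mul_left _ ?_
  have hs : Summable fun j => (c j : ℂ) * φ (y - x j) :=
    Summable.of_norm_bounded (hc.mul_right M) fun j => by
      rw [norm_mul, Complex.norm_real, Real.norm_of_nonneg (hc0 j)]
      exact mul_le_mul_of_nonneg_left (hM _) (hc0 j)
  exact hs.hasSum

/-- Tonelli: the unit balls all have the same finite volume, so the integral is at most that volume
times `∑ t_j`. -/
theorem integrable_of_le_tsum_indicator {g : Rd d → ℂ}
    (hg : AEStronglyMeasurable g (volume : Measure (Rd d))) {t : ℕ → ℝ} (ht : Summable t)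
    (ht0 : ∀ j, 0 ≤ t j) {y : ℕ → Rd d}
    (h : ∀ x, ‖g x‖ ≤ ∑' j, (Metric.closedBall (y j) 1).indicator (fun _ => t j) x) :
    Integrable g volume := by
  refine ⟨hg, ?_⟩
  have h1 : ∀ x, ‖g x‖ₑ ≤
      ∑' j, (Metric.closedBall (y j) 1).indicator (fun _ => ENNReal.ofReal (t j)) x := by
    intro x
    have h0 : ∀ j, 0 ≤ (Metric.closedBall (y j) 1).indicator (fun _ => t j) x := fun j =>
      Set.indicator_nonneg (fun _ _ => ht0 j) x
    have hs : Summable fun j => (Metric.closedBall (y j) 1).indicator (fun _ => t j) x :=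
      Summable.of_nonneg_of_le h0 (fun j => Set.indicator_le_self' (fun _ _ => ht0 j) x) ht
    rw [← ofReal_norm]
    refine (ENNReal.ofReal_le_ofReal (h x)).trans (le_of_eq ?_)
    rw [ENNReal.ofReal_tsum_of_nonneg h0 hs]
    refine tsum_congr fun j => ?_
    by_cases hx : x ∈ Metric.closedBall (y j) 1
    · simp only [Set.indicator_of_mem hx]
    · simp only [Set.indicator_of_notMem hx, ENNReal.ofReal_zero]
  refine (lintegral_mono h1).trans_lt ?_
  rw [lintegral_tsum fun j => (measurable_const.indicator
    Metric.isClosed_closedBall.measurableSet).aemeasurable]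
  have h2 : ∀ j, ∫⁻ x, (Metric.closedBall (y j) 1).indicator (fun _ => ENNReal.ofReal (t j)) x =
      ENNReal.ofReal (t j) * (volume : Measure (Rd d)) (Metric.closedBall 0 1) := by
    intro j
    rw [lintegral_indicator_const Metric.isClosed_closedBall.measurableSet,
      Measure.addHaar_closedBall_center]
  simp only [h2]
  rw [ENNReal.tsum_mul_right, ← ENNReal.ofReal_tsum_of_nonneg ht0 ht]
  exact ENNReal.mul_lt_top ENNReal.ofReal_lt_top (isCompact_closedBall _ _).measure_lt_top

/-- A series of translates of a test function with rapidly decreasing coefficients. -/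
theorem tsum_translate_mem_K1Submodule {V : WeightSystem d} (hV : V.WeaklyModerate)
    {ψ : TestFn d} (hψ : ∀ x, 1 < ‖x‖ → ψ x = 0) {b : ℕ → ℝ} (hb : Summable b)
    (hb0 : ∀ j, 0 ≤ b j) {y : ℕ → Rd d} (hbv : ∀ k, Summable fun j => b j * V.w k (y j)) :
    (fun x => ∑' j, (b j : ℂ) * ψ (x - y j)) ∈ K1Submodule V := by
  choose A hA0 hA using fun k => exists_jetNorm_le k ψ.smooth ψ.hasCompactSupport
  have hterm : ∀ j, ContDiff ℝ ∞ (fun x => (b j : ℂ) * ψ (x - y j)) := fun j =>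
    contDiff_const.mul (ψ.smooth.comp (contDiff_id.sub contDiff_const))
  have hder : ∀ (k j : ℕ) (x : Rd d), ‖iteratedFDeriv ℝ k (fun x => (b j : ℂ) * ψ (x - y j)) x‖ ≤
      (Metric.closedBall (y j) 1).indicator (fun _ => b j * A k) x := by
    intro k j x
    have e : (fun x => (b j : ℂ) * ψ (x - y j)) = (b j : ℂ) • fun x => ψ (x - y j) := rfl
    have hs : ContDiff ℝ ∞ (fun x => ψ (x - y j)) :=
      ψ.smooth.comp (contDiff_id.sub contDiff_const)
    rw [e, iteratedFDeriv_const_smul_apply (hs.contDiffAt.of_le (by exact_mod_cast le_top)),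
      norm_smul, Complex.norm_real, Real.norm_of_nonneg (hb0 j), iteratedFDeriv_comp_sub]
    by_cases hx : x ∈ Metric.closedBall (y j) 1
    · rw [Set.indicator_of_mem hx]
      exact mul_le_mul_of_nonneg_left
        ((norm_iteratedFDeriv_le_jetNorm le_rfl _ _).trans (hA k _)) (hb0 j)
    · rw [Set.indicator_of_notMem hx]
      have h1 : x - y j ∉ tsupport ψ := fun h =>
        hx (by simpa [dist_eq_norm] using tsupport_subset_closedBall hψ h)
      have h2 : ‖iteratedFDeriv ℝ k ψ (x - y j)‖ ≤ 0 :=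
        (norm_iteratedFDeriv_le_jetNorm le_rfl _ _).trans
          (jetNorm_eq_zero_of_notMem_tsupport k h1).le
      rw [le_antisymm h2 (norm_nonneg _), mul_zero]
  have hind : ∀ (t : ℕ → ℝ), (∀ j, 0 ≤ t j) → ∀ j x,
      (Metric.closedBall (y j) 1).indicator (fun _ => t j) x ≤ t j := fun t ht j x =>
    Set.indicator_le_self' (fun _ _ => ht j) x
  have hbA : ∀ k j, 0 ≤ b j * A k := fun k j => mul_nonneg (hb0 j) (hA0 k)
  have hder' : ∀ (k j : ℕ) (x : Rd d),
      ‖iteratedFDeriv ℝ k (fun x => (b j : ℂ) * ψ (x - y j)) x‖ ≤ b j * A k := fun k j x =>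
    (hder k j x).trans (hind (fun j => b j * A k) (hbA k) j x)
  have hsm : ContDiff ℝ ∞ (fun x => ∑' j, (b j : ℂ) * ψ (x - y j)) :=
    contDiff_tsum (N := ⊤) (v := fun k j => b j * A k) hterm (fun _ _ => hb.mul_right _)
      fun k j x _ => hder' k j x
  refine ⟨hsm, fun n k s => ?_⟩
  -- The `j`-th term lives in the unit ball around `y_j`, where `v_n ≤ C v_m(y_j)`; summability of
  -- `b_j v_m(y_j)` is what remains.
  obtain ⟨m, C, hC, hCv⟩ := hV.closedBall 1 n
  have hvm : ∀ j, 0 ≤ V.w m (y j) := fun j => (V.pos _ _).le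
  refine integrable_of_le_tsum_indicator
    ((V.aestronglyMeasurable_coe n).mul (continuous_partialDeriv s hsm).aestronglyMeasurable)
    (t := fun j => b j * V.w m (y j) * (C * A k)) ((hbv m).mul_right _)
    (fun j => mul_nonneg (mul_nonneg (hb0 j) (hvm j)) (mul_nonneg hC.le (hA0 k))) (y := y)
    fun x => ?_
  rw [norm_mul, V.norm_coe]
  have e : iteratedFDeriv ℝ k (fun x => ∑' j, (b j : ℂ) * ψ (x - y j)) x =
      ∑' j, iteratedFDeriv ℝ k (fun x => (b j : ℂ) * ψ (x - y j)) x :=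
    iteratedFDeriv_tsum_apply (N := ⊤) (v := fun k j => b j * A k) hterm
      (fun _ _ => hb.mul_right _) (fun k j x _ => hder' k j x) le_top x
  have hsi : Summable fun j => (Metric.closedBall (y j) 1).indicator (fun _ => b j * A k) x :=
    Summable.of_nonneg_of_le (fun j => Set.indicator_nonneg (fun _ _ => hbA k j) x)
      (fun j => hind (fun j => b j * A k) (hbA k) j x) (hb.mul_right _)
  have h1 : ‖partialDeriv s (fun x => ∑' j, (b j : ℂ) * ψ (x - y j)) x‖ ≤
      ∑' j, (Metric.closedBall (y j) 1).indicator (fun _ => b j * A k) x := by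
    refine (norm_partialDeriv_le s _ x).trans ?_
    rw [e]
    exact tsum_of_norm_bounded hsi.hasSum fun j => hder k j x
  refine (mul_le_mul_of_nonneg_left h1 (V.pos n x).le).trans ?_
  rw [← tsum_mul_left]
  refine (hsi.mul_left _).tsum_le_tsum (fun j => ?_) ?_
  · by_cases hx : x ∈ Metric.closedBall (y j) 1
    · simp only [Set.indicator_of_mem hx]
      have h2 := hCv (y j) (x - y j) (by simpa [dist_eq_norm] using hx)
      rw [add_sub_cancel] at h2
      calc V.w n x * (b j * A k) ≤ C * V.w m (y j) * (b j * A k) :=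
            mul_le_mul_of_nonneg_right h2 (hbA k j)
        _ = _ := by ring
    · simp only [Set.indicator_of_notMem hx, mul_zero, le_refl]
  · have ht : ∀ j, 0 ≤ b j * V.w m (y j) * (C * A k) := fun j =>
      mul_nonneg (mul_nonneg (hb0 j) (hvm j)) (mul_nonneg hC.le (hA0 k))
    exact Summable.of_nonneg_of_le (fun j => Set.indicator_nonneg (fun _ _ => ht j) x)
      (fun j => hind (fun j => b j * V.w m (y j) * (C * A k)) ht j x) ((hbv m).mul_right _)

end Series

/-! ### Necessity of moderateness -/

section Necessity

open Filter Topology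

variable {d : ℕ} {V W : WeightSystem d}

theorem exists_nonneg_bump (d : ℕ) : ∃ (ψ : TestFn d) (p : Rd d → ℝ),
    (∀ x, 1 < ‖x‖ → ψ x = 0) ∧ (∀ x, 0 ≤ p x) ∧ (∀ x, ψ x = p x) ∧ p 0 = 1 := by
  let p : ContDiffBump (0 : Rd d) := ⟨1 / 2, 1, by norm_num, by norm_num⟩
  have hp : ∀ x, 1 < ‖x‖ → ((p x : ℝ) : ℂ) = 0 := fun x hx => by
    rw [p.zero_of_le_dist (by simpa using hx.le), Complex.ofReal_zero]
  exact ⟨TestFn.ofContDiff (fun x => ((p x : ℝ) : ℂ)) (Complex.ofRealCLM.contDiff.comp p.contDiff)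
    (hasCompactSupport_of_radius hp), p, hp, fun x => p.nonneg, fun _ => rfl,
    p.one_of_mem_closedBall (Metric.mem_closedBall_self p.rIn_pos.le)⟩

/-- `F` is known as a series of point masses only on `𝒟`, so it is evaluated on the cutoffs of `φ`.
There all terms are nonnegative and all but the `m`-th may be dropped; once the cutoff equals one at
`z - x m`, the bound no longer depends on it and passes to the limit. -/
theorem le_norm_convK1 (hV : V.WeaklyModerate) {F : K1Dual V.check} {c : ℕ → ℝ}
    {hc : Summable c} {hc0 : ∀ j, 0 ≤ c j} {x : ℕ → Rd d}
    (hF : restrictToTestFn V.check F = diracSeries c hc hc0 x) {φ : K1 V} {q : Rd d → ℝ}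
    (hq0 : ∀ z, 0 ≤ q z) (hq : ∀ z, (φ : Rd d → ℂ) z = q z) (m : ℕ) (z : Rd d) :
    c m * q (z - x m) ≤ ‖convK1 hV F φ z‖ := by
  obtain ⟨κ, u, hκ0, hκ1, hu, -, hlim⟩ := φ.exists_tendsto_toK1
  refine ge_of_tendsto (tendsto_convTestFn_convK1 hV F hlim z).norm ?_
  obtain ⟨N₀, hN₀⟩ := exists_nat_ge ‖z - x m‖
  filter_upwards [eventually_ge_atTop N₀] with N hN
  have hN' : ‖z - x m‖ ≤ N + 1 := by
    have : (N₀ : ℝ) ≤ N := by exact_mod_cast hN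
    linarith
  obtain ⟨M, -, hM⟩ := (u N).exists_norm_le
  have hterm : ∀ j, (c j : ℂ) * u N (z - x j) =
      ((c j * (κ N (z - x j) * q (z - x j)) : ℝ) : ℂ) := fun j => by
    rw [hu, hq]; push_cast; ring
  have hnn : ∀ j, 0 ≤ c j * (κ N (z - x j) * q (z - x j)) := fun j =>
    mul_nonneg (hc0 j) (mul_nonneg (hκ0 _ _) (hq0 _))
  have hs : Summable fun j => c j * (κ N (z - x j) * q (z - x j)) :=
    Summable.of_nonneg_of_le hnn (fun j => by
      have h1 := hM (z - x j)
      rw [hu, hq, ← Complex.ofReal_mul, Complex.norm_real,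
        Real.norm_of_nonneg (mul_nonneg (hκ0 _ _) (hq0 _))] at h1
      exact mul_le_mul_of_nonneg_left h1 (hc0 j)) (hc.mul_right M)
  have hval : convTestFn (restrictToTestFn V.check F) (u N) z =
      ((∑' j, c j * (κ N (z - x j) * q (z - x j)) : ℝ) : ℂ) := by
    rw [hF, Complex.ofReal_tsum]
    exact tsum_congr hterm
  rw [hval, Complex.norm_real, Real.norm_of_nonneg (tsum_nonneg hnn)]
  have h2 := hs.le_tsum m fun j _ => hnn j
  rwa [hκ1 N _ hN', one_mul] at h2

/-- Normalized coefficients making every weighted series summable along a sequence of points. -/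
theorem WeightSystem.summable_geometric_div (V : WeightSystem d) {l : ℕ → ℕ} (hl : ∀ m, m ≤ l m)
    (y : ℕ → Rd d) (k : ℕ) :
    Summable fun j => (1 / 2 : ℝ) ^ j / V.w (l j) (y j) * V.w k (y j) := by
  refine Summable.of_norm_bounded_eventually_nat summable_geometric_two ?_
  filter_upwards [eventually_ge_atTop k] with j hj
  have h0 := V.pos (l j) (y j)
  rw [norm_mul, norm_div, Real.norm_of_nonneg (V.pos k _).le, Real.norm_of_nonneg h0.le,
    Real.norm_of_nonneg (by positivity : (0 : ℝ) ≤ (1 / 2) ^ j), div_mul_eq_mul_div, div_le_iff₀ h0]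
  exact mul_le_mul_of_nonneg_left (V.mono (hj.trans (hl j)) _) (by positivity)

theorem WeightSystem.summable_geometric_div_one (V : WeightSystem d) (l : ℕ → ℕ)
    (y : ℕ → Rd d) : Summable fun j => (1 / 2 : ℝ) ^ j / V.w (l j) (y j) :=
  Summable.of_nonneg_of_le (fun j => div_nonneg (by positivity) (V.pos _ _).le)
    (fun _ => div_le_self (by positivity) (V.one_le _ _)) summable_geometric_two

variable {E : Type*} [NormedAddCommGroup E] [NormedSpace ℂ E]
  {ι : E →ₗ[ℂ] (Rd d →ₘ[(volume : Measure (Rd d))] ℂ)}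

theorem isModerate_of_subset (hE : IsTIBF ι) (hsolid : IsSolid ι) (hV : V.WeaklyModerate)
    (hW : W.WeaklyModerate) (h : OCTestFn ι W ⊆ restrictToTestFn V.check '' OCK1 ι hV W) :
    W.IsModerate V := by
  by_contra hcon
  simp only [WeightSystem.IsModerate] at hcon
  push Not at hcon
  obtain ⟨n, hn⟩ := hcon
  -- The negated condition requires an index at least `n`; an index at least `m` makes the
  -- normalizing weights eventually dominate every fixed weight.
  let l : ℕ → ℕ := fun m => max m n
  have hl : ∀ m, m ≤ l m := fun m => le_max_left _ _
  -- The factor `4 ^ m` absorbs the two factors `2 ^ (-m)` in `c m` and `b m`, leaving the unbounded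
  -- `m + 1`.
  choose x y hxy using fun m : ℕ => hn (l m) (le_max_right _ _) (4 ^ m * (m + 1)) (by positivity)
  let c : ℕ → ℝ := fun j => (1 / 2 : ℝ) ^ j / W.w (l j) (x j)
  let b : ℕ → ℝ := fun j => (1 / 2 : ℝ) ^ j / V.w (l j) (y j)
  have hc0 : ∀ j, 0 ≤ c j := fun j => div_nonneg (by positivity) (W.pos _ _).le
  have hb0 : ∀ j, 0 ≤ b j := fun j => div_nonneg (by positivity) (V.pos _ _).le
  have hc : Summable c := W.summable_geometric_div_one l x
  have hb : Summable b := V.summable_geometric_div_one l y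
  have hcb : ∀ m : ℕ, (m : ℝ) + 1 < c m * b m * W.w n (x m + y m) := by
    intro m
    have hw := W.pos (l m) (x m)
    have hv := V.pos (l m) (y m)
    have e : c m * b m * W.w n (x m + y m) =
        W.w n (x m + y m) / (4 ^ m * W.w (l m) (x m) * V.w (l m) (y m)) := by
      have h4 : (4 : ℝ) ^ m = 2 ^ m * 2 ^ m := by rw [← mul_pow]; norm_num
      simp only [c, b, h4, one_div, inv_pow]
      field_simp
    rw [e, lt_div_iff₀ (by positivity)]
    calc _ = 4 ^ m * ((m : ℝ) + 1) * W.w (l m) (x m) * V.w (l m) (y m) := by ring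
      _ < _ := hxy m
  obtain ⟨ψ, p, hψ1, hp0, hψp, hp1⟩ := exists_nonneg_bump d
  obtain ⟨M, -, hM⟩ := ψ.exists_norm_le
  have hpM : ∀ z, p z ≤ M := fun z => by
    have := hM z
    rwa [hψp, Complex.norm_real, Real.norm_of_nonneg (hp0 z)] at this
  obtain ⟨F, hF, hFf⟩ := h (diracSeries_mem_OCTestFn hE hsolid hW hc hc0
    (W.summable_geometric_div hl x))
  let φ : K1 V := K1.mk _ (tsum_translate_mem_K1Submodule hV hψ1 hb hb0
    (V.summable_geometric_div hl y))
  let q : Rd d → ℝ := fun z => ∑' j, b j * p (z - y j)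
  have hnn : ∀ z j, 0 ≤ b j * p (z - y j) := fun z j => mul_nonneg (hb0 j) (hp0 _)
  have hqs : ∀ z, Summable fun j => b j * p (z - y j) := fun z =>
    Summable.of_nonneg_of_le (hnn z)
      (fun j => mul_le_mul_of_nonneg_left (hpM _) (hb0 j)) (hb.mul_right M)
  have hq : ∀ z, (φ : Rd d → ℂ) z = q z := fun z => by
    rw [Complex.ofReal_tsum]
    exact tsum_congr fun j => by rw [hψp, Complex.ofReal_mul]
  have hlow : ∀ m z, c m * b m * p (z - (x m + y m)) ≤ ‖convK1 hV F φ z‖ := fun m z => by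
    refine le_trans ?_ (le_norm_convK1 hV hFf (fun z => tsum_nonneg (hnn z)) hq m z)
    have h1 := (hqs (z - x m)).le_tsum m fun j _ => hnn _ j
    rw [mul_assoc, ← sub_sub]
    exact mul_le_mul_of_nonneg_left h1 (hc0 m)
  obtain ⟨k, C, hC, hCw⟩ := hW.closedBall 1 n
  obtain ⟨C₀, hC₀, hT⟩ := hE.exists_translate
  obtain ⟨e, he⟩ := (hF φ).2 k
  obtain ⟨e₁, he₁⟩ := hE.exists_represents_indicator hsolid 1
  obtain ⟨e₂, he₂, -⟩ := (he₁.smul (M : ℂ)).dominated hsolid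
    (h := ψ) ψ.continuous.locallyIntegrable fun z => by
      by_cases hz : z ∈ Metric.closedBall (0 : Rd d) 1
      · simpa [Set.indicator_of_mem hz] using (hM z).trans (le_abs_self M)
      · rw [hψ1 z (by simpa using hz), norm_zero]
        exact norm_nonneg _
  -- `e₂` is the class of the bump `ψ`; a continuous function with value one at the origin is not
  -- zero almost everywhere.
  have he₂0 : 0 < ‖e₂‖ := by
    refine norm_pos_iff.2 fun h0 => ?_
    have h1 : (fun _ => (0 : ℂ)) =ᵐ[volume] ψ := (represents_zero (ι := ι)).symm.trans (h0 ▸ he₂)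
    have h2 := congrFun ((continuous_const.ae_eq_iff_eq _ ψ.continuous).1 h1) 0
    rw [hψp, hp1] at h2
    simp at h2
  -- After translation by `-(x m + y m)` the weighted convolution dominates, up to `C`, the multiple
  -- `c m * b m * W.w n (x m + y m)` of the fixed bump: (wM) replaces the weight at the centre by
  -- `w_k` at nearby points. Boundedness of translations makes the right side independent of `m`.
  have hbound : ∀ m : ℕ, ((m : ℝ) + 1) * ‖e₂‖ ≤ C * (C₀ * ‖e‖) := by
    intro m
    obtain ⟨e₃, he₃, h3⟩ := hT (-(x m + y m)) e _ he
    have hpos : 0 ≤ c m * b m * W.w n (x m + y m) := by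
      have := hcb m
      have : (0 : ℝ) ≤ m := m.cast_nonneg
      linarith
    obtain ⟨e₄, he₄, h4⟩ := (he₃.smul (C : ℂ)).dominated hsolid
      (h := fun z => ((c m * b m * W.w n (x m + y m) : ℝ) : ℂ) * ψ z)
      (continuous_const.mul ψ.continuous).locallyIntegrable fun z => by
        rw [norm_mul, norm_mul, norm_mul, Complex.norm_real, Complex.norm_real,
          Real.norm_of_nonneg hpos, Real.norm_of_nonneg hC.le, W.norm_coe, sub_neg_eq_add]
        by_cases hz : ‖z‖ ≤ 1
        · have h5 := hlow m (z + (x m + y m))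
          have h6 := hCw (z + (x m + y m)) (-z) (by simpa using hz)
          rw [add_sub_cancel_right] at h5
          rw [add_neg_cancel_comm] at h6
          rw [hψp, Complex.norm_real, Real.norm_of_nonneg (hp0 z)]
          calc _ = W.w n (x m + y m) * (c m * b m * p z) := by ring
            _ ≤ C * W.w k (z + (x m + y m)) * ‖convK1 hV F φ (z + (x m + y m))‖ :=
              mul_le_mul h6 h5 (mul_nonneg (mul_nonneg (hc0 m) (hb0 m)) (hp0 z))
                (mul_nonneg hC.le (W.pos _ _).le)
            _ = _ := by ring
        · rw [hψ1 z (not_le.1 hz), norm_zero, mul_zero]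
          have := (W.pos k (z + (x m + y m))).le
          positivity
    rw [he₄.unique hE (he₂.smul _), norm_smul, norm_smul, Complex.norm_real, Complex.norm_real,
      Real.norm_of_nonneg hpos, Real.norm_of_nonneg hC.le] at h4
    calc _ ≤ c m * b m * W.w n (x m + y m) * ‖e₂‖ :=
          mul_le_mul_of_nonneg_right (hcb m).le (norm_nonneg _)
      _ ≤ C * ‖e₃‖ := h4
      _ ≤ _ := mul_le_mul_of_nonneg_left h3 hC.le
  obtain ⟨m, hm⟩ := exists_nat_gt (C * (C₀ * ‖e‖) / ‖e₂‖)
  rw [div_lt_iff₀ he₂0] at hm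
  have := hbound m
  linarith [add_mul (m : ℝ) 1 ‖e₂‖]

end Necessity

/-! ### The theorem: restriction, injectivity and the criterion for equality. -/

theorem theoremt {d : ℕ} {E : Type*} [NormedAddCommGroup E] [NormedSpace ℂ E]
    (ι : E →ₗ[ℂ] (Rd d →ₘ[(volume : Measure (Rd d))] ℂ)) (hE : IsTIBF ι) (hsolid : IsSolid ι)
    (V W : WeightSystem d) (hV : V.WeaklyModerate) (hW : W.WeaklyModerate) :
    Set.MapsTo (restrictToTestFn V.check) (OCK1 ι hV W) (OCTestFn ι W) ∧
    Set.InjOn (restrictToTestFn V.check) (OCK1 ι hV W) ∧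
    (restrictToTestFn V.check '' OCK1 ι hV W = OCTestFn ι W ↔ W.IsModerate V) := by
  have hmaps : Set.MapsTo (restrictToTestFn V.check) (OCK1 ι hV W) (OCTestFn ι W) :=
    fun F hF ψ => convK1_toK1 hV F ψ ▸ hF (TestFn.toK1 V ψ)
  refine ⟨hmaps, restrictToTestFn_injective.injOn,
    fun h => isModerate_of_subset hE hsolid hV hW h.superset,
    fun hmod => hmaps.image_subset.antisymm fun f hf => ?_⟩
  obtain ⟨F, rfl⟩ := exists_restrictToTestFn_eq hE hV hW hmod hf
  exact ⟨F, mem_OCK1_of_isModerate hE hsolid hV hmod hf, rfl⟩
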